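/- **Theorem (existence and uniqueness of the linearised discrete solution).** Let $\Omega\subset\mathbb R^2$ be a convex domain with a conforming mesh $\mathcal T_h$ of finitely many disjoint open simple polygons $K$, $\overline\Omega=\bigcup_K\overline K$ (two edges of different elements coincide or meet at most in common endpoints; hanging nodes count as vertices). Let $\ell\ge 2$, $\varepsilon>0$, and let $u_\varepsilon\in W^{2,\infty}(\Omega)$ be strictly convex in the sense that $\Phi_\varepsilon=\operatorname{cof}(D^2u_\varepsilon)$ satisfies $\xi^\top\Phi_\varepsilon\xi\ge\beta|\xi|^2$ a.e. in $\Omega$ for all $\xi\in\mathbb R^2$, with some $\beta>0$ (for instance, the solution of the vanishing moment problem $-\varepsilon\Delta^2u_\varepsilon+\det D^2u_\varepsilon=f$ in $\Omega$, $u_\varepsilon=g$ and $\Delta u_\varepsilon=\varepsilon$ on $\partial\Omega$, if it has these properties). $\mathbb P_k$ denotes polynomials of degree $\le k$, $\mathbb P_k=\{0\}$ for $k<0$; $n$ and $\tau$ are the outward unit normal and the counterclockwise unit tangent of $K$. *Local spaces.* $\widetilde V^K=\{v\in H^2(K):\Delta^2v\in\mathbb P_\ell(K),\ v|_e\in\mathbb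 P_\ell(e),\ \Delta v|_e\in\mathbb P_{\ell-2}(e)\ \forall e\subset\partial K\}$, where $\Delta^2v=p$, $\Delta v|_e=q_e$ mean that $\int_K\Delta v\,\Delta w=\int_Kp\,w+\sum_e\int_eq_e\,\partial_nw$ for all $w\in H^2(K)\cap H^1_0(K)$. Fix bases of $\mathbb P_{\ell-2}(e)$ and of $\mathbb P_{\ell-4}(K)$; the degrees of freedom $\Lambda^K$ are the vertex values of $v$, the moments $\frac1{|e|}\int_ev\,p$ and $\int_e\partial_nv\,p$ for $p$ in the basis of $\mathbb P_{\ell-2}(e)$, and $\frac1{|K|}\int_Kv\,p$ for $p$ in the basis of $\mathbb P_{\ell-4}(K)$. *Projections.* Let $\Pi_0^K:\widetilde V^K\to\mathbb P_\ell(K)$, $\Pi_0^e:\widetilde V^K\to\mathbb P_\ell(e)$, $\Pi_n^e:\widetilde V^K\to\mathbb P_{\ell-1}(e)$ be any linear combinations of the degrees of freedom such that: $\int_K\Pi_0^Kv\,p=\int_Kv\,p$ for $p\in\mathbb P_{\ell-4}(K)$; $\Pi_0^ev$ equals $v$ at the endpoints of $e$, and $\int_e\Pi_0^ev\,p=\int_ev\,p$,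 $\int_e\Pi^e_nv\,p=\int_e\partial_nv\,p$ for $p\in\mathbb P_{\ell-2}(e)$; and $\Pi_0^Kq=q$, $\Pi_0^eq=q|_e$, $\Pi_n^eq=\partial_nq|_e$ for $q\in\mathbb P_\ell(K)$. Define $\Pi_1^Kv\in[\mathbb P_{\ell-1}(K)]^2$ and $\Pi_2^Kv\in[\mathbb P_{\ell-2}(K)]^{2\times2}$ by $$\int_K\Pi_1^Kv\cdot p=-\int_K\Pi_0^Kv\,\operatorname{div}p+\sum_{e\subset\partial K}\int_e\Pi_0^ev\,p\cdot n\qquad\forall p\in[\mathbb P_{\ell-1}(K)]^2,$$ $$\int_K\Pi_2^Kv:p=-\int_K\Pi_1^Kv\cdot\operatorname{div}p+\sum_{e\subset\partial K}\int_e\big(\Pi_n^ev\,(n\otimes n):p+\partial_\tau(\Pi_0^ev)\,(\tau\otimes n):p\big)\qquad\forall p\in[\mathbb P_{\ell-2}(K)]^{2\times2},$$ and $V^K=\{v\in\widetilde V^K:\int_K(v-\Pi_0^Kv)p=0\ \ \forall p\in\mathbb P_\ell(K)\setminus\mathbb P_{\ell-4}(K)\}$. *Discrete problem.* $V_{h,\ell,0}$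 consists of all $v\in H^1_0(\Omega)$ with $v|_K\in V^K$ for all $K$ and $\int_e[\partial_{n_e}v]\,p=0$ for all interior edges $e$ and $p\in\mathbb P_{\ell-2}(e)$, where $[\cdot]$ is the jump across $e$. With $h_K=\operatorname{diam}K$ put $A_{L,h}=\sum_KA^K_{L,h}$, $$A^K_{L,h}(v,w)=\varepsilon\int_K\Pi_2^Kv:\Pi_2^Kw+\int_K\Phi_\varepsilon\Pi_1^Kv\cdot\Pi_1^Kw+\big(\varepsilon h_K^{-2}+\|\Phi_\varepsilon\|_{L^\infty(K)}\big)\sum_{\lambda\in\Lambda^K}\lambda(v-\Pi_0^Kv)\,\lambda(w-\Pi_0^Kw).$$ Then for every $\varphi\in L^2(\Omega)$ and every $\psi\in H^{-1/2}(\partial\Omega)=(H^{1/2}(\partial\Omega))'$ there is exactly one $v_h\in V_{h,\ell,0}$ with $$A_{L,h}(v_h,w_h)=\int_\Omega\varphi\,w_h+\varepsilon\sum_{e\subset\partial\Omega}\int_e\psi\,\Pi_n^ew_h\qquad\forall w_h\in V_{h,\ell,0}.$$ Here, since a piecewise polynomial on $\partial\Omega$ need not belong to $H^{1/2}(\partial\Omega)$,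 the edge pairings $q\mapsto\int_e\psi\,q$ on $\mathbb P_{\ell-1}(e)$ may be any linear functionals with $\sum_{e\subset\partial\Omega}\int_e\psi\,q_e=\langle\psi,g\rangle$ whenever $g\in H^{1/2}(\partial\Omega)$ and $g|_e=q_e\in\mathbb P_{\ell-1}(e)$ for all boundary edges $e$. -/

import Mathlib

open MeasureTheory Set Filter Topology
open scoped ENNReal ContDiff

noncomputable section

namespace VEM

/-- The Euclidean plane. -/
abbrev Plane : Type := EuclideanSpace ℝ (Fin 2)

/-! ### Sobolev spaces through weak derivatives -/

/-- The `i`-th classical partial derivative. -/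
def partialDeriv (i : Fin 2) (f : Plane → ℝ) (x : Plane) : ℝ :=
  fderiv ℝ f x (EuclideanSpace.single i 1)

/-- `φ ∈ C_c^∞(U)`. -/
def IsTestFunction (U : Set Plane) (φ : Plane → ℝ) : Prop :=
  ContDiff ℝ ∞ φ ∧ HasCompactSupport φ ∧ tsupport φ ⊆ U

/-- `g` is the `i`-th weak partial derivative of `f` on `U`. -/
def IsWeakDeriv (U : Set Plane) (i : Fin 2) (f g : Plane → ℝ) : Prop :=
  ∀ φ : Plane → ℝ, IsTestFunction U φ →
    ∫ x in U, f x * partialDeriv i φ x = - ∫ x in U, g x * φ x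

/-- `f ∈ L²(U)`. -/
def MemL2 (U : Set Plane) (f : Plane → ℝ) : Prop :=
  MemLp f 2 (volume.restrict U)

/-- `f` has an `i`-th weak partial derivative in `L²(U)`. -/
def HasL2Deriv (U : Set Plane) (i : Fin 2) (f : Plane → ℝ) : Prop :=
  ∃ g : Plane → ℝ, MemL2 U g ∧ IsWeakDeriv U i f g

open Classical in
/-- The `i`-th weak partial derivative in `L²(U)`; it is unique up to null sets
(and `0` by convention if there is none). -/
def weakDeriv (U : Set Plane) (i : Fin 2) (f : Plane → ℝ) : Plane → ℝ :=
  if h : HasL2Deriv U i f then h.choose else 0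

/-- `f ∈ H¹(U)`. -/
def MemH1 (U : Set Plane) (f : Plane → ℝ) : Prop :=
  MemL2 U f ∧ ∀ i, HasL2Deriv U i f

/-- `f ∈ H²(U)`. -/
def MemH2 (U : Set Plane) (f : Plane → ℝ) : Prop :=
  MemH1 U f ∧ ∀ i, MemH1 U (weakDeriv U i f)

/-- `f ∈ H¹₀(U)`, the closure of `C_c^∞(U)` in `H¹(U)`. -/
def MemH10 (U : Set Plane) (f : Plane → ℝ) : Prop :=
  MemH1 U f ∧ ∀ δ : ℝ≥0∞, 0 < δ → ∃ φ : Plane → ℝ, IsTestFunction U φ ∧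
    eLpNorm (fun x => f x - φ x) 2 (volume.restrict U) < δ ∧
    ∀ i, eLpNorm (fun x => weakDeriv U i f x - partialDeriv i φ x) 2 (volume.restrict U) < δ

/-- The weak Hessian. -/
def weakHessian (U : Set Plane) (f : Plane → ℝ) (x : Plane) : Matrix (Fin 2) (Fin 2) ℝ :=
  Matrix.of fun i j => weakDeriv U j (weakDeriv U i f) x

/-- The weak Laplacian. -/
def weakLaplacian (U : Set Plane) (f : Plane → ℝ) (x : Plane) : ℝ :=
  ∑ i, weakDeriv U i (weakDeriv U i f) x

/-! ### Polynomials -/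

/-- Bivariate polynomials of degree at most `k`; this is `{0}` for `k < 0`. -/
def Poly (k : ℤ) : Submodule ℝ (MvPolynomial (Fin 2) ℝ) :=
  MvPolynomial.restrictSupport ℝ {s : Fin 2 →₀ ℕ | (s.degree : ℤ) ≤ k}

/-- The function on the plane given by a bivariate polynomial. -/
def polyFun (p : MvPolynomial (Fin 2) ℝ) (x : Plane) : ℝ :=
  MvPolynomial.eval (fun i => x i) p

/-- Polynomials of degree at most `k` on an edge, written in the affine parameter `t ∈ [0, 1]` of
that edge; this is `{0}` for `k < 0`. -/
def EdgePoly (k : ℤ) : Submodule ℝ (Polynomial ℝ) :=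
  Polynomial.degreeLT ℝ (k + 1).toNat

/-! ### Polygons -/

/-- A simple polygon, as an open set with its vertices in counterclockwise order. Two consecutive
edges may be collinear, so that hanging nodes are allowed as vertices. -/
structure Polygon where
  /-- The number of vertices is `m + 3`. -/
  m : ℕ
  /-- The vertices; the index is cyclic. -/
  vertex : Fin (m + 3) → Plane
  vertex_injective : Function.Injective vertex
  /-- The boundary curve does not meet itself. -/
  simple : ∀ i j, i ≠ j →
    Disjoint (openSegment ℝ (vertex i) (vertex (i + 1))) (segment ℝ (vertex j) (vertex (j + 1)))
  /-- The open region. -/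
  carrier : Set Plane
  isOpen_carrier : IsOpen carrier
  isConnected_carrier : IsConnected carrier
  isBounded_carrier : Bornology.IsBounded carrier
  frontier_carrier : frontier carrier = ⋃ i, segment ℝ (vertex i) (vertex (i + 1))
  /-- The region lies to the left of each edge, and not to its right. -/
  left_side : ∀ i, ∀ x ∈ openSegment ℝ (vertex i) (vertex (i + 1)), ∀ᶠ t : ℝ in 𝓝[>] 0,
    x - t • (!₂[vertex (i + 1) 1 - vertex i 1, vertex i 0 - vertex (i + 1) 0] : Plane) ∈ carrier ∧
    x + t • (!₂[vertex (i + 1) 1 - vertex i 1, vertex i 0 - vertex (i + 1) 0] : Plane) ∉ carrier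

namespace Polygon

variable (K : Polygon)

/-- Index type of the vertices, and of the edges: edge `i` joins vertex `i` to vertex `i + 1`. -/
abbrev Idx : Type := Fin (K.m + 3)

/-- Edge `i` as a closed segment. -/
def edge (i : K.Idx) : Set Plane := segment ℝ (K.vertex i) (K.vertex (i + 1))

/-- Edge `i` without its endpoints. -/
def openEdge (i : K.Idx) : Set Plane := openSegment ℝ (K.vertex i) (K.vertex (i + 1))

/-- The point of edge `i` with affine parameter `t`. -/
def edgePoint (i : K.Idx) (t : ℝ) : Plane :=
  AffineMap.lineMap (K.vertex i) (K.vertex (i + 1)) t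

/-- The length of edge `i`. -/
def edgeLength (i : K.Idx) : ℝ := dist (K.vertex i) (K.vertex (i + 1))

/-- The outward unit normal on edge `i`. -/
def normal (i : K.Idx) : Plane :=
  (K.edgeLength i)⁻¹ • !₂[K.vertex (i + 1) 1 - K.vertex i 1, K.vertex i 0 - K.vertex (i + 1) 0]

/-- The counterclockwise unit tangent on edge `i`. -/
def tangent (i : K.Idx) : Plane :=
  (K.edgeLength i)⁻¹ • (K.vertex (i + 1) - K.vertex i)

/-- The arc length integral over edge `i` of a function of the affine parameter. -/
def edgeIntegral (i : K.Idx) (f : ℝ → ℝ) : ℝ :=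
  K.edgeLength i * ∫ t in (0 : ℝ)..1, f t

/-- The area. -/
def area : ℝ := (volume K.carrier).toReal

/-- `g` is the normal derivative of `v ∈ H²(K)` on the boundary: an `L²` function there for which
Green's formula holds. By the trace theorem there is exactly one, up to null sets. -/
def IsNormalTrace (v g : Plane → ℝ) : Prop :=
  (∀ i, MemLp (fun t => g (K.edgePoint i t)) 2 (volume.restrict (Icc (0 : ℝ) 1))) ∧
  ∀ φ : Plane → ℝ, ContDiff ℝ ∞ φ →
    ∫ x in K.carrier, (weakLaplacian K.carrier v x * φ x +
        ∑ j, weakDeriv K.carrier j v x * partialDeriv j φ x) =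
      ∑ i, K.edgeIntegral i (fun t => g (K.edgePoint i t) * φ (K.edgePoint i t))

open Classical in
/-- The outward normal derivative on the boundary. -/
def normalTrace (v : Plane → ℝ) : Plane → ℝ :=
  if h : ∃ g, K.IsNormalTrace v g then h.choose else 0

/-- The enlarged local virtual element space: the `v ∈ H²(K)` with `Δ²v ∈ P_ℓ(K)`, and
`v ∈ P_ℓ(e)`, `Δv ∈ P_{ℓ-2}(e)` on each edge `e`. A function of `H²(K)` is represented by its
continuous version on the closed polygon, so that vertex and edge values are pointwise ones, and
its normal derivative on the boundary exists. As `v` is only in `H²(K)`, the equation `Δ²v = p` in `K` and the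
conditions `Δv = q_e` on the edges are meant in the weak sense, against all test functions
of `H²(K) ∩ H¹₀(K)`. -/
def MemEnlarged (ℓ : ℕ) (v : Plane → ℝ) : Prop :=
  MemH2 K.carrier v ∧
  ContinuousOn v (closure K.carrier) ∧
  (∃ g, K.IsNormalTrace v g) ∧
  (∀ i, ∃ r ∈ EdgePoly ℓ, ∀ t ∈ Icc (0 : ℝ) 1, v (K.edgePoint i t) = r.eval t) ∧
  ∃ p ∈ Poly ℓ, ∃ q : K.Idx → EdgePoly ((ℓ : ℤ) - 2),
    ∀ w g : Plane → ℝ, MemH2 K.carrier w → MemH10 K.carrier w → K.IsNormalTrace w g →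
      ∫ x in K.carrier, weakLaplacian K.carrier v x * weakLaplacian K.carrier w x =
        (∫ x in K.carrier, polyFun p x * w x) +
          ∑ i, K.edgeIntegral i (fun t => (q i : Polynomial ℝ).eval t * g (K.edgePoint i t))

/-! ### Degrees of freedom -/

/-- The polynomial bases that enter the degrees of freedom. -/
structure DofBasis (ℓ : ℕ) where
  /-- For the moments of the values on the edges. -/
  edge : K.Idx → Module.Basis (Fin (ℓ - 1)) ℝ (EdgePoly ((ℓ : ℤ) - 2))
  /-- For the moments of the normal derivative on the edges. -/
  normal : K.Idx → Module.Basis (Fin (ℓ - 1)) ℝ (EdgePoly ((ℓ : ℤ) - 2))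
  /-- For the interior moments. -/
  interior : Module.Basis (Fin (Module.finrank ℝ (Poly ((ℓ : ℤ) - 4)))) ℝ (Poly ((ℓ : ℤ) - 4))

/-- Index type of the degrees of freedom: vertices, edge moments, normal moments, interior
moments. -/
abbrev DofIdx (ℓ : ℕ) : Type :=
  K.Idx ⊕ (K.Idx × Fin (ℓ - 1)) ⊕ (K.Idx × Fin (ℓ - 1)) ⊕
    Fin (Module.finrank ℝ (Poly ((ℓ : ℤ) - 4)))

variable {K}

/-- The degrees of freedom of `v`. -/
def dof {ℓ : ℕ} (B : K.DofBasis ℓ) (v : Plane → ℝ) : K.DofIdx ℓ → ℝ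
  | .inl i => v (K.vertex i)
  | .inr (.inl (i, r)) => (K.edgeLength i)⁻¹ *
      K.edgeIntegral i (fun t => v (K.edgePoint i t) * (B.edge i r : Polynomial ℝ).eval t)
  | .inr (.inr (.inl (i, r))) =>
      K.edgeIntegral i
        (fun t => K.normalTrace v (K.edgePoint i t) * (B.normal i r : Polynomial ℝ).eval t)
  | .inr (.inr (.inr r)) =>
      K.area⁻¹ * ∫ x in K.carrier, v x * polyFun (B.interior r) x

/-! ### Projections -/

/-- Admissible value, edge and edge normal projections: linear combinations of the degrees of
freedom, with prescribed moments, and exact on `P_ℓ(K)`. -/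
structure Projections {ℓ : ℕ} (B : K.DofBasis ℓ) where
  /-- The value projection as a function of the degrees of freedom. -/
  value : (K.DofIdx ℓ → ℝ) →ₗ[ℝ] Poly ℓ
  /-- The edge projections as functions of the degrees of freedom. -/
  edge : K.Idx → (K.DofIdx ℓ → ℝ) →ₗ[ℝ] EdgePoly ℓ
  /-- The edge normal projections as functions of the degrees of freedom. -/
  normal : K.Idx → (K.DofIdx ℓ → ℝ) →ₗ[ℝ] EdgePoly ((ℓ : ℤ) - 1)
  value_moment : ∀ v, K.MemEnlarged ℓ v → ∀ p ∈ Poly ((ℓ : ℤ) - 4),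
    ∫ x in K.carrier, polyFun (value (dof B v)) x * polyFun p x =
      ∫ x in K.carrier, v x * polyFun p x
  value_poly : ∀ q ∈ Poly ℓ, (value (dof B (polyFun q)) : MvPolynomial (Fin 2) ℝ) = q
  edge_left : ∀ v, K.MemEnlarged ℓ v → ∀ i,
    (edge i (dof B v) : Polynomial ℝ).eval 0 = v (K.vertex i)
  edge_right : ∀ v, K.MemEnlarged ℓ v → ∀ i,
    (edge i (dof B v) : Polynomial ℝ).eval 1 = v (K.vertex (i + 1))
  edge_moment : ∀ v, K.MemEnlarged ℓ v → ∀ i, ∀ p ∈ EdgePoly ((ℓ : ℤ) - 2),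
    K.edgeIntegral i (fun t => (edge i (dof B v) : Polynomial ℝ).eval t * p.eval t) =
      K.edgeIntegral i (fun t => v (K.edgePoint i t) * p.eval t)
  edge_poly : ∀ q ∈ Poly ℓ, ∀ i, ∀ t ∈ Icc (0 : ℝ) 1,
    (edge i (dof B (polyFun q)) : Polynomial ℝ).eval t = polyFun q (K.edgePoint i t)
  normal_moment : ∀ v, K.MemEnlarged ℓ v → ∀ i, ∀ p ∈ EdgePoly ((ℓ : ℤ) - 2),
    K.edgeIntegral i (fun t => (normal i (dof B v) : Polynomial ℝ).eval t * p.eval t) =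
      K.edgeIntegral i (fun t => K.normalTrace v (K.edgePoint i t) * p.eval t)
  normal_poly : ∀ q ∈ Poly ℓ, ∀ i, ∀ t ∈ Icc (0 : ℝ) 1,
    (normal i (dof B (polyFun q)) : Polynomial ℝ).eval t =
      fderiv ℝ (polyFun q) (K.edgePoint i t) (K.normal i)

namespace Projections

variable {ℓ : ℕ} {B : K.DofBasis ℓ} (P : Projections B)

/-- The value projection of `v`. -/
def valueProj (v : Plane → ℝ) : MvPolynomial (Fin 2) ℝ := P.value (dof B v)

/-- The edge projection of `v` on edge `i`. -/
def edgeProj (i : K.Idx) (v : Plane → ℝ) : Polynomial ℝ := P.edge i (dof B v)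

/-- The edge normal projection of `v` on edge `i`. -/
def normalProj (i : K.Idx) (v : Plane → ℝ) : EdgePoly ((ℓ : ℤ) - 1) := P.normal i (dof B v)

/-- The variational identity that defines the gradient projection. -/
def IsGradProj (v : Plane → ℝ) (G : Fin 2 → MvPolynomial (Fin 2) ℝ) : Prop :=
  (∀ j, G j ∈ Poly ((ℓ : ℤ) - 1)) ∧
  ∀ p : Fin 2 → MvPolynomial (Fin 2) ℝ, (∀ j, p j ∈ Poly ((ℓ : ℤ) - 1)) →
    ∫ x in K.carrier, ∑ j, polyFun (G j) x * polyFun (p j) x =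
      - (∫ x in K.carrier, polyFun (P.valueProj v) x *
          ∑ j, polyFun (MvPolynomial.pderiv j (p j)) x) +
      ∑ i, K.edgeIntegral i (fun t => (P.edgeProj i v).eval t *
          ∑ j, polyFun (p j) (K.edgePoint i t) * K.normal i j)

/-- The gradient projection (the unique solution of its variational identity). -/
def gradProj (v : Plane → ℝ) : Fin 2 → MvPolynomial (Fin 2) ℝ :=
  Classical.epsilon (P.IsGradProj v)

/-- The variational identity that defines the Hessian projection. -/
def IsHessProj (v : Plane → ℝ) (H : Fin 2 → Fin 2 → MvPolynomial (Fin 2) ℝ) : Prop :=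
  (∀ a b, H a b ∈ Poly ((ℓ : ℤ) - 2)) ∧
  ∀ p : Fin 2 → Fin 2 → MvPolynomial (Fin 2) ℝ, (∀ a b, p a b ∈ Poly ((ℓ : ℤ) - 2)) →
    ∫ x in K.carrier, ∑ a, ∑ b, polyFun (H a b) x * polyFun (p a b) x =
      - (∫ x in K.carrier, ∑ a, polyFun (P.gradProj v a) x *
          ∑ b, polyFun (MvPolynomial.pderiv b (p a b)) x) +
      ∑ i, K.edgeIntegral i (fun t =>
        (P.normalProj i v : Polynomial ℝ).eval t *
          (∑ a, ∑ b, K.normal i a * K.normal i b * polyFun (p a b) (K.edgePoint i t)) +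
        ((K.edgeLength i)⁻¹ * (P.edgeProj i v).derivative.eval t) *
          (∑ a, ∑ b, K.tangent i a * K.normal i b * polyFun (p a b) (K.edgePoint i t)))

/-- The Hessian projection (the unique solution of its variational identity). -/
def hessProj (v : Plane → ℝ) : Fin 2 → Fin 2 → MvPolynomial (Fin 2) ℝ :=
  Classical.epsilon (P.IsHessProj v)

/-- The local virtual element space. -/
def MemLocal (v : Plane → ℝ) : Prop :=
  K.MemEnlarged ℓ v ∧
  ∀ p ∈ Poly ℓ, p ∉ Poly ((ℓ : ℤ) - 4) →
    ∫ x in K.carrier, (v x - polyFun (P.valueProj v) x) * polyFun p x = 0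

end Projections

end Polygon

/-! ### Meshes and the global space -/

/-- A conforming polygonal mesh of `Ω`: finitely many disjoint polygons whose closures cover the
closure of `Ω`; edges of two different polygons coincide or meet at most in common endpoints. -/
structure Mesh (Ω : Set Plane) where
  /-- The number of elements. -/
  N : ℕ
  /-- The elements. -/
  element : Fin N → Polygon
  disjoint : ∀ k k', k ≠ k' → Disjoint (element k).carrier (element k').carrier
  cover : ⋃ k, closure (element k).carrier = closure Ω
  conforming : ∀ k k', k ≠ k' → ∀ i j, (element k).edge i = (element k').edge j ∨
    Disjoint ((element k).openEdge i) ((element k').edge j)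

namespace Mesh

variable {Ω : Set Plane} (T : Mesh Ω)

/-- Pairs of an element and one of its edges. -/
abbrev EdgeIdx : Type := Σ k : Fin T.N, (T.element k).Idx

open Classical in
/-- The edges on the boundary of `Ω`. -/
def boundaryEdges : Finset T.EdgeIdx :=
  Finset.univ.filter fun e => (T.element e.1).edge e.2 ⊆ frontier Ω

/-- A choice of degrees of freedom on every element. -/
abbrev DofBases (ℓ : ℕ) : Type := ∀ k, (T.element k).DofBasis ℓ

variable {T}

/-- A choice of admissible projections on every element. -/
abbrev Projections {ℓ : ℕ} (B : T.DofBases ℓ) : Type := ∀ k, Polygon.Projections (B k)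

variable {ℓ : ℕ} {B : T.DofBases ℓ} (P : Projections B)

/-- The global virtual element space with zero boundary values. The members are represented by
their continuous versions on the closure of `Ω`, extended by zero. The jump of the
normal derivative over an interior edge is the sum of the two outward normal derivatives. -/
def space : Set (Plane → ℝ) :=
  {v | MemH10 Ω v ∧ ContinuousOn v (closure Ω) ∧ (∀ x ∉ closure Ω, v x = 0) ∧
    (∀ k, (P k).MemLocal v) ∧
    ∀ k k', k ≠ k' → ∀ i j, (T.element k).edge i = (T.element k').edge j →
      ∀ p ∈ EdgePoly ((ℓ : ℤ) - 2),
        (T.element k).edgeIntegral i (fun t =>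
          ((T.element k).normalTrace v ((T.element k).edgePoint i t) +
            (T.element k').normalTrace v ((T.element k).edgePoint i t)) * p.eval t) = 0}

end Mesh

/-! ### The discrete form -/

/-- The cofactor matrix. -/
def cof (A : Matrix (Fin 2) (Fin 2) ℝ) : Matrix (Fin 2) (Fin 2) ℝ := A.adjugate.transpose

/-- The `L^∞(U)` norm of a matrix field, with the Frobenius norm for matrices. -/
def supNorm (U : Set Plane) (Φ : Plane → Matrix (Fin 2) (Fin 2) ℝ) : ℝ :=
  (eLpNorm (fun x => Real.sqrt (∑ a, ∑ b, Φ x a b ^ 2)) ⊤ (volume.restrict U)).toReal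

/-- The dofi-dofi stabilisation on one element. -/
def stab {K : Polygon} {ℓ : ℕ} (B : K.DofBasis ℓ) (ε : ℝ)
    (Φ : Plane → Matrix (Fin 2) (Fin 2) ℝ) (u v : Plane → ℝ) : ℝ :=
  (ε * (Metric.diam K.carrier ^ 2)⁻¹ + supNorm K.carrier Φ) *
    ∑ s, Polygon.dof B u s * Polygon.dof B v s

/-- The discrete linearised form on one element. -/
def localForm {K : Polygon} {ℓ : ℕ} {B : K.DofBasis ℓ} (P : Polygon.Projections B) (ε : ℝ)
    (Φ : Plane → Matrix (Fin 2) (Fin 2) ℝ) (u v : Plane → ℝ) : ℝ :=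
  ε * (∫ x in K.carrier, ∑ a, ∑ b, polyFun (P.hessProj u a b) x * polyFun (P.hessProj v a b) x) +
  (∫ x in K.carrier, ∑ a, ∑ b,
    Φ x a b * polyFun (P.gradProj u b) x * polyFun (P.gradProj v a) x) +
  stab B ε Φ (fun x => u x - polyFun (P.valueProj u) x) (fun x => v x - polyFun (P.valueProj v) x)

/-- The global discrete linearised form. -/
def discreteForm {Ω : Set Plane} {T : Mesh Ω} {ℓ : ℕ} {B : T.DofBases ℓ}
    (P : Mesh.Projections B) (ε : ℝ)
    (Φ : Plane → Matrix (Fin 2) (Fin 2) ℝ) (u v : Plane → ℝ) : ℝ :=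
  ∑ k, localForm (P k) ε Φ u v

/-! ### Boundary data -/

/-- The `H^{1/2}(∂Ω)` norm (Sobolev–Slobodeckij), with respect to arc length. -/
def hHalfNorm (Ω : Set Plane) (g : Plane → ℝ) : ℝ≥0∞ :=
  ((∫⁻ x in frontier Ω, ‖g x‖ₑ ^ 2 ∂(Measure.hausdorffMeasure 1)) +
    ∫⁻ x in frontier Ω, ∫⁻ y in frontier Ω, (‖g x - g y‖ₑ / edist x y) ^ 2
      ∂(Measure.hausdorffMeasure 1) ∂(Measure.hausdorffMeasure 1)) ^ (1 / 2 : ℝ)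

/-- `g ∈ H^{1/2}(∂Ω)`. -/
def MemHHalf (Ω : Set Plane) (g : Plane → ℝ) : Prop :=
  AEStronglyMeasurable g ((Measure.hausdorffMeasure 1).restrict (frontier Ω)) ∧
    hHalfNorm Ω g < ⊤

/-- `H^{-1/2}(∂Ω)`: the bounded linear functionals on `H^{1/2}(∂Ω)`. Values outside
`H^{1/2}(∂Ω)` are irrelevant. -/
structure HMinusHalf (Ω : Set Plane) where
  /-- The functional. -/
  toFun : (Plane → ℝ) → ℝ
  map_add : ∀ f g, MemHHalf Ω f → MemHHalf Ω g → toFun (f + g) = toFun f + toFun g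
  map_smul : ∀ (c : ℝ) (f), MemHHalf Ω f → toFun (c • f) = c * toFun f
  bounded : ∃ C : ℝ, ∀ f, MemHHalf Ω f → |toFun f| ≤ C * (hHalfNorm Ω f).toReal

/-- An edgewise pairing `q ↦ ∫_e ψ q` of `ψ ∈ H^{-1/2}(∂Ω)` with polynomials of degree at most
`ℓ - 1` on the boundary edges `e`. A piecewise polynomial need not be in `H^{1/2}(∂Ω)`, so that the
edge integrals are not determined by `ψ`; any values will do that are linear in `q` and add up to
the duality pairing with `ψ` whenever the piecewise polynomial is in `H^{1/2}(∂Ω)`. -/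
structure EdgePairing {Ω : Set Plane} (ψ : HMinusHalf Ω) (T : Mesh Ω) (ℓ : ℕ) where
  /-- The value of `∫_e ψ q`. -/
  toFun : T.EdgeIdx → EdgePoly ((ℓ : ℤ) - 1) →ₗ[ℝ] ℝ
  compatible : ∀ (q : T.EdgeIdx → EdgePoly ((ℓ : ℤ) - 1)) (g : Plane → ℝ), MemHHalf Ω g →
    (∀ e ∈ T.boundaryEdges, ∀ t ∈ Icc (0 : ℝ) 1,
      g ((T.element e.1).edgePoint e.2 t) = (q e : Polynomial ℝ).eval t) →
    ∑ e ∈ T.boundaryEdges, toFun e (q e) = ψ.toFun g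

end VEM

end

noncomputable section

namespace VEM

/-! ### Weak derivatives -/

section WeakDerivatives

variable {U V : Set Plane} {i : Fin 2} {f f' g g' φ : Plane → ℝ}

/-! The problem is a square linear system. The global space has finite dimension and both sides of
the equation are linear on it, so existence and uniqueness follow together once A(v, v) = 0 forces v
= 0 (`existsUnique_of_definite`, `discreteForm_definite`). No quantitative coercivity is needed,
hence no shape regularity of the mesh.

Let A(v, v) = 0. All terms of all local forms are nonnegative, so on each element K the projected
gradient Π₁v and every degree of freedom of v - Π₀v vanish; here the weight of the stabilisation is
positive because of ε h_K⁻² (`localForm_nonneg`). The projections see v only through its degrees of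
freedom, which are now those of the polynomial q = Π₀v. Exactness on polynomials and the divergence
theorem give Π₁v = ∇q (`gradProj_of_dof_eq`), so q is constant. The difference w = v - q lies in the
enlarged space, its degrees of freedom vanish, and so do its moments against P_ℓ(K): those up to
degree ℓ - 4 are degrees of freedom, the others vanish by definition of the local space.

Unisolvence (`MemEnlarged.eq_zero`) then gives w = 0. On an edge, w is a polynomial of degree at
most ℓ with zero end values and zero moments, hence zero. So w lies in H² ∩ H¹₀ and may be tested in
its own weak biharmonic equation: ∫ (Δw)² = ∫ p w + Σ ∫ q_e ∂ₙw = 0. Therefore ∫ |∇w|² = -∫ w Δw =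
0, and w = 0 by a Poincaré argument. Thus v is constant on every element. Its weak derivative
vanishes a.e. in Ω, since the element boundaries are null sets, and v = 0 because v lies in H¹₀(Ω)
(`eq_zero_of_eq_const`). The same unisolvence makes the map to the degrees of freedom injective on
the global space, which is why its dimension is finite (`finiteDimensional_space`).

The bulk of the proof is the analysis behind these steps. A continuous H¹ function that vanishes on
the boundary lies in H¹₀, on any bounded open set (`memH10_of_continuousOn`). The divergence theorem
holds on every simple polygon, convex or not (`integral_partialDeriv`); it yields normal derivatives
of polynomials and exactness of the projections. Weak derivatives, normal traces and projections are
chosen representatives, so linearity always rests on a uniqueness statement (`IsWeakDeriv.ae_eq`,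
`IsNormalTrace.ae_eq`, `eq_of_polyIntegral_eq`), in the first two cases up to null sets. -/

theorem contDiff_partialDeriv (hf : ContDiff ℝ ∞ f) (i : Fin 2) :
    ContDiff ℝ ∞ (partialDeriv i f) :=
  (hf.fderiv_right (m := ∞) (by simp)).clm_apply contDiff_const

theorem IsTestFunction.partialDeriv (hφ : IsTestFunction U φ) (i : Fin 2) :
    IsTestFunction U (partialDeriv i φ) := by
  refine ⟨contDiff_partialDeriv hφ.1 i, ?_, ?_⟩
  · exact hφ.2.1.fderiv_apply ℝ _
  · exact (tsupport_fderiv_apply_subset ℝ _).trans hφ.2.2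

theorem IsTestFunction.mul_left (hφ : IsTestFunction U φ) (hf : ContDiff ℝ ∞ f) :
    IsTestFunction U (fun x => f x * φ x) :=
  ⟨hf.mul hφ.1, hφ.2.1.mul_left, (tsupport_mul_subset_right).trans hφ.2.2⟩

theorem IsTestFunction.mono (h : U ⊆ V) (hφ : IsTestFunction U φ) : IsTestFunction V φ :=
  ⟨hφ.1, hφ.2.1, hφ.2.2.trans h⟩

theorem IsTestFunction.eq_zero (hφ : IsTestFunction U φ) {x : Plane} (hx : x ∉ U) : φ x = 0 :=
  image_eq_zero_of_notMem_tsupport fun h => hx (hφ.2.2 h)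

theorem IsTestFunction.setIntegral_mul (hφ : IsTestFunction U φ) (f : Plane → ℝ) :
    ∫ x in U, f x * φ x = ∫ x, f x * φ x :=
  setIntegral_eq_integral_of_forall_compl_eq_zero fun x hx => by rw [hφ.eq_zero hx, mul_zero]

theorem IsTestFunction.memLp (hφ : IsTestFunction U φ) (μ : Measure Plane)
    [IsFiniteMeasureOnCompacts μ] (p : ℝ≥0∞) : MemLp φ p μ :=
  hφ.1.continuous.memLp_of_hasCompactSupport hφ.2.1

theorem MemL2.integrable_mul (hf : MemL2 U f) (hg : MemL2 U g) :
    Integrable (fun x => f x * g x) (volume.restrict U) :=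
  MemLp.integrable_mul hf hg

theorem MemL2.smul_add (c : ℝ) (hf : MemL2 U f) (hg : MemL2 U g) : MemL2 U (c • f + g) :=
  (hf.const_smul c).add hg

theorem Continuous.memLp_restrict (hf : Continuous f) (hU : Bornology.IsBounded U) (p : ℝ≥0∞) :
    MemLp f p (volume.restrict U) := by
  obtain ⟨C, hC⟩ := hU.isCompact_closure.exists_bound_of_continuousOn hf.continuousOn
  have : IsFiniteMeasure (volume.restrict (closure U)) :=
    ⟨by simpa using hU.isCompact_closure.measure_lt_top⟩
  refine MemLp.mono_measure (Measure.restrict_mono subset_closure le_rfl) ?_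
  refine MemLp.of_bound hf.aestronglyMeasurable C ?_
  filter_upwards [ae_restrict_mem isClosed_closure.measurableSet] with x hx using hC x hx

theorem integral_mul_partialDeriv (hf : ContDiff ℝ ∞ f) (hφ : IsTestFunction univ φ) (i : Fin 2) :
    ∫ x, f x * partialDeriv i φ x = -∫ x, partialDeriv i f x * φ x := by
  have h1 : Integrable (fun x => partialDeriv i f x * φ x) :=
    memLp_one_iff_integrable.1 ((hφ.mul_left (contDiff_partialDeriv hf i)).memLp _ _)
  have h2 : Integrable (fun x => f x * partialDeriv i φ x) :=
    memLp_one_iff_integrable.1 (((hφ.partialDeriv i).mul_left hf).memLp _ _)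
  have h3 : Integrable (fun x => f x * φ x) :=
    memLp_one_iff_integrable.1 ((hφ.mul_left hf).memLp _ _)
  exact integral_mul_fderiv_eq_neg_fderiv_mul_of_integrable h1 h2 h3
    (fun x _ => (hf.differentiable (by simp)).differentiableAt)
    (fun x _ => (hφ.1.differentiable (by simp)).differentiableAt)

theorem isWeakDeriv_of_contDiff (hf : ContDiff ℝ ∞ f) (U : Set Plane) (i : Fin 2) :
    IsWeakDeriv U i f (partialDeriv i f) := by
  intro φ hφ
  rw [(hφ.partialDeriv i).setIntegral_mul, hφ.setIntegral_mul]
  exact integral_mul_partialDeriv hf (hφ.mono (subset_univ _)) i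

/-- This is the fundamental lemma of the calculus of variations. It makes the choice inside
`weakDeriv` harmless: any L² weak derivative found by hand agrees with the chosen one almost
everywhere. -/
theorem IsWeakDeriv.ae_eq (hU : IsOpen U) (h : IsWeakDeriv U i f g) (h' : IsWeakDeriv U i f g')
    (hg : MemL2 U g) (hg' : MemL2 U g') : g =ᵐ[volume.restrict U] g' := by
  have key : ∀ᵐ x ∂volume, x ∈ U → g x - g' x = 0 := by
    refine hU.ae_eq_zero_of_integral_contDiff_smul_eq_zero ?_ ?_
    · exact locallyIntegrableOn_of_locallyIntegrable_restrict
        ((hg.sub hg').locallyIntegrable (by norm_num))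
    · intro η h1 h2 h3
      have hη : IsTestFunction U η := ⟨h1, h2, h3⟩
      rw [← setIntegral_eq_integral_of_forall_compl_eq_zero (s := U)
        (fun x hx => by rw [hη.eq_zero hx, zero_smul])]
      have e := (h η hη).symm.trans (h' η hη)
      have : ∀ x, η x • (g x - g' x) = g x * η x - g' x * η x := fun x => by
        simp only [smul_eq_mul]; ring
      simp_rw [this]
      rw [integral_sub (hg.integrable_mul (hη.memLp _ _)) (hg'.integrable_mul (hη.memLp _ _))]
      linarith
  rw [EventuallyEq, ae_restrict_iff' hU.measurableSet]
  filter_upwards [key] with x hx hxU using sub_eq_zero.1 (hx hxU)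

theorem IsWeakDeriv.congr_ae (h : IsWeakDeriv U i f g) (hf : f =ᵐ[volume.restrict U] f')
    (hg : g =ᵐ[volume.restrict U] g') : IsWeakDeriv U i f' g' := by
  intro φ hφ
  have e1 : ∫ x in U, f x * VEM.partialDeriv i φ x = ∫ x in U, f' x * VEM.partialDeriv i φ x :=
    integral_congr_ae (hf.mono fun x hx => by simp only [hx])
  have e2 : ∫ x in U, g x * φ x = ∫ x in U, g' x * φ x :=
    integral_congr_ae (hg.mono fun x hx => by simp only [hx])
  rw [← e1, ← e2, h φ hφ]

theorem IsWeakDeriv.smul_add (c : ℝ) (h : IsWeakDeriv U i f g) (h' : IsWeakDeriv U i f' g')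
    (hf : MemL2 U f) (hg : MemL2 U g) (hf' : MemL2 U f') (hg' : MemL2 U g') :
    IsWeakDeriv U i (c • f + f') (c • g + g') := by
  intro φ hφ
  have e1 := h φ hφ
  have e2 := h' φ hφ
  have i1 := (hf.integrable_mul ((hφ.partialDeriv i).memLp _ _)).const_mul c
  have i2 := (hf'.integrable_mul ((hφ.partialDeriv i).memLp _ _))
  have i3 := (hg.integrable_mul (hφ.memLp _ _)).const_mul c
  have i4 := (hg'.integrable_mul (hφ.memLp _ _))
  have l : ∀ x, (c • f + f') x * VEM.partialDeriv i φ x =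
      c * (f x * VEM.partialDeriv i φ x) + f' x * VEM.partialDeriv i φ x := fun x => by
    simp only [Pi.add_apply, Pi.smul_apply, smul_eq_mul]; ring
  have r : ∀ x, (c • g + g') x * φ x = c * (g x * φ x) + g' x * φ x := fun x => by
    simp only [Pi.add_apply, Pi.smul_apply, smul_eq_mul]; ring
  simp_rw [l, r]
  rw [integral_add i1 i2, integral_add i3 i4, integral_const_mul, integral_const_mul, e1, e2]
  ring

/-- A test function of V is one of U, and the integrals over U and over V both equal the integral
over the plane. -/
theorem IsWeakDeriv.mono (hVU : V ⊆ U) (h : IsWeakDeriv U i f g) : IsWeakDeriv V i f g := by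
  intro φ hφ
  have e := h φ (hφ.mono hVU)
  rwa [((hφ.mono hVU).partialDeriv i).setIntegral_mul, (hφ.mono hVU).setIntegral_mul,
    ← (hφ.partialDeriv i).setIntegral_mul, ← hφ.setIntegral_mul] at e

theorem HasL2Deriv.memL2_weakDeriv (h : HasL2Deriv U i f) : MemL2 U (weakDeriv U i f) := by
  rw [weakDeriv, dif_pos h]; exact h.choose_spec.1

theorem HasL2Deriv.isWeakDeriv (h : HasL2Deriv U i f) : IsWeakDeriv U i f (weakDeriv U i f) := by
  rw [weakDeriv, dif_pos h]; exact h.choose_spec.2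

theorem IsWeakDeriv.weakDeriv_ae_eq (hU : IsOpen U) (h : IsWeakDeriv U i f g) (hg : MemL2 U g) :
    weakDeriv U i f =ᵐ[volume.restrict U] g :=
  have H : HasL2Deriv U i f := ⟨g, hg, h⟩
  H.isWeakDeriv.ae_eq hU h H.memL2_weakDeriv hg

/-- The chosen derivatives need not depend linearly on the function pointwise, so linearity is an
almost everywhere statement here and in all that is built on it. -/
theorem weakDeriv_smul_add (hU : IsOpen U) (c : ℝ) (hf : MemL2 U f) (hf' : MemL2 U f')
    (h : HasL2Deriv U i f) (h' : HasL2Deriv U i f') :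
    weakDeriv U i (c • f + f') =ᵐ[volume.restrict U] c • weakDeriv U i f + weakDeriv U i f' :=
  (h.isWeakDeriv.smul_add c h'.isWeakDeriv hf h.memL2_weakDeriv hf'
    h'.memL2_weakDeriv).weakDeriv_ae_eq hU (h.memL2_weakDeriv.smul_add c h'.memL2_weakDeriv)

theorem weakDeriv_congr_ae (hU : IsOpen U) (h : HasL2Deriv U i f)
    (hf : f =ᵐ[volume.restrict U] f') :
    weakDeriv U i f' =ᵐ[volume.restrict U] weakDeriv U i f :=
  (h.isWeakDeriv.congr_ae hf .rfl).weakDeriv_ae_eq hU h.memL2_weakDeriv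

theorem weakDeriv_of_contDiff (hU : IsOpen U) (hb : Bornology.IsBounded U)
    (hf : ContDiff ℝ ∞ f) (i : Fin 2) :
    weakDeriv U i f =ᵐ[volume.restrict U] partialDeriv i f :=
  (isWeakDeriv_of_contDiff hf U i).weakDeriv_ae_eq hU
    (Continuous.memLp_restrict (contDiff_partialDeriv hf i).continuous hb 2)

theorem HasL2Deriv.congr_ae (h : HasL2Deriv U i f) (hf : f =ᵐ[volume.restrict U] f') :
    HasL2Deriv U i f' :=
  ⟨_, h.memL2_weakDeriv, h.isWeakDeriv.congr_ae hf .rfl⟩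

theorem MemH1.congr_ae (h : MemH1 U f) (hf : f =ᵐ[volume.restrict U] f') : MemH1 U f' :=
  ⟨h.1.ae_eq hf, fun i => (h.2 i).congr_ae hf⟩

theorem MemH1.smul_add (c : ℝ) (h : MemH1 U f) (h' : MemH1 U f') : MemH1 U (c • f + f') :=
  ⟨h.1.smul_add c h'.1, fun i => ⟨_, (h.2 i).memL2_weakDeriv.smul_add c (h'.2 i).memL2_weakDeriv,
    (h.2 i).isWeakDeriv.smul_add c (h'.2 i).isWeakDeriv h.1 (h.2 i).memL2_weakDeriv h'.1
      (h'.2 i).memL2_weakDeriv⟩⟩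

theorem memH1_of_contDiff (hb : Bornology.IsBounded U) (hf : ContDiff ℝ ∞ f) : MemH1 U f :=
  ⟨Continuous.memLp_restrict hf.continuous hb 2, fun i => ⟨_,
    Continuous.memLp_restrict (contDiff_partialDeriv hf i).continuous hb 2,
    isWeakDeriv_of_contDiff hf U i⟩⟩

theorem MemH2.smul_add (hU : IsOpen U) (c : ℝ) (h : MemH2 U f) (h' : MemH2 U f') :
    MemH2 U (c • f + f') :=
  ⟨h.1.smul_add c h'.1, fun i => ((h.2 i).smul_add c (h'.2 i)).congr_ae
    (weakDeriv_smul_add hU c h.1.1 h'.1.1 (h.1.2 i) (h'.1.2 i)).symm⟩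

theorem memH2_of_contDiff (hU : IsOpen U) (hb : Bornology.IsBounded U) (hf : ContDiff ℝ ∞ f) :
    MemH2 U f :=
  ⟨memH1_of_contDiff hb hf, fun i => (memH1_of_contDiff hb (contDiff_partialDeriv hf i)).congr_ae
    (weakDeriv_of_contDiff hU hb hf i).symm⟩

theorem MemH2.memL2_weakLaplacian (h : MemH2 U f) : MemL2 U (weakLaplacian U f) :=
  memLp_finsetSum (p := 2) Finset.univ fun i _ => ((h.2 i).2 i).memL2_weakDeriv

theorem weakLaplacian_smul_add (hU : IsOpen U) (c : ℝ) (h : MemH2 U f) (h' : MemH2 U f') :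
    weakLaplacian U (c • f + f') =ᵐ[volume.restrict U]
      c • weakLaplacian U f + weakLaplacian U f' := by
  have key : ∀ i, weakDeriv U i (weakDeriv U i (c • f + f')) =ᵐ[volume.restrict U]
      c • weakDeriv U i (weakDeriv U i f) + weakDeriv U i (weakDeriv U i f') := fun i =>
    (weakDeriv_congr_ae hU (((h.2 i).smul_add c (h'.2 i)).2 i)
      (weakDeriv_smul_add hU c h.1.1 h'.1.1 (h.1.2 i) (h'.1.2 i)).symm).trans
      (weakDeriv_smul_add hU c (h.2 i).1 (h'.2 i).1 ((h.2 i).2 i) ((h'.2 i).2 i))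
  filter_upwards [key 0, key 1] with x h0 h1
  simp only [weakLaplacian, Fin.sum_univ_two, Pi.add_apply, Pi.smul_apply, smul_eq_mul, h0, h1]
  ring

theorem weakLaplacian_of_contDiff (hU : IsOpen U) (hb : Bornology.IsBounded U)
    (hf : ContDiff ℝ ∞ f) :
    weakLaplacian U f =ᵐ[volume.restrict U]
      fun x => ∑ i, partialDeriv i (partialDeriv i f) x := by
  have key : ∀ i, weakDeriv U i (weakDeriv U i f) =ᵐ[volume.restrict U]
      partialDeriv i (partialDeriv i f) := fun i =>
    (weakDeriv_congr_ae hU ((memH1_of_contDiff hb (contDiff_partialDeriv hf i)).2 i)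
      (weakDeriv_of_contDiff hU hb hf i).symm).trans
      (weakDeriv_of_contDiff hU hb (contDiff_partialDeriv hf i) i)
  filter_upwards [key 0, key 1] with x h0 h1
  simp only [weakLaplacian, Fin.sum_univ_two, h0, h1]

end WeakDerivatives

/-! ### Mollification in `L²` -/

section Mollification

open scoped Convolution

variable {g h : Plane → ℝ} (ρ : ContDiffBump (0 : Plane))

theorem eLpNorm_two_sq {α : Type*} [MeasurableSpace α] (f : α → ℝ) (μ : Measure α) :
    eLpNorm f 2 μ ^ 2 = ∫⁻ x, ‖f x‖ₑ ^ 2 ∂μ := by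
  have := eLpNorm_nnreal_pow_eq_lintegral (p := 2) (f := f) (μ := μ) (by norm_num)
  simpa using this

/-- Young's inequality for the convolution with a normed bump function. -/
theorem eLpNorm_normed_convolution_le (hg : Measurable g) :
    eLpNorm (ρ.normed volume ⋆[ContinuousLinearMap.lsmul ℝ ℝ, volume] g) 2 volume ≤
      eLpNorm g 2 volume := by
  -- The normed bump is the density of a probability measure ν. Monotonicity of L^p norms for ν
  -- gives |ρ ⋆ g|²(x) ≤ ∫ |g(x - t)|² dν(t); Tonelli and translation invariance do the rest.
  set w : Plane → ℝ≥0∞ := fun t => ENNReal.ofReal (ρ.normed volume t) with hw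
  have hwm : Measurable w := (ρ.continuous_normed.measurable).ennreal_ofReal
  set ν : Measure Plane := volume.withDensity w with hν
  have hprob : IsProbabilityMeasure ν := by
    constructor
    rw [hν, withDensity_apply _ MeasurableSet.univ, Measure.restrict_univ,
      ← ofReal_integral_eq_lintegral_ofReal ρ.integrable_normed
        (Eventually.of_forall ρ.nonneg_normed), ρ.integral_normed, ENNReal.ofReal_one]
  have hm : Measurable fun z : Plane × Plane => ‖g (z.1 - z.2)‖ₑ ^ 2 :=
    (hg.comp (measurable_fst.sub measurable_snd)).enorm.pow_const 2
  have hpt : ∀ x, ‖(ρ.normed volume ⋆[ContinuousLinearMap.lsmul ℝ ℝ, volume] g) x‖ₑ ^ 2 ≤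
      ∫⁻ t, ‖g (x - t)‖ₑ ^ 2 ∂ν := by
    intro x
    have hmx : Measurable fun t => g (x - t) := hg.comp (measurable_const.sub measurable_id)
    have h1 : ‖(ρ.normed volume ⋆[ContinuousLinearMap.lsmul ℝ ℝ, volume] g) x‖ₑ ≤
        eLpNorm (fun t => g (x - t)) 1 ν := by
      rw [convolution_lsmul, eLpNorm_one_eq_lintegral_enorm, hν,
        lintegral_withDensity_eq_lintegral_mul _ hwm hmx.enorm]
      refine (enorm_integral_le_lintegral_enorm _).trans (lintegral_mono fun t => ?_)
      rw [enorm_smul, Real.enorm_of_nonneg (ρ.nonneg_normed t)]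
      rfl
    calc _ ≤ eLpNorm (fun t => g (x - t)) 2 ν ^ 2 := by
          gcongr
          exact h1.trans (eLpNorm_le_eLpNorm_of_exponent_le (by norm_num)
            hmx.aestronglyMeasurable)
      _ = _ := eLpNorm_two_sq _ _
  have hsq : eLpNorm (ρ.normed volume ⋆[ContinuousLinearMap.lsmul ℝ ℝ, volume] g) 2 volume ^ 2 ≤
      eLpNorm g 2 volume ^ 2 := by
    rw [eLpNorm_two_sq, eLpNorm_two_sq]
    calc _ ≤ ∫⁻ x, ∫⁻ t, ‖g (x - t)‖ₑ ^ 2 ∂ν := lintegral_mono hpt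
      _ = ∫⁻ t, (∫⁻ x, ‖g (x - t)‖ₑ ^ 2) ∂ν := by
          rw [lintegral_lintegral_swap hm.aemeasurable]
      _ = ∫⁻ _, (∫⁻ x, ‖g x‖ₑ ^ 2) ∂ν := by
          refine lintegral_congr fun t => ?_
          exact lintegral_sub_right_eq_self (fun x => ‖g x‖ₑ ^ 2) t
      _ = _ := by rw [lintegral_const, measure_univ, mul_one]
  exact (ENNReal.pow_right_strictMono two_ne_zero).le_iff_le.1 hsq

theorem exists_normed_convolution_sub_le_of_continuous (hc : Continuous h)
    (hs : HasCompactSupport h) {δ : ℝ} (hδ : 0 < δ) :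
    ∃ r > 0, ∀ ρ : ContDiffBump (0 : Plane), ρ.rOut ≤ r → ∀ x,
      |(ρ.normed volume ⋆[ContinuousLinearMap.lsmul ℝ ℝ, volume] h) x - h x| ≤ δ := by
  obtain ⟨r, hr, H⟩ := Metric.uniformContinuous_iff.1 (hs.uniformContinuous_of_continuous hc) δ hδ
  refine ⟨r, hr, fun ρ hρ x => ?_⟩
  exact ρ.dist_normed_convolution_le hc.aestronglyMeasurable fun y hy =>
    (H (lt_of_lt_of_le hy hρ)).le

/-- Approximate g by a continuous h of compact support. Uniform continuity handles ρ ⋆ h - h, and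
Young's inequality carries the error g - h through the convolution; each of the three errors is at
most δ/3. -/
theorem exists_eLpNorm_normed_convolution_sub_le (hgm : Measurable g) (hg : MemLp g 2 volume)
    {δ : ℝ≥0∞} (hδ : δ ≠ 0) :
    ∃ r > 0, ∀ ρ : ContDiffBump (0 : Plane), ρ.rOut ≤ r →
      eLpNorm (ρ.normed volume ⋆[ContinuousLinearMap.lsmul ℝ ℝ, volume] g - g) 2 volume ≤ δ := by
  have hδ3 : δ / 3 ≠ 0 := by simp [hδ]
  obtain ⟨h, hs, hgh, hc, hh⟩ := hg.exists_hasCompactSupport_eLpNorm_sub_le (by norm_num) hδ3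
  -- With bump radius at most 1, ρ ⋆ h - h vanishes off this compact set, so a uniform bound on it
  -- becomes an L² bound.
  set S := Metric.cthickening 1 (tsupport h) with hS
  have hSc : IsCompact S := hs.isCompact.cthickening
  obtain ⟨η, hη, hηS⟩ : ∃ η : ℝ, 0 < η ∧
      (volume.restrict S) univ ^ (2 : ℝ≥0∞).toReal⁻¹ * ENNReal.ofReal η ≤ δ / 3 := by
    set C := (volume.restrict S) univ ^ (2 : ℝ≥0∞).toReal⁻¹
    have hC : C ≠ ⊤ := by
      refine ENNReal.rpow_ne_top_of_nonneg (by simp) ?_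
      simpa using hSc.measure_lt_top.ne
    have ht : Tendsto (fun η : ℝ => C * ENNReal.ofReal η) (𝓝[>] 0) (𝓝 0) := by
      have := (ENNReal.tendsto_ofReal (tendsto_id (α := ℝ) (x := 𝓝 0))).mono_left
        (nhdsWithin_le_nhds (s := Ioi 0))
      have := ENNReal.Tendsto.const_mul (a := C) this (Or.inr hC)
      simpa using this
    obtain ⟨η, h1, h2⟩ := ((ht.eventually_lt_const (pos_iff_ne_zero.2 hδ3)).and
      self_mem_nhdsWithin).exists
    exact ⟨η, h2, h1.le⟩
  obtain ⟨r, hr, H⟩ := exists_normed_convolution_sub_le_of_continuous hc hs hη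
  refine ⟨min r 1, by positivity, fun ρ hρ => ?_⟩
  have hρ1 : HasCompactSupport (ρ.normed (volume : Measure Plane)) := ρ.hasCompactSupport_normed
  have hlin : ρ.normed volume ⋆[ContinuousLinearMap.lsmul ℝ ℝ, volume] g =
      ρ.normed volume ⋆[ContinuousLinearMap.lsmul ℝ ℝ, volume] (g - h) +
      ρ.normed volume ⋆[ContinuousLinearMap.lsmul ℝ ℝ, volume] h := by
    rw [← ConvolutionExists.distrib_add, sub_add_cancel]
    · exact hρ1.convolutionExists_left _ ρ.continuous_normed
        ((hg.sub hh).locallyIntegrable (by norm_num))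
    · exact hρ1.convolutionExists_left _ ρ.continuous_normed (hh.locallyIntegrable (by norm_num))
  have hcont : Continuous (ρ.normed volume ⋆[ContinuousLinearMap.lsmul ℝ ℝ, volume] h) :=
    hρ1.continuous_convolution_left _ ρ.continuous_normed (hh.locallyIntegrable (by norm_num))
  have hcont' : Continuous (ρ.normed volume ⋆[ContinuousLinearMap.lsmul ℝ ℝ, volume] (g - h)) :=
    hρ1.continuous_convolution_left _ ρ.continuous_normed
      ((hg.sub hh).locallyIntegrable (by norm_num))
  have hsupp : Function.support
      (ρ.normed volume ⋆[ContinuousLinearMap.lsmul ℝ ℝ, volume] h - h) ⊆ S := by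
    intro x hx
    by_contra hxS
    have hz : ∀ y ∈ Metric.ball x ρ.rOut, h y = 0 := by
      intro y hy
      refine image_eq_zero_of_notMem_tsupport fun hyh => hxS ?_
      refine Metric.mem_cthickening_of_dist_le x y 1 _ hyh ?_
      rw [dist_comm]
      exact (le_of_lt hy).trans (hρ.trans (min_le_right _ _))
    have hz0 := hz x (Metric.mem_ball_self ρ.rOut_pos)
    refine hx ?_
    rw [Pi.sub_apply, ρ.normed_convolution_eq_right fun y hy => by rw [hz y hy, hz0], sub_self]
  have h2 : eLpNorm (ρ.normed volume ⋆[ContinuousLinearMap.lsmul ℝ ℝ, volume] h - h) 2 volume ≤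
      δ / 3 := by
    rw [← eLpNorm_restrict_eq_of_support_subset hsupp]
    refine (eLpNorm_le_of_ae_bound (C := η) (Eventually.of_forall fun x => ?_)).trans hηS
    exact H ρ (hρ.trans (min_le_left _ _)) x
  have e : ρ.normed volume ⋆[ContinuousLinearMap.lsmul ℝ ℝ, volume] g - g =
      (ρ.normed volume ⋆[ContinuousLinearMap.lsmul ℝ ℝ, volume] (g - h) +
      (ρ.normed volume ⋆[ContinuousLinearMap.lsmul ℝ ℝ, volume] h - h)) - (g - h) := by
    rw [hlin]; abel
  rw [e]
  have hgha := (hgm.sub hc.measurable)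
  calc _ ≤ δ / 3 + δ / 3 + δ / 3 := by
        refine (eLpNorm_sub_le (hcont'.add (hcont.sub hc)).aestronglyMeasurable
          hgha.aestronglyMeasurable (by norm_num)).trans (add_le_add ?_ hgh)
        refine (eLpNorm_add_le hcont'.aestronglyMeasurable
          (hcont.sub hc).aestronglyMeasurable (by norm_num)).trans (add_le_add ?_ h2)
        exact (eLpNorm_normed_convolution_le ρ hgha).trans hgh
    _ = δ := ENNReal.add_thirds δ

/-- The derivative of a mollified function is the mollified weak derivative, away from the
boundary. -/
theorem partialDeriv_normed_convolution {U : Set Plane} (hU : IsOpen U) {i : Fin 2}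
    {w : Plane → ℝ} (hw : MemL2 U w) (hd : IsWeakDeriv U i w g) {x : Plane}
    (hx : Metric.closedBall x ρ.rOut ⊆ U) :
    partialDeriv i
        (ρ.normed volume ⋆[ContinuousLinearMap.lsmul ℝ ℝ, volume] (U.indicator w)) x =
      (ρ.normed volume ⋆[ContinuousLinearMap.lsmul ℝ ℝ, volume] (U.indicator g)) x := by
  have hloc : LocallyIntegrable (U.indicator w) volume :=
    (((memLp_indicator_iff_restrict hU.measurableSet).2 hw).locallyIntegrable (by norm_num))
  have hρ1 : HasCompactSupport (ρ.normed (volume : Measure Plane)) := ρ.hasCompactSupport_normed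
  have hd1 := hρ1.hasFDerivAt_convolution_left (ContinuousLinearMap.lsmul ℝ ℝ)
    (ρ.contDiff_normed (n := 1)) hloc x
  have hex := ((hρ1.fderiv ℝ).convolutionExists_left
    ((ContinuousLinearMap.lsmul ℝ ℝ).precompL Plane)
    ((ρ.contDiff_normed (n := 1)).continuous_fderiv (by simp)) hloc x)
  rw [partialDeriv, hd1.fderiv, convolution_eq_swap,
    ContinuousLinearMap.integral_apply hex.integrable_swap]
  simp only [ContinuousLinearMap.precompL_apply, ContinuousLinearMap.lsmul_apply]
  -- The derivative falls on the kernel. The reflected and translated kernel is a test function of U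
  -- because the closed ball around x lies in U, so the definition of the weak derivative applies to
  -- it.
  set η : Plane → ℝ := fun y => ρ.normed volume (x - y) with hη
  have hηt : IsTestFunction U η := by
    have hts : tsupport η ⊆ Metric.closedBall x ρ.rOut := by
      refine closure_minimal (fun y hy => ?_) Metric.isClosed_closedBall
      have : x - y ∈ Function.support (ρ.normed (volume : Measure Plane)) := hy
      rw [ρ.support_normed_eq, mem_ball_zero_iff] at this
      rw [Metric.mem_closedBall, dist_comm, dist_eq_norm]
      exact this.le
    refine ⟨ρ.contDiff_normed.comp (contDiff_const.sub contDiff_id), ?_, hts.trans hx⟩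
    exact HasCompactSupport.of_support_subset_isCompact (isCompact_closedBall x ρ.rOut)
      (subset_tsupport _ |>.trans hts)
  have hdη : ∀ y, partialDeriv i η y =
      -(fderiv ℝ (ρ.normed volume) (x - y) (EuclideanSpace.single i 1)) := by
    intro y
    have h1 : HasFDerivAt η ((fderiv ℝ (ρ.normed volume) (x - y)).comp
        (-ContinuousLinearMap.id ℝ Plane)) y := by
      refine HasFDerivAt.comp y (g := ρ.normed volume) (f := fun y => x - y) ?_ ?_
      · exact ((ρ.contDiff_normed (n := 1)).differentiable (by simp)).differentiableAt.hasFDerivAt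
      · exact (hasFDerivAt_id y).const_sub x
    rw [partialDeriv, h1.fderiv]
    simp
  have e := hd η hηt
  rw [convolution_lsmul_swap]
  have e1 : ∀ y, (fderiv ℝ (ρ.normed volume) (x - y) (EuclideanSpace.single i 1)) •
      U.indicator w y = -(U.indicator (fun y => w y * partialDeriv i η y) y) := by
    intro y
    by_cases hy : y ∈ U
    · simp only [indicator_of_mem hy, smul_eq_mul, hdη]; ring
    · simp [indicator_of_notMem hy]
  have e2 : ∀ y, ρ.normed volume (x - y) • U.indicator g y =
      U.indicator (fun y => g y * η y) y := by
    intro y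
    by_cases hy : y ∈ U
    · simp only [indicator_of_mem hy, smul_eq_mul, hη]; ring
    · simp [indicator_of_notMem hy]
  simp_rw [e1, e2]
  rw [integral_neg, integral_indicator hU.measurableSet, integral_indicator hU.measurableSet, e,
    neg_neg]

end Mollification

/-! ### Functions of `H¹₀(U)` -/

section Dirichlet

open scoped Convolution

variable {U : Set Plane} {w : Plane → ℝ}

theorem tendsto_eLpNorm_zero_of_dominated {α : Type*} [MeasurableSpace α] {μ : Measure α}
    {F : ℕ → α → ℝ} {b : α → ℝ} (hF : ∀ n, AEStronglyMeasurable (F n) μ) (hb : MemLp b 2 μ)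
    (hle : ∀ n, ∀ᵐ x ∂μ, ‖F n x‖ ≤ ‖b x‖) (h0 : ∀ᵐ x ∂μ, Tendsto (fun n => F n x) atTop (𝓝 0)) :
    Tendsto (fun n => eLpNorm (F n) 2 μ) atTop (𝓝 0) := by
  have h2 : Tendsto (fun n => ∫⁻ x, ‖F n x‖ₑ ^ 2 ∂μ) atTop (𝓝 (∫⁻ _, 0 ∂μ)) := by
    refine tendsto_lintegral_of_dominated_convergence' (fun x => ‖b x‖ₑ ^ 2)
      (fun n => (hF n).enorm.pow_const 2) (fun n => (hle n).mono fun x hx => ?_) ?_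
      (h0.mono fun x hx => ?_)
    · exact pow_le_pow_left' (enorm_le_iff_norm_le.2 hx) 2
    · rw [← eLpNorm_two_sq]; exact ENNReal.pow_ne_top hb.2.ne
    · have := ENNReal.Tendsto.pow (n := 2) hx.enorm
      simpa using this
  rw [lintegral_zero] at h2
  simp_rw [← eLpNorm_two_sq] at h2
  have h3 := h2.ennrpow_const (1 / 2 : ℝ)
  simp_rw [← ENNReal.rpow_natCast, ← ENNReal.rpow_mul] at h3
  simpa using h3

/-- A smooth function that vanishes near `0` and is the identity away from `0`. -/
theorem exists_smooth_truncation : ∃ (G : ℝ → ℝ) (M : ℝ), ContDiff ℝ ∞ G ∧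
    (∀ s, |s| ≤ 1 → G s = 0) ∧ (∀ s, |G s - s| ≤ 2) ∧ (∀ s, |deriv G s| ≤ M) ∧
    (∀ s, |s| < 1 → deriv G s = 0) ∧ ∀ s, 2 < |s| → deriv G s = 1 := by
  -- The truncation is G(s) = s - s β(s). It differs from s by |s β(s)|, which is at most |s|, and
  -- is zero once |s| ≥ 2; hence the bound 2.
  set β : ContDiffBump (0 : ℝ) := ⟨1, 2, by norm_num, by norm_num⟩
  set H : ℝ → ℝ := fun s => s * β s with hH
  have hHc : ContDiff ℝ ∞ H := contDiff_id.mul β.contDiff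
  have hHs : HasCompactSupport H := β.hasCompactSupport.mul_left
  have hout : ∀ s : ℝ, 2 ≤ |s| → H s = 0 := fun s hs => by
    rw [hH]; simp only
    rw [β.zero_of_le_dist (by simpa using hs), mul_zero]
  have hin : ∀ s : ℝ, |s| ≤ 1 → H s = s := fun s hs => by
    rw [hH]; simp only
    rw [β.one_of_mem_closedBall (by simpa using hs), mul_one]
  have hder : ∀ s, deriv (fun s => s - H s) s = 1 - deriv H s := fun s => by
    rw [deriv_fun_sub (f := fun s => s) differentiableAt_id (hHc.differentiable (by simp)).differentiableAt]
    simp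
  obtain ⟨C, hC⟩ := (hHs.deriv).exists_bound_of_continuous (hHc.continuous_deriv (by simp))
  refine ⟨fun s => s - H s, 1 + C, contDiff_id.sub hHc, fun s hs => ?_, fun s => ?_, fun s => ?_,
    fun s hs => ?_, fun s hs => ?_⟩
  · simp only [hin s hs, sub_self]
  · rw [sub_sub_cancel_left, abs_neg]
    rcases le_total 2 |s| with h | h
    · rw [hout s h, abs_zero]; norm_num
    · rw [hH]; simp only
      rw [abs_mul, abs_of_nonneg β.nonneg]
      exact (mul_le_of_le_one_right (abs_nonneg _) β.le_one).trans h
  · rw [hder]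
    exact (abs_sub _ _).trans (by simpa using hC s)
  · have : H =ᶠ[𝓝 s] id := by
      filter_upwards [(isOpen_lt continuous_abs continuous_const).mem_nhds hs] with t ht
      exact hin t (le_of_lt ht)
    rw [hder, this.deriv_eq, deriv_id, sub_self]
  · have : H =ᶠ[𝓝 s] fun _ => 0 := by
      filter_upwards [(isOpen_lt continuous_const continuous_abs).mem_nhds hs] with t ht
      exact hout t (le_of_lt ht)
    rw [hder, this.deriv_eq, deriv_const, sub_zero]

theorem continuous_indicator_of_frontier {U : Set Plane}
    (hc : ContinuousOn w (closure U)) (h0 : ∀ x ∈ frontier U, w x = 0) :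
    Continuous (U.indicator w) := by
  classical
  have : U.indicator w = U.piecewise w 0 := by
    ext x; by_cases hx : x ∈ U <;> simp [hx]
  rw [this]
  exact continuous_piecewise (fun x hx => h0 x hx) hc continuousOn_const

/-- W and m are the mollifications of w and of its gradient, both extended by zero. They match as
function and derivative only at points farther from the complement of U than the bump radius. The
set |w| ≥ δ/2 is compact in U, by continuity of the extension, so a small radius serves all of it.
-/
theorem exists_smooth_approx (hU : IsOpen U) (hb : Bornology.IsBounded U) (hw : MemL2 U w)
    (hc : Continuous (U.indicator w)) {g : Fin 2 → Plane → ℝ} (hgm : ∀ i, Measurable (g i))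
    (hg : ∀ i, MemL2 U (g i)) (hd : ∀ i, IsWeakDeriv U i w (g i)) {δ : ℝ} (hδ : 0 < δ) :
    ∃ (W : Plane → ℝ) (m : Fin 2 → Plane → ℝ), ContDiff ℝ ∞ W ∧
      (∀ x, |W x - U.indicator w x| ≤ δ / 2) ∧ (∀ i, AEStronglyMeasurable (m i) volume) ∧
      (∀ i, eLpNorm (m i - U.indicator (g i)) 2 volume ≤ ENNReal.ofReal δ) ∧
      ∀ i x, δ / 2 ≤ |U.indicator w x| → partialDeriv i W x = m i x := by
  have hcs : HasCompactSupport (U.indicator w) := by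
    refine HasCompactSupport.of_support_subset_isCompact hb.isCompact_closure ?_
    exact (support_indicator_subset).trans subset_closure
  have hL : ∀ i, MemLp (U.indicator (g i)) 2 volume := fun i =>
    (memLp_indicator_iff_restrict hU.measurableSet).2 (hg i)
  have hLm : ∀ i, Measurable (U.indicator (g i)) := fun i =>
    (hgm i).indicator hU.measurableSet
  obtain ⟨r₁, hr₁, H₁⟩ := exists_normed_convolution_sub_le_of_continuous hc hcs (half_pos hδ)
  have hδ' : ENNReal.ofReal δ ≠ 0 := by simpa using hδ
  choose r hr H using fun i => exists_eLpNorm_normed_convolution_sub_le (hLm i) (hL i) hδ'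
  set C : Set Plane := {x | δ / 2 ≤ |U.indicator w x|} with hC
  have hCU : C ⊆ U := by
    intro x hx
    by_contra hxU
    rw [hC, mem_ofPred_eq, indicator_of_notMem hxU, abs_zero] at hx
    linarith
  have hCc : IsCompact C := by
    refine hb.isCompact_closure.of_isClosed_subset ?_ (hCU.trans subset_closure)
    exact isClosed_le continuous_const hc.abs
  obtain ⟨r₂, hr₂, H₂⟩ := hCc.exists_cthickening_subset_open hU hCU
  set R := min (min r₁ r₂) (min (r 0) (r 1)) with hR
  have hR0 : 0 < R := by
    have := hr 0; have := hr 1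
    positivity
  set ρ : ContDiffBump (0 : Plane) := ⟨R / 2, R, half_pos hR0, half_lt_self hR0⟩ with hρ
  have hρs : HasCompactSupport (ρ.normed (volume : Measure Plane)) := ρ.hasCompactSupport_normed
  refine ⟨ρ.normed volume ⋆[ContinuousLinearMap.lsmul ℝ ℝ, volume] U.indicator w,
    fun i => ρ.normed volume ⋆[ContinuousLinearMap.lsmul ℝ ℝ, volume] U.indicator (g i),
    ?_, ?_, fun i => ?_, fun i => ?_, fun i x hx => ?_⟩
  · exact hρs.contDiff_convolution_left (n := (⊤ : ℕ∞)) _ ρ.contDiff_normed hc.locallyIntegrable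
  · exact H₁ ρ ((min_le_left _ _).trans (min_le_left _ _))
  · exact (hρs.continuous_convolution_left _ ρ.continuous_normed
      ((hL i).locallyIntegrable (by norm_num))).aestronglyMeasurable
  · refine H i ρ ?_
    fin_cases i
    · exact (min_le_right _ _).trans (min_le_left _ _)
    · exact (min_le_right _ _).trans (min_le_right _ _)
  · refine partialDeriv_normed_convolution ρ hU hw (hd i) fun y hy => H₂ ?_
    refine Metric.mem_cthickening_of_dist_le y x r₂ C hx ?_
    exact (Metric.mem_closedBall.1 hy).trans ((min_le_left _ _).trans (min_le_right _ _))

/-- The approximants are φₙ = δₙ G(Wₙ/δₙ), the mollification truncated at height δₙ. Where |w| <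
δₙ/2 one has |Wₙ| < δₙ, so φₙ = 0; this puts the support inside U without any regularity of the
boundary. The limit of the gradients is first obtained with the factor 1_{w ≠ 0}, since G' vanishes
near 0. -/
theorem exists_seq_isTestFunction (hU : IsOpen U) (hb : Bornology.IsBounded U) (hw : MemL2 U w)
    (hc : Continuous (U.indicator w)) {g : Fin 2 → Plane → ℝ} (hgm : ∀ i, Measurable (g i))
    (hg : ∀ i, MemL2 U (g i)) (hd : ∀ i, IsWeakDeriv U i w (g i)) :
    ∃ φ : ℕ → Plane → ℝ, (∀ n, IsTestFunction U (φ n)) ∧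
      Tendsto (fun n => eLpNorm (fun x => w x - φ n x) 2 (volume.restrict U)) atTop (𝓝 0) ∧
      ∀ i, Tendsto (fun n => eLpNorm (fun x => {x | U.indicator w x ≠ 0}.indicator (g i) x -
        partialDeriv i (φ n) x) 2 (volume.restrict U)) atTop (𝓝 0) := by
  obtain ⟨G, M, hGs, hG0, hGid, hGM, hGd0, hGd1⟩ := exists_smooth_truncation
  set δ : ℕ → ℝ := fun n => 1 / ((n : ℝ) + 1) with hδ
  have hδ0 : ∀ n, 0 < δ n := fun n => by positivity
  have hδt : Tendsto δ atTop (𝓝 0) := tendsto_one_div_add_atTop_nhds_zero_nat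
  choose W m hW hWw hm hmg hWm using fun n =>
    exists_smooth_approx hU hb hw hc hgm hg hd (hδ0 n)
  have hM0 : 0 ≤ M := (abs_nonneg _).trans (hGM 0)
  set φ : ℕ → Plane → ℝ := fun n x => δ n * G (W n x / δ n) with hφ
  have hWd : ∀ n, ContDiff ℝ ∞ fun x => W n x / δ n := fun n => (hW n).div_const _
  have hφd : ∀ n, ContDiff ℝ ∞ (φ n) := fun n => contDiff_const.mul (hGs.comp (hWd n))
  have hpd : ∀ n i x, partialDeriv i (φ n) x =
      deriv G (W n x / δ n) * partialDeriv i (W n) x := by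
    intro n i x
    have h1 : HasFDerivAt (fun x => W n x / δ n) ((δ n)⁻¹ • fderiv ℝ (W n) x) x := by
      simpa [div_eq_inv_mul] using
        (((hW n).differentiable (by simp)).differentiableAt (x := x)).hasFDerivAt.const_mul (δ n)⁻¹
    have h2 : HasDerivAt G (deriv G (W n x / δ n)) (W n x / δ n) :=
      (hGs.differentiable (by simp)).differentiableAt.hasDerivAt
    have h3 := (h2.comp_hasFDerivAt x h1).const_mul (δ n)
    have h4 : fderiv ℝ (φ n) x = _ := h3.fderiv
    rw [partialDeriv, h4]
    simp only [smul_smul, smul_apply, smul_eq_mul, partialDeriv]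
    have := (hδ0 n).ne'
    field_simp
  have hsmall : ∀ n x, |U.indicator w x| < δ n / 2 → |W n x / δ n| < 1 := by
    intro n x hx
    rw [abs_div, abs_of_pos (hδ0 n), div_lt_one (hδ0 n)]
    have h1 := hWw n x
    have h2 := abs_sub_abs_le_abs_sub (W n x) (U.indicator w x)
    linarith
  have hts : ∀ n, tsupport (φ n) ⊆ {x | δ n / 2 ≤ |U.indicator w x|} := by
    intro n
    refine closure_minimal (fun x hx => ?_) (isClosed_le continuous_const hc.abs)
    by_contra hlt
    refine hx ?_
    simp only [hφ]
    rw [hG0 _ (hsmall n x (not_le.1 hlt)).le, mul_zero]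
  have hCU : ∀ n, {x | δ n / 2 ≤ |U.indicator w x|} ⊆ U := by
    intro n x hx
    by_contra hxU
    rw [mem_ofPred_eq, indicator_of_notMem hxU, abs_zero] at hx
    have := hδ0 n
    linarith
  have hφt : ∀ n, IsTestFunction U (φ n) := fun n => ⟨hφd n,
    hb.isCompact_closure.of_isClosed_subset (isClosed_tsupport _)
      (((hts n).trans (hCU n)).trans subset_closure), (hts n).trans (hCU n)⟩
  have hfin : (volume.restrict U) univ ≠ ⊤ := by
    rw [Measure.restrict_apply_univ]; exact hb.measure_lt_top.ne
  refine ⟨φ, hφt, ?_, fun i => ?_⟩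
  · have hbd : ∀ n, eLpNorm (fun x => w x - φ n x) 2 (volume.restrict U) ≤
        (volume.restrict U) univ ^ (2 : ℝ≥0∞).toReal⁻¹ * ENNReal.ofReal (3 * δ n) := by
      intro n
      refine eLpNorm_le_of_ae_bound ?_
      filter_upwards [ae_restrict_mem hU.measurableSet] with x hx
      have h1 := hWw n x
      rw [indicator_of_mem hx] at h1
      have h2 : |φ n x - W n x| ≤ 2 * δ n := by
        have e : φ n x - W n x = δ n * (G (W n x / δ n) - W n x / δ n) := by
          have := (hδ0 n).ne'
          simp only [hφ]; field_simp
        rw [e, abs_mul, abs_of_pos (hδ0 n), mul_comm]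
        exact mul_le_mul_of_nonneg_right (hGid _) (hδ0 n).le
      rw [Real.norm_eq_abs, abs_sub_comm]
      have h3 := abs_sub_le (φ n x) (W n x) (w x)
      have := hδ0 n
      linarith
    refine tendsto_of_tendsto_of_tendsto_of_le_of_le tendsto_const_nhds ?_
      (fun _ => zero_le) hbd
    have h1 : Tendsto (fun n => ENNReal.ofReal (3 * δ n)) atTop (𝓝 0) := by
      simpa using ENNReal.tendsto_ofReal (hδt.const_mul 3)
    have h2 := ENNReal.Tendsto.const_mul (a := (volume.restrict U) univ ^ (2 : ℝ≥0∞).toReal⁻¹)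
      h1 (Or.inr (ENNReal.rpow_ne_top_of_nonneg (by simp) hfin))
    simpa using h2
  · set γ := U.indicator (g i) with hγ
    have hγL : MemLp γ 2 volume := (memLp_indicator_iff_restrict hU.measurableSet).2 (hg i)
    set D : ℕ → Plane → ℝ := fun n x => deriv G (W n x / δ n) with hD
    have hDc : ∀ n, Continuous (D n) := fun n =>
      (hGs.continuous_deriv (by simp)).comp (hWd n).continuous
    set S : Set Plane := {x | U.indicator w x ≠ 0} with hS
    have hSm : MeasurableSet S := (isOpen_ne_fun hc continuous_const).measurableSet
    -- The gradient error splits into G' times the mollification error of the gradient (`A` below)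
    -- and this term, which tends to zero by dominated convergence.
    set E : ℕ → Plane → ℝ := fun n x => D n x * γ x - S.indicator γ x with hE
    have hEm : ∀ n, AEStronglyMeasurable (E n) volume := fun n =>
      ((hDc n).aestronglyMeasurable.mul hγL.1).sub (hγL.1.indicator hSm)
    have hE0 : Tendsto (fun n => eLpNorm (E n) 2 volume) atTop (𝓝 0) := by
      refine tendsto_eLpNorm_zero_of_dominated (b := fun x => (M + 1) * γ x) hEm
        (hγL.const_mul (M + 1)) (fun n => Eventually.of_forall fun x => ?_)
        (Eventually.of_forall fun x => ?_)
      · have h1 : ‖S.indicator γ x‖ ≤ ‖γ x‖ := norm_indicator_le_norm_self _ _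
        have h2 : ‖D n x * γ x‖ ≤ M * ‖γ x‖ := by
          rw [norm_mul]; exact mul_le_mul_of_nonneg_right (hGM _) (norm_nonneg _)
        calc ‖E n x‖ ≤ M * ‖γ x‖ + ‖γ x‖ := (norm_sub_le _ _).trans (add_le_add h2 h1)
          _ = ‖(M + 1) * γ x‖ := by
            rw [norm_mul, Real.norm_of_nonneg (add_nonneg hM0 zero_le_one)]; ring
      · by_cases hx : x ∈ S
        · have hpos : 0 < |U.indicator w x| := abs_pos.2 hx
          refine tendsto_const_nhds.congr' ?_
          -- If |w| > 3δₙ, then |Wₙ| > 3δₙ - δₙ/2 > 2δₙ, which is in the range where G' = 1.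
          filter_upwards [hδt.eventually_lt_const (show 0 < |U.indicator w x| / 3 by positivity)]
            with n hn
          have h1 := hWw n x
          have h2 := abs_sub_abs_le_abs_sub (U.indicator w x) (W n x)
          rw [abs_sub_comm] at h2
          have h3 : 2 < |W n x / δ n| := by
            have := hδ0 n
            rw [abs_div, abs_of_pos (hδ0 n), lt_div_iff₀ (hδ0 n)]
            linarith
          simp only [hE, hD]
          rw [hGd1 _ h3, indicator_of_mem hx, one_mul, sub_self]
        · refine tendsto_const_nhds.congr fun n => ?_
          have h1 : U.indicator w x = 0 := by simpa [hS] using hx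
          simp only [hE, hD]
          rw [indicator_of_notMem hx, hGd0 _ (hsmall n x (by
            rw [h1, abs_zero]; exact half_pos (hδ0 n))), zero_mul, sub_zero]
    set A : ℕ → Plane → ℝ := fun n x => D n x * (m n i x - γ x) with hA
    have hAm : ∀ n, AEStronglyMeasurable (A n) volume := fun n =>
      (hDc n).aestronglyMeasurable.mul ((hm n i).sub hγL.1)
    have hAb : ∀ n, eLpNorm (A n) 2 volume ≤ ENNReal.ofReal M * ENNReal.ofReal (δ n) := by
      intro n
      refine (eLpNorm_le_mul_eLpNorm_of_ae_le_mul (g := m n i - γ) (c := M)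
        (Eventually.of_forall fun x => ?_) 2).trans ?_
      · rw [norm_mul]; exact mul_le_mul_of_nonneg_right (hGM _) (norm_nonneg _)
      · gcongr
        exact hmg n i
    have hdec : ∀ n x, S.indicator γ x - partialDeriv i (φ n) x = -(A n x + E n x) := by
      intro n x
      rw [hpd]
      by_cases hx : δ n / 2 ≤ |U.indicator w x|
      · rw [hWm n i x hx]
        simp only [hA, hE, hD]; ring
      · have h0 : D n x = 0 := hGd0 _ (hsmall n x (not_le.1 hx))
        have h0' : deriv G (W n x / δ n) = 0 := h0
        simp only [hA, hE, h0, h0']; ring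
    have hbd : ∀ n, eLpNorm (fun x => S.indicator (g i) x - partialDeriv i (φ n) x) 2
        (volume.restrict U) ≤ ENNReal.ofReal M * ENNReal.ofReal (δ n) + eLpNorm (E n) 2 volume := by
      intro n
      have e1 : eLpNorm (fun x => S.indicator (g i) x - partialDeriv i (φ n) x) 2
          (volume.restrict U) = eLpNorm (-(A n + E n)) 2 (volume.restrict U) := by
        refine eLpNorm_congr_ae ?_
        filter_upwards [ae_restrict_mem hU.measurableSet] with x hx
        have : S.indicator (g i) x = S.indicator γ x := by
          by_cases hxS : x ∈ S
          · rw [indicator_of_mem hxS, indicator_of_mem hxS, hγ, indicator_of_mem hx]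
          · rw [indicator_of_notMem hxS, indicator_of_notMem hxS]
        rw [this, hdec]; rfl
      rw [e1, eLpNorm_neg]
      refine (eLpNorm_mono_measure _ Measure.restrict_le_self).trans ?_
      exact (eLpNorm_add_le (hAm n) (hEm n) (by norm_num)).trans (add_le_add (hAb n) le_rfl)
    refine tendsto_of_tendsto_of_tendsto_of_le_of_le tendsto_const_nhds ?_
      (fun _ => zero_le) hbd
    have h1 : Tendsto (fun n => ENNReal.ofReal (δ n)) atTop (𝓝 0) := by
      simpa using ENNReal.tendsto_ofReal hδt
    have h2 := ENNReal.Tendsto.const_mul (a := ENNReal.ofReal M) h1 (Or.inr ENNReal.ofReal_ne_top)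
    simpa using h2.add hE0

theorem MemL2.tendsto_integral_mul {f h : Plane → ℝ} (hf : MemL2 U f) (hh : MemL2 U h)
    {k : ℕ → Plane → ℝ} (hk : ∀ n, MemL2 U (k n))
    (ht : Tendsto (fun n => eLpNorm (fun x => h x - k n x) 2 (volume.restrict U)) atTop (𝓝 0)) :
    Tendsto (fun n => ∫ x in U, f x * k n x) atTop (𝓝 (∫ x in U, f x * h x)) := by
  refine tendsto_integral_of_L1 _ (hf.integrable_mul hh).1
    (Eventually.of_forall fun n => hf.integrable_mul (hk n)) ?_
  have hbd : ∀ n, ∫⁻ x in U, ‖f x * k n x - f x * h x‖ₑ ≤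
      eLpNorm f 2 (volume.restrict U) *
        eLpNorm (fun x => h x - k n x) 2 (volume.restrict U) := by
    intro n
    have e := eLpNorm_smul_le_mul_eLpNorm (p := 2) (q := 2) (r := 1)
      (μ := volume.restrict U) (hh.sub (hk n)).1 hf.1
    rw [eLpNorm_one_eq_lintegral_enorm] at e
    refine le_trans (le_of_eq ?_) e
    refine lintegral_congr fun x => ?_
    rw [← enorm_neg]
    congr 1
    simp only [Pi.smul_apply', Pi.sub_apply, smul_eq_mul]; ring
  refine tendsto_of_tendsto_of_tendsto_of_le_of_le tendsto_const_nhds ?_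
    (fun _ => zero_le) hbd
  simpa using ENNReal.Tendsto.const_mul (a := eLpNorm f 2 (volume.restrict U)) ht
    (Or.inr hf.2.ne)

theorem isWeakDeriv_of_tendsto {f g : Plane → ℝ} {i : Fin 2} (hf : MemL2 U f) (hg : MemL2 U g)
    {φ : ℕ → Plane → ℝ} (hφ : ∀ n, IsTestFunction U (φ n))
    (h1 : Tendsto (fun n => eLpNorm (fun x => f x - φ n x) 2 (volume.restrict U)) atTop (𝓝 0))
    (h2 : Tendsto (fun n => eLpNorm (fun x => g x - partialDeriv i (φ n) x) 2
      (volume.restrict U)) atTop (𝓝 0)) : IsWeakDeriv U i f g := by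
  intro η hη
  have t1 := MemL2.tendsto_integral_mul (U := U) ((hη.partialDeriv i).memLp _ _) hf
    (fun n => (hφ n).memLp _ _) h1
  have t2 := (MemL2.tendsto_integral_mul (U := U) (hη.memLp _ _) hg
    (fun n => ((hφ n).partialDeriv i).memLp _ _) h2).neg
  have e : ∀ n, ∫ x in U, partialDeriv i η x * φ n x =
      -∫ x in U, η x * partialDeriv i (φ n) x := by
    intro n
    have := isWeakDeriv_of_contDiff (hφ n).1 U i η hη
    simp_rw [mul_comm (partialDeriv i η _), mul_comm (η _)]
    exact this
  simp_rw [e] at t1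
  have := tendsto_nhds_unique t1 t2
  simp_rw [mul_comm (partialDeriv i η _), mul_comm (η _)] at this
  exact this

/-- Continuity up to the boundary keeps the sets |w| ≥ δ away from it, so the truncated
mollifications are test functions. No trace theorem and no assumption on the shape of U is involved.
-/
theorem memH10_of_continuousOn (hU : IsOpen U) (hb : Bornology.IsBounded U) (hw : MemH1 U w)
    (hc : ContinuousOn w (closure U)) (h0 : ∀ x ∈ frontier U, w x = 0) : MemH10 U w := by
  refine ⟨hw, fun δ hδ => ?_⟩
  have hL := fun i => (hw.2 i).memL2_weakDeriv
  set g : Fin 2 → Plane → ℝ := fun i => (hL i).1.aemeasurable.mk _ with hg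
  have hgm : ∀ i, Measurable (g i) := fun i => (hL i).1.aemeasurable.measurable_mk
  have hge : ∀ i, weakDeriv U i w =ᵐ[volume.restrict U] g i := fun i =>
    (hL i).1.aemeasurable.ae_eq_mk
  have hgL : ∀ i, MemL2 U (g i) := fun i => (hL i).ae_eq (hge i)
  have hgd : ∀ i, IsWeakDeriv U i w (g i) := fun i => (hw.2 i).isWeakDeriv.congr_ae .rfl (hge i)
  have hci := continuous_indicator_of_frontier hc h0
  obtain ⟨φ, hφ, t1, t2⟩ := exists_seq_isTestFunction hU hb hw.1 hci hgm hgL hgd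
  have hSm : MeasurableSet {x | U.indicator w x ≠ 0} :=
    (isOpen_ne_fun hci continuous_const).measurableSet
  -- The gradient vanishes almost everywhere on {w = 0}: the restricted gradient is an L² limit of
  -- gradients of φₙ → w, hence also a weak derivative of w, and weak derivatives are unique.
  have hee : ∀ i, {x | U.indicator w x ≠ 0}.indicator (g i) =ᵐ[volume.restrict U]
      weakDeriv U i w := fun i =>
    (isWeakDeriv_of_tendsto hw.1 ((hgL i).indicator hSm) hφ t1 (t2 i)).ae_eq hU
      (hw.2 i).isWeakDeriv ((hgL i).indicator hSm) (hL i)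
  have t3 : ∀ i, ∀ᶠ n in atTop, eLpNorm (fun x => weakDeriv U i w x - partialDeriv i (φ n) x) 2
      (volume.restrict U) < δ := fun i => by
    filter_upwards [(t2 i).eventually_lt_const hδ] with n hn
    rwa [eLpNorm_congr_ae (g := fun x => {x | U.indicator w x ≠ 0}.indicator (g i) x -
      partialDeriv i (φ n) x) ((hee i).mono fun x hx => by simp only [hx])]
  obtain ⟨n, h1, h2⟩ := ((t1.eventually_lt_const hδ).and (eventually_all.2 t3)).exists
  exact ⟨φ n, hφ n, h1, h2⟩

theorem MemH10.exists_seq (hw : MemH10 U w) : ∃ φ : ℕ → Plane → ℝ, (∀ n, IsTestFunction U (φ n)) ∧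
    Tendsto (fun n => eLpNorm (fun x => w x - φ n x) 2 (volume.restrict U)) atTop (𝓝 0) ∧
    ∀ i, Tendsto (fun n => eLpNorm (fun x => weakDeriv U i w x - partialDeriv i (φ n) x) 2
      (volume.restrict U)) atTop (𝓝 0) := by
  set δ : ℕ → ℝ≥0∞ := fun n => ENNReal.ofReal (1 / ((n : ℝ) + 1)) with hδ
  have hδt : Tendsto δ atTop (𝓝 0) := by
    rw [← ENNReal.ofReal_zero]
    exact ENNReal.tendsto_ofReal tendsto_one_div_add_atTop_nhds_zero_nat
  choose φ hφ h1 h2 using fun n => hw.2 (δ n) (ENNReal.ofReal_pos.2 (by positivity))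
  exact ⟨φ, hφ, tendsto_of_tendsto_of_tendsto_of_le_of_le tendsto_const_nhds hδt
      (fun _ => zero_le) fun n => (h1 n).le,
    fun i => tendsto_of_tendsto_of_tendsto_of_le_of_le tendsto_const_nhds hδt
      (fun _ => zero_le) fun n => (h2 n i).le⟩

/-- The zero boundary values allow a partial integration against any function of `H¹(U)`. -/
theorem MemH10.integral_mul_weakDeriv (hw : MemH10 U w) {f : Plane → ℝ} (hf : MemH1 U f)
    (i : Fin 2) : ∫ x in U, f x * weakDeriv U i w x = -∫ x in U, weakDeriv U i f x * w x := by
  obtain ⟨φ, hφ, t1, t2⟩ := hw.exists_seq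
  have l1 := MemL2.tendsto_integral_mul hf.1 (hw.1.2 i).memL2_weakDeriv
    (fun n => ((hφ n).partialDeriv i).memLp _ _) (t2 i)
  have l2 := (MemL2.tendsto_integral_mul (hf.2 i).memL2_weakDeriv hw.1.1
    (fun n => (hφ n).memLp _ _) t1).neg
  have e : ∀ n, ∫ x in U, f x * partialDeriv i (φ n) x =
      -∫ x in U, weakDeriv U i f x * φ n x := fun n => (hf.2 i).isWeakDeriv _ (hφ n)
  simp_rw [e] at l1
  exact tendsto_nhds_unique l1 l2

theorem ae_eq_zero_of_integral_mul_self {α : Type*} [MeasurableSpace α] {μ : Measure α}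
    {f : α → ℝ} (hf : MemLp f 2 μ) (h : ∫ x, f x * f x ∂μ = 0) : f =ᵐ[μ] 0 := by
  have := (integral_eq_zero_iff_of_nonneg (fun x => mul_self_nonneg (f x))
    (MemLp.integrable_mul hf hf)).1 h
  exact this.mono fun x hx => by simpa using hx

/-- This is the Poincaré argument with the multiplier x₀. If ∂₀w = 0, testing with x₀φ gives ∫ w φ =
-∫ x₀ w ∂₀φ for test functions φ. Letting φ tend to w in H¹ turns this into ∫ w² = -∫ x₀ w ∂₀w = 0.
-/
theorem MemH10.ae_eq_zero (hb : Bornology.IsBounded U) (hw : MemH10 U w)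
    (h : ∀ᵐ x ∂volume.restrict U, weakDeriv U 0 w x = 0) : w =ᵐ[volume.restrict U] 0 := by
  set X : Plane → ℝ := fun x => x 0 with hX
  have hXc : ContDiff ℝ ∞ X := contDiff_piLp_apply (i := (0 : Fin 2)) (p := 2)
  have hXL : ∀ p, MemLp X p (volume.restrict U) := fun p =>
    Continuous.memLp_restrict hXc.continuous hb p
  obtain ⟨φ, hφ, t1, t2⟩ := hw.exists_seq
  have l1 := MemL2.tendsto_integral_mul hw.1.1 hw.1.1 (fun n => (hφ n).memLp _ _) t1
  have hXw : MemL2 U (fun x => X x * w x) := by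
    have : MemLp (fun x => X x * w x) 2 (volume.restrict U) := hw.1.1.mul (hXL ⊤)
    exact this
  have l2 := (MemL2.tendsto_integral_mul hXw (hw.1.2 0).memL2_weakDeriv
    (fun n => ((hφ n).partialDeriv 0).memLp _ _) (t2 0)).neg
  have e : ∀ n, ∫ x in U, w x * φ n x = -∫ x in U, X x * w x * partialDeriv 0 (φ n) x := by
    intro n
    have h1 := (hw.1.2 0).isWeakDeriv _ ((hφ n).mul_left hXc)
    have h2 : ∫ x in U, weakDeriv U 0 w x * (X x * φ n x) = 0 := by
      refine integral_eq_zero_of_ae (h.mono fun x hx => ?_)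
      simp [hx]
    have hdX : ∀ x, fderiv ℝ X x (EuclideanSpace.single 0 1) = 1 := by
      intro x
      have : fderiv ℝ X x = EuclideanSpace.proj (0 : Fin 2) :=
        (EuclideanSpace.proj (0 : Fin 2) : Plane →L[ℝ] ℝ).hasFDerivAt.fderiv
      rw [this]; simp
    have h3 : ∀ x, w x * partialDeriv 0 (fun x => X x * φ n x) x =
        X x * w x * partialDeriv 0 (φ n) x + w x * φ n x := by
      intro x
      simp only [partialDeriv]
      rw [fderiv_fun_mul (hXc.differentiable (by simp)).differentiableAt
        ((hφ n).1.differentiable (by simp)).differentiableAt]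
      simp only [add_apply, smul_apply, smul_eq_mul, hdX]
      ring
    simp_rw [h3] at h1
    rw [integral_add (hXw.integrable_mul (((hφ n).partialDeriv 0).memLp _ _))
      (hw.1.1.integrable_mul ((hφ n).memLp _ _)), h2] at h1
    linarith
  simp_rw [e] at l1
  have h3 := tendsto_nhds_unique l1 l2
  have h4 : ∫ x in U, X x * w x * weakDeriv U 0 w x = 0 := by
    refine integral_eq_zero_of_ae (h.mono fun x hx => ?_)
    simp [hx]
  rw [h4, neg_zero] at h3
  exact ae_eq_zero_of_integral_mul_self hw.1.1 h3

theorem MemH10.smul_add (hU : IsOpen U) (c : ℝ) {w' : Plane → ℝ} (hw : MemH10 U w)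
    (hw' : MemH10 U w') : MemH10 U (c • w + w') := by
  refine ⟨hw.1.smul_add c hw'.1, fun δ hδ => ?_⟩
  obtain ⟨φ, hφ, s1, s2⟩ := hw.exists_seq
  obtain ⟨φ', hφ', t1, t2⟩ := hw'.exists_seq
  have key : ∀ {f f' : Plane → ℝ} {k k' : ℕ → Plane → ℝ}, MemL2 U f → MemL2 U f' →
      (∀ n, MemL2 U (k n)) → (∀ n, MemL2 U (k' n)) →
      Tendsto (fun n => eLpNorm (fun x => f x - k n x) 2 (volume.restrict U)) atTop (𝓝 0) →
      Tendsto (fun n => eLpNorm (fun x => f' x - k' n x) 2 (volume.restrict U)) atTop (𝓝 0) →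
      ∀ᶠ n in atTop, eLpNorm (fun x => (c • f + f') x - (c * k n x + k' n x)) 2
        (volume.restrict U) < δ := by
    intro f f' k k' hf hf' hk hk' h h'
    have hbd : ∀ n, eLpNorm (fun x => (c • f + f') x - (c * k n x + k' n x)) 2
        (volume.restrict U) ≤ ‖c‖ₑ * eLpNorm (fun x => f x - k n x) 2 (volume.restrict U) +
          eLpNorm (fun x => f' x - k' n x) 2 (volume.restrict U) := by
      intro n
      have e : (fun x => (c • f + f') x - (c * k n x + k' n x)) =
          c • (fun x => f x - k n x) + fun x => f' x - k' n x := by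
        ext x; simp only [Pi.add_apply, Pi.smul_apply, smul_eq_mul]; ring
      rw [e]
      refine (eLpNorm_add_le ((hf.sub (hk n)).const_smul c).1 (hf'.sub (hk' n)).1
        (by norm_num)).trans ?_
      exact add_le_add (eLpNorm_const_smul_le) le_rfl
    have ht := (ENNReal.Tendsto.const_mul (a := ‖c‖ₑ) h (Or.inr enorm_ne_top)).add h'
    rw [mul_zero, add_zero] at ht
    filter_upwards [ht.eventually_lt_const hδ] with n hn using (hbd n).trans_lt hn
  have k1 := key hw.1.1 hw'.1.1 (fun n => (hφ n).memLp _ _) (fun n => (hφ' n).memLp _ _) s1 t1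
  have k2 := fun i => key (hw.1.2 i).memL2_weakDeriv (hw'.1.2 i).memL2_weakDeriv
    (fun n => ((hφ n).partialDeriv i).memLp _ _) (fun n => ((hφ' n).partialDeriv i).memLp _ _)
    (s2 i) (t2 i)
  obtain ⟨n, h1, h2⟩ := (k1.and (eventually_all.2 k2)).exists
  refine ⟨fun x => c * φ n x + φ' n x, ⟨(contDiff_const.mul (hφ n).1).add (hφ' n).1,
    ((hφ n).2.1.mul_left).add (hφ' n).2.1, ?_⟩, h1, fun i => ?_⟩
  · refine (tsupport_add _ _).trans (union_subset ?_ (hφ' n).2.2)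
    exact (tsupport_mul_subset_right).trans (hφ n).2.2
  · have hpd : ∀ x, partialDeriv i (fun x => c * φ n x + φ' n x) x =
        c * partialDeriv i (φ n) x + partialDeriv i (φ' n) x := by
      intro x
      have d1 := ((hφ n).1.differentiable (by simp)).differentiableAt (x := x)
      have d2 := ((hφ' n).1.differentiable (by simp)).differentiableAt (x := x)
      simp only [partialDeriv]
      rw [fderiv_fun_add (d1.const_mul c) d2, fderiv_const_mul d1]
      simp
    refine lt_of_eq_of_lt (eLpNorm_congr_ae ?_) (h2 i)
    filter_upwards [weakDeriv_smul_add hU c hw.1.1 hw'.1.1 (hw.1.2 i) (hw'.1.2 i)] with x hx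
    rw [hx, hpd]

end Dirichlet

/-! ### The divergence theorem on a polygon -/

/-- The points with m = 0 in a punctured neighbourhood form an open set with open complement, and it
contains all large numbers; connectedness of ℝ finishes. Punctured neighbourhoods allow arbitrary
values at exceptional points, which will be the crossings of a line with the boundary. -/
theorem eventually_eq_zero_of_locally_const {m : ℝ → ℝ}
    (h : ∀ a, ∃ μ, ∀ᶠ x in 𝓝[≠] a, m x = μ) (h0 : ∃ R, ∀ a > R, m a = 0) (a : ℝ) :
    ∀ᶠ x in 𝓝[≠] a, m x = 0 := by
  have spread : ∀ (a μ : ℝ), (∀ᶠ x in 𝓝[≠] a, m x = μ) →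
      ∀ᶠ y in 𝓝 a, ∀ᶠ x in 𝓝[≠] y, m x = μ := by
    intro a μ hμ
    filter_upwards [eventually_eventually_nhds.2 (eventually_nhdsWithin_iff.1 hμ)] with y hy
    by_cases hya : y = a
    · rwa [hya]
    · filter_upwards [nhdsWithin_le_nhds hy, nhdsWithin_le_nhds (isOpen_ne.mem_nhds hya)]
        with x hx hxa using hx hxa
  set A : Set ℝ := {a | ∀ᶠ x in 𝓝[≠] a, m x = 0} with hA
  have hAo : IsOpen A := isOpen_iff_mem_nhds.2 fun a ha => spread a 0 ha
  have hAc : IsOpen Aᶜ := by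
    refine isOpen_iff_mem_nhds.2 fun a ha => ?_
    obtain ⟨μ, hμ⟩ := h a
    have hμ0 : μ ≠ 0 := by rintro rfl; exact ha hμ
    filter_upwards [spread a μ hμ] with y hy hyA
    obtain ⟨x, h1, h2⟩ := (hy.and hyA).exists
    exact hμ0 (h1.symm.trans h2)
  obtain ⟨R, hR⟩ := h0
  have hne : A.Nonempty := ⟨R + 1, by
    refine nhdsWithin_le_nhds ?_
    filter_upwards [Ioi_mem_nhds (lt_add_one R)] with x hx using hR x hx⟩
  have := IsClopen.eq_univ ⟨isOpen_compl_iff.1 hAc, hAo⟩ hne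
  have ha : a ∈ A := by rw [this]; exact mem_univ a
  exact ha

namespace Polygon

variable (K : Polygon)

/-- The outward normal on edge `i`, scaled by the length of the edge. -/
def edgeNormal (i : K.Idx) : Plane :=
  !₂[K.vertex (i + 1) 1 - K.vertex i 1, K.vertex i 0 - K.vertex (i + 1) 0]

theorem vertex_succ_ne (i : K.Idx) : K.vertex (i + 1) ≠ K.vertex i := by
  intro h
  have := K.vertex_injective h
  simp at this

theorem edgeLength_pos (i : K.Idx) : 0 < K.edgeLength i :=
  dist_pos.2 (K.vertex_succ_ne i).symm

theorem edgeLength_mul_normal (i : K.Idx) (j : Fin 2) :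
    K.edgeLength i * K.normal i j = K.edgeNormal i j := by
  rw [normal, PiLp.smul_apply, smul_eq_mul, mul_inv_cancel_left₀ (K.edgeLength_pos i).ne']
  rfl

theorem edgePoint_apply (i : K.Idx) (t : ℝ) (j : Fin 2) :
    K.edgePoint i t j = K.vertex i j + t * (K.vertex (i + 1) j - K.vertex i j) := by
  simp [edgePoint, AffineMap.lineMap_apply, add_comm]

theorem continuous_edgePoint (i : K.Idx) : Continuous (K.edgePoint i) :=
  AffineMap.lineMap_continuous

theorem edgePoint_mem_edge (i : K.Idx) {t : ℝ} (ht : t ∈ Icc (0 : ℝ) 1) :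
    K.edgePoint i t ∈ K.edge i := by
  rw [edge, segment_eq_image_lineMap]; exact mem_image_of_mem _ ht

theorem edgePoint_mem_openEdge (i : K.Idx) {t : ℝ} (ht : t ∈ Ioo (0 : ℝ) 1) :
    K.edgePoint i t ∈ K.openEdge i := by
  rw [openEdge, openSegment_eq_image_lineMap]; exact mem_image_of_mem _ ht

theorem exists_edgePoint_of_mem_edge {i : K.Idx} {x : Plane} (hx : x ∈ K.edge i) :
    ∃ t ∈ Icc (0 : ℝ) 1, K.edgePoint i t = x := by
  rwa [edge, segment_eq_image_lineMap] at hx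

theorem edge_subset_frontier (i : K.Idx) : K.edge i ⊆ frontier K.carrier := by
  rw [K.frontier_carrier]; exact subset_iUnion K.edge i

theorem isCompact_edge (i : K.Idx) : IsCompact (K.edge i) := by
  rw [edge, segment_eq_image_lineMap]
  exact isCompact_Icc.image AffineMap.lineMap_continuous

/-- Near a point inside an edge, the polygon is the half-plane to the left of this edge. -/
theorem exists_ball_side (i : K.Idx) {x₀ : Plane} (hx₀ : x₀ ∈ K.openEdge i) :
    ∃ r > 0, ∀ x ∈ Metric.ball x₀ r,
      (∑ j, (x j - x₀ j) * K.edgeNormal i j < 0 → x ∈ K.carrier) ∧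
      (0 < ∑ j, (x j - x₀ j) * K.edgeNormal i j → x ∉ K.carrier) := by
  -- The other edges form a closed set that misses x₀, so a small ball around x₀ meets the frontier
  -- only on the line through edge i.
  set S : Set Plane := ⋃ l : {l : K.Idx // l ≠ i}, K.edge l with hS
  have hSc : IsClosed S := isClosed_iUnion_of_finite fun l => (K.isCompact_edge l).isClosed
  have hxS : x₀ ∉ S := by
    rw [hS, mem_iUnion]
    rintro ⟨l, hl⟩
    exact disjoint_left.1 (K.simple i l l.2.symm) hx₀ hl
  obtain ⟨r, hr, hrS⟩ := Metric.mem_nhds_iff.1 (hSc.isOpen_compl.mem_nhds hxS)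
  set L : Plane → ℝ := fun x => ∑ j, (x j - x₀ j) * K.edgeNormal i j with hL
  have hLc : Continuous L := by rw [hL]; fun_prop
  obtain ⟨t₀, -, ht₀⟩ : ∃ t ∈ Icc (0 : ℝ) 1, K.edgePoint i t = x₀ :=
    K.exists_edgePoint_of_mem_edge (openSegment_subset_segment _ _ _ hx₀)
  have hfr : ∀ x ∈ Metric.ball x₀ r, x ∈ frontier K.carrier → L x = 0 := by
    intro x hx hxf
    rw [K.frontier_carrier, mem_iUnion] at hxf
    obtain ⟨l, hl⟩ := hxf
    by_cases hli : l = i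
    · subst hli
      obtain ⟨t, -, ht⟩ := K.exists_edgePoint_of_mem_edge hl
      rw [hL, ← ht, ← ht₀]
      simp only [Fin.sum_univ_two, edgePoint_apply, edgeNormal]
      simp
      ring
    · exact absurd (mem_iUnion.2 ⟨⟨l, hli⟩, hl⟩) (hrS hx)
  have hcv : ∀ s : ℝ, Convex ℝ (Metric.ball x₀ r ∩ {x | 0 < s * L x}) := by
    intro s
    refine (convex_ball _ _).inter ?_
    intro x hx y hy a b ha hb hab
    have hb' : b = 1 - a := by linarith
    have e : s * L (a • x + b • y) = a * (s * L x) + b * (s * L y) := by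
      simp only [hL, Fin.sum_univ_two, PiLp.add_apply, PiLp.smul_apply, smul_eq_mul, hb']
      ring
    rw [mem_ofPred_eq] at hx hy ⊢
    rw [e]
    rcases ha.eq_or_lt with h | h
    · have : b = 1 := by linarith
      rw [← h, this]; linarith
    · have := mul_pos h hx
      have := mul_nonneg hb hy.le
      linarith
  have hN : 0 < ∑ j, K.edgeNormal i j * K.edgeNormal i j := by
    have h1 : (∑ j, K.edgeNormal i j * K.edgeNormal i j) =
        (K.vertex (i + 1) 1 - K.vertex i 1) * (K.vertex (i + 1) 1 - K.vertex i 1) +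
        (K.vertex i 0 - K.vertex (i + 1) 0) * (K.vertex i 0 - K.vertex (i + 1) 0) := by
      simp [edgeNormal]
    rw [h1]
    refine lt_of_le_of_ne (add_nonneg (mul_self_nonneg _) (mul_self_nonneg _)) fun h => ?_
    have h2 := (mul_self_add_mul_self_eq_zero.1 h.symm)
    refine K.vertex_succ_ne i ?_
    ext j
    fin_cases j
    · exact (sub_eq_zero.1 h2.2).symm
    · exact sub_eq_zero.1 h2.1
  have hside := K.left_side i x₀ hx₀
  have hball : ∀ s : ℝ, ∀ᶠ t : ℝ in 𝓝[>] 0, x₀ + (s * t) • K.edgeNormal i ∈ Metric.ball x₀ r := by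
    intro s
    have : ContinuousAt (fun t : ℝ => x₀ + (s * t) • K.edgeNormal i) 0 := by fun_prop
    have := this.preimage_mem_nhds (t := Metric.ball x₀ r)
      (by simpa using Metric.ball_mem_nhds x₀ hr)
    exact nhdsWithin_le_nhds this
  obtain ⟨t, ⟨⟨ht1, ht2⟩, htm, htp⟩, ht⟩ :=
    ((hside.and ((hball (-1)).and (hball 1))).and self_mem_nhdsWithin).exists
  have ht : 0 < t := ht
  have hLt : ∀ s : ℝ, L (x₀ + (s * t) • K.edgeNormal i) =
      s * (t * ∑ j, K.edgeNormal i j * K.edgeNormal i j) := by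
    intro s
    simp only [hL, Fin.sum_univ_two, PiLp.add_apply, PiLp.smul_apply, smul_eq_mul]
    ring
  have htN := mul_pos ht hN
  -- An open half of the ball misses the frontier, so it is covered by the polygon and its exterior.
  -- Being convex, it lies in one of them, and `left_side` tells which.
  have hun : ∀ s : ℝ, Metric.ball x₀ r ∩ {x | 0 < s * L x} ⊆ K.carrier ∪ (closure K.carrier)ᶜ := by
    rintro s x ⟨hxb, hxs⟩
    by_contra hx
    rw [mem_union, not_or, notMem_compl_iff] at hx
    have : x ∈ frontier K.carrier := by
      rw [K.isOpen_carrier.frontier_eq]; exact ⟨hx.2, hx.1⟩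
    rw [mem_ofPred_eq, hfr x hxb this, mul_zero] at hxs
    exact lt_irrefl _ hxs
  have hdis : Disjoint K.carrier (closure K.carrier)ᶜ :=
    disjoint_compl_right_iff_subset.2 subset_closure
  have hminus := (hcv (-1)).isPreconnected.subset_left_of_subset_union K.isOpen_carrier
    isClosed_closure.isOpen_compl hdis (hun (-1))
    ⟨_, ⟨htm, by rw [mem_ofPred_eq, hLt]; linarith⟩, by
      have e : x₀ + (-1 * t) • K.edgeNormal i = x₀ - t • K.edgeNormal i := by
        rw [neg_one_mul, neg_smul, sub_eq_add_neg]
      rw [e]; exact ht1⟩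
  have hplus := (hcv 1).isPreconnected.subset_right_of_subset_union K.isOpen_carrier
    isClosed_closure.isOpen_compl hdis (hun 1)
    ⟨x₀ + (1 * t) • K.edgeNormal i, ⟨htp, by rw [mem_ofPred_eq, hLt]; linarith⟩, by
      have hm : x₀ + (1 * t) • K.edgeNormal i ∈ K.carrier ∪ (closure K.carrier)ᶜ :=
        hun 1 ⟨htp, by rw [mem_ofPred_eq, hLt]; linarith⟩
      refine hm.resolve_left ?_
      rw [one_mul]; exact ht2⟩
  refine ⟨r, hr, fun x hx => ⟨fun h => hminus ⟨hx, ?_⟩, fun h hxK => ?_⟩⟩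
  · rw [mem_ofPred_eq]; change L x < 0 at h; linarith
  · refine hplus ⟨hx, ?_⟩ (subset_closure hxK)
    rw [mem_ofPred_eq, one_mul]; exact h

end Polygon

/-! ### Fubini along lines parallel to a coordinate axis. -/

/-- The point with coordinate `j` equal to `a` and the other one equal to `b`. -/
def coordPoint (j : Fin 2) (a b : ℝ) : Plane := WithLp.toLp 2 fun i => if i = j then a else b

@[simp] theorem coordPoint_self (j : Fin 2) (a b : ℝ) : coordPoint j a b j = a := by
  simp [coordPoint]

theorem coordPoint_of_ne {j k : Fin 2} (h : k ≠ j) (a b : ℝ) : coordPoint j a b k = b := by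
  simp [coordPoint, h]

theorem eq_coordPoint {j k : Fin 2} (h : k ≠ j) (x : Plane) : x = coordPoint j (x j) (x k) := by
  ext i
  by_cases hi : i = j
  · rw [hi, coordPoint_self]
  · have : i = k := by omega
    rw [this, coordPoint_of_ne h]

theorem continuous_coordPoint (j : Fin 2) : Continuous fun z : ℝ × ℝ => coordPoint j z.1 z.2 := by
  refine (PiLp.continuous_toLp 2 _).comp (continuous_pi fun i => ?_)
  by_cases hi : i = j
  · simpa [hi] using continuous_fst
  · simpa [hi] using continuous_snd

theorem measurePreserving_coordPoint (j : Fin 2) :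
    MeasurePreserving (fun z : ℝ × ℝ => coordPoint j z.1 z.2) := by
  have h0 : MeasurePreserving (fun z : ℝ × ℝ => (WithLp.toLp 2 ![z.1, z.2] : Plane)) :=
    (PiLp.volume_preserving_toLp (Fin 2)).comp (volume_preserving_finTwoArrow ℝ).symm
  have hs : MeasurePreserving (Prod.swap : ℝ × ℝ → ℝ × ℝ) := Measure.measurePreserving_swap
  fin_cases j
  · convert h0 using 2 with z
    ext i; fin_cases i <;> simp [coordPoint]
  · convert h0.comp hs using 2 with z
    ext i; fin_cases i <;> simp [coordPoint]

theorem integral_eq_integral_coordPoint (j : Fin 2) {f : Plane → ℝ} (hf : Integrable f) :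
    ∫ x, f x = ∫ b, ∫ a, f (coordPoint j a b) := by
  have hmp := measurePreserving_coordPoint j
  have h1 : ∫ x, f x = ∫ z : ℝ × ℝ, f (coordPoint j z.1 z.2) := by
    rw [← hmp.map_eq, integral_map hmp.measurable.aemeasurable]
    rw [hmp.map_eq]; exact hf.1
  rw [h1, Measure.volume_eq_prod, integral_prod_symm]
  have := hmp.integrable_comp hf.1
  rw [Measure.volume_eq_prod] at this
  exact this.2 hf

/-! ### Crossings of axis-parallel lines with the edges, and the divergence theorem. -/

namespace Polygon

variable (K : Polygon) {j k : Fin 2}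

/-- The increment of coordinate `k` along edge `i`. -/
def delta (k : Fin 2) (i : K.Idx) : ℝ := K.vertex (i + 1) k - K.vertex i k

/-- Coordinate `j` of the point where edge `i` has coordinate `k` equal to `b`. -/
def crossing (j k : Fin 2) (i : K.Idx) (b : ℝ) : ℝ :=
  K.edgePoint i ((b - K.vertex i k) / K.delta k i) j

/-- The values of coordinate `k` inside edge `i`. -/
def range (k : Fin 2) (i : K.Idx) : Set ℝ :=
  Ioo (min (K.vertex i k) (K.vertex (i + 1) k)) (max (K.vertex i k) (K.vertex (i + 1) k))

theorem edgeNormal_eq (h : k ≠ j) : ∃ s : ℝ, (s = 1 ∨ s = -1) ∧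
    ∀ i, K.edgeNormal i j = s * K.delta k i := by
  fin_cases j <;> fin_cases k <;> first | exact absurd rfl h | skip
  · exact ⟨1, .inl rfl, fun i => by simp [edgeNormal, delta]⟩
  · exact ⟨-1, .inr rfl, fun i => by simp [edgeNormal, delta]⟩

theorem delta_ne_zero_of_mem_range {i : K.Idx} {b : ℝ} (hb : b ∈ K.range k i) :
    K.delta k i ≠ 0 := by
  intro h
  rw [delta, sub_eq_zero] at h
  rw [range, h, min_self, max_self, Ioo_self] at hb
  exact hb

theorem param_mem_Ioo {i : K.Idx} {b : ℝ} (hb : b ∈ K.range k i) :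
    (b - K.vertex i k) / K.delta k i ∈ Ioo (0 : ℝ) 1 := by
  rw [range] at hb
  rcases le_total (K.vertex i k) (K.vertex (i + 1) k) with h | h
  · rw [min_eq_left h, max_eq_right h] at hb
    have hd : 0 < K.delta k i := by rw [delta]; linarith [hb.1, hb.2]
    refine ⟨div_pos (by linarith [hb.1]) hd, (div_lt_one hd).2 ?_⟩
    rw [delta]; linarith [hb.2]
  · rw [min_eq_right h, max_eq_left h] at hb
    have hd : K.delta k i < 0 := by rw [delta]; linarith [hb.1, hb.2]
    refine ⟨div_pos_of_neg_of_neg (by linarith [hb.2]) hd, (div_lt_one_of_neg hd).2 ?_⟩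
    rw [delta]; linarith [hb.1]

theorem coordPoint_crossing (h : k ≠ j) {i : K.Idx} {b : ℝ} (hb : b ∈ K.range k i) :
    coordPoint j (K.crossing j k i b) b = K.edgePoint i ((b - K.vertex i k) / K.delta k i) := by
  rw [eq_coordPoint h (K.edgePoint i _)]
  congr 1
  rw [edgePoint_apply, ← delta, div_mul_cancel₀ _ (K.delta_ne_zero_of_mem_range hb)]
  ring

/-- Excluding the vertex values of b removes both the edges parallel to the line and the crossings
at endpoints, so every boundary point left on the line is interior to an edge that crosses the line
transversally. -/
theorem exists_crossing_of_mem_frontier (h : k ≠ j) {a b : ℝ}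
    (hb : ∀ i, b ≠ K.vertex i k) (hx : coordPoint j a b ∈ frontier K.carrier) :
    ∃ i, b ∈ K.range k i ∧ K.crossing j k i b = a := by
  rw [K.frontier_carrier, mem_iUnion] at hx
  obtain ⟨i, hi⟩ := hx
  obtain ⟨t, ⟨ht0, ht1⟩, ht⟩ := K.exists_edgePoint_of_mem_edge hi
  have hk : K.vertex i k + t * K.delta k i = b := by
    have := congrArg (fun x : Plane => x k) ht
    simp only [edgePoint_apply, coordPoint_of_ne h] at this
    exact this
  have hj : K.edgePoint i t j = a := by
    have := congrArg (fun x : Plane => x j) ht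
    simpa using this
  have hd : K.delta k i ≠ 0 := fun h0 => hb i (by rw [← hk, h0]; ring)
  have h0 : t ≠ 0 := fun h0 => hb i (by rw [← hk, h0]; ring)
  have h1 : t ≠ 1 := fun h1 => hb (i + 1) (by rw [← hk, h1, delta]; ring)
  have ht0' := lt_of_le_of_ne ht0 h0.symm
  have ht1' := lt_of_le_of_ne ht1 h1
  have hpar : (b - K.vertex i k) / K.delta k i = t := by
    rw [← hk, add_sub_cancel_left, mul_div_cancel_right₀ _ hd]
  refine ⟨i, ?_, by rw [crossing, hpar, hj]⟩
  rw [range]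
  rcases lt_or_gt_of_ne hd with hlt | hgt
  · rw [min_eq_right (by rw [delta] at hlt; linarith), max_eq_left (by rw [delta] at hlt; linarith)]
    have e : K.vertex (i + 1) k = K.vertex i k + K.delta k i := by rw [delta]; ring
    rw [e, ← hk]
    constructor <;> nlinarith
  · rw [min_eq_left (by rw [delta] at hgt; linarith), max_eq_right (by rw [delta] at hgt; linarith)]
    have e : K.vertex (i + 1) k = K.vertex i k + K.delta k i := by rw [delta]; ring
    rw [e, ← hk]
    constructor <;> nlinarith

open Classical in
/-- The signed indicator of the ray that ends at the crossing with edge `i`. -/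
def rayTerm (j k : Fin 2) (i : K.Idx) (a b : ℝ) : ℝ :=
  if b ∈ K.range k i ∧ a < K.crossing j k i b then SignType.sign (K.edgeNormal i j) else 0

theorem rayTerm_eventually_const (j k : Fin 2) (i : K.Idx) {a b : ℝ}
    (h : b ∈ K.range k i → K.crossing j k i b ≠ a) :
    ∀ᶠ x in 𝓝 a, K.rayTerm j k i x b = K.rayTerm j k i a b := by
  by_cases hb : b ∈ K.range k i
  · rcases lt_or_gt_of_ne (h hb) with h1 | h1
    · filter_upwards [Ioi_mem_nhds h1] with x hx
      rw [rayTerm, rayTerm, if_neg fun h => lt_asymm hx h.2, if_neg fun h => lt_asymm h1 h.2]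
    · filter_upwards [Iio_mem_nhds h1] with x hx
      rw [rayTerm, rayTerm, if_pos ⟨hb, hx⟩, if_pos ⟨hb, h1⟩]
  · refine Eventually.of_forall fun x => ?_
    rw [rayTerm, rayTerm, if_neg fun h => hb h.1, if_neg fun h => hb h.1]

theorem indicator_eventually_const {x : Plane} (hx : x ∉ frontier K.carrier) :
    ∀ᶠ y in 𝓝 x, K.carrier.indicator (1 : Plane → ℝ) y = K.carrier.indicator 1 x := by
  by_cases hxK : x ∈ K.carrier
  · filter_upwards [K.isOpen_carrier.mem_nhds hxK] with y hy
    rw [indicator_of_mem hy, indicator_of_mem hxK]; rfl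
  · have : x ∈ (closure K.carrier)ᶜ := fun h => hx (by
      rw [K.isOpen_carrier.frontier_eq]; exact ⟨h, hxK⟩)
    filter_upwards [isClosed_closure.isOpen_compl.mem_nhds this] with y hy
    rw [indicator_of_notMem (fun h => hy (subset_closure h)), indicator_of_notMem hxK]

/-- On a line parallel to a coordinate axis, the indicator of the polygon is the sum of the signed
indicators of the rays that end at the crossings with the edges. -/
theorem indicator_eq_sum_rayTerm (h : k ≠ j) {a b : ℝ} (hb : ∀ i, b ≠ K.vertex i k)
    (ha : ∀ i, b ∈ K.range k i → K.crossing j k i b ≠ a) :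
    K.carrier.indicator (1 : Plane → ℝ) (coordPoint j a b) = ∑ i, K.rayTerm j k i a b := by
  -- The difference of the two sides is constant near every non-crossing. At a crossing the jump of
  -- the indicator is that of one ray term, since the edge interior meets no other edge. The
  -- difference also vanishes far out to the right, so it vanishes everywhere off the crossings.
  set m : ℝ → ℝ := fun a => K.carrier.indicator (1 : Plane → ℝ) (coordPoint j a b) -
    ∑ i, K.rayTerm j k i a b with hm
  have hcb : Continuous fun a => coordPoint j a b :=
    (continuous_coordPoint j).comp (continuous_id.prodMk continuous_const)
  have hreg : ∀ a, (∀ i, b ∈ K.range k i → K.crossing j k i b ≠ a) → ∀ᶠ x in 𝓝 a, m x = m a := by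
    intro a ha
    have hnf : coordPoint j a b ∉ frontier K.carrier := fun hf => by
      obtain ⟨i, h1, h2⟩ := K.exists_crossing_of_mem_frontier h hb hf
      exact ha i h1 h2
    filter_upwards [hcb.continuousAt.eventually (K.indicator_eventually_const hnf),
      eventually_all.2 fun i => K.rayTerm_eventually_const j k i (ha i)] with x h1 h2
    simp only [hm]
    rw [h1, Finset.sum_congr rfl fun i _ => h2 i]
  have hlc : ∀ a, ∃ μ, ∀ᶠ x in 𝓝[≠] a, m x = μ := by
    intro a
    by_cases ha : ∀ i, b ∈ K.range k i → K.crossing j k i b ≠ a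
    · exact ⟨m a, nhdsWithin_le_nhds (hreg a ha)⟩
    push Not at ha
    obtain ⟨i, hi, rfl⟩ := ha
    set a := K.crossing j k i b with ha
    have hpt : coordPoint j a b ∈ K.openEdge i := by
      rw [ha, K.coordPoint_crossing h hi]
      exact K.edgePoint_mem_openEdge i (K.param_mem_Ioo hi)
    have hother : ∀ l, l ≠ i → b ∈ K.range k l → K.crossing j k l b ≠ a := by
      intro l hl hbl hla
      refine disjoint_left.1 (K.simple i l hl.symm) hpt ?_
      rw [← hla, K.coordPoint_crossing h hbl]
      exact openSegment_subset_segment _ _ _ (K.edgePoint_mem_openEdge l (K.param_mem_Ioo hbl))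
    obtain ⟨r, hr, hball⟩ := K.exists_ball_side i hpt
    have hsum : ∀ x, ∑ l, (coordPoint j x b l - coordPoint j a b l) * K.edgeNormal i l =
        (x - a) * K.edgeNormal i j := by
      intro x
      rw [Finset.sum_eq_single j]
      · simp
      · intro l _ hl
        rw [coordPoint_of_ne hl, coordPoint_of_ne hl, sub_self, zero_mul]
      · simp
    have hN : K.edgeNormal i j ≠ 0 := by
      obtain ⟨s, hs, he⟩ := K.edgeNormal_eq h
      rw [he]
      exact mul_ne_zero (by rcases hs with rfl | rfl <;> norm_num) (K.delta_ne_zero_of_mem_range hi)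
    refine ⟨(if 0 < K.edgeNormal i j then 0 else 1) -
      ∑ l ∈ Finset.univ.erase i, K.rayTerm j k l a b, ?_⟩
    have hev : ∀ᶠ x in 𝓝[≠] a, ∀ l, l ≠ i → K.rayTerm j k l x b = K.rayTerm j k l a b := by
      refine nhdsWithin_le_nhds (eventually_all.2 fun l => ?_)
      by_cases hl : l = i
      · exact Eventually.of_forall fun x hx => absurd hl hx
      · filter_upwards [K.rayTerm_eventually_const j k l (hother l hl)] with x hx _ using hx
    filter_upwards [hev, nhdsWithin_le_nhds
      (hcb.continuousAt.eventually (Metric.ball_mem_nhds (coordPoint j a b) hr)),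
      self_mem_nhdsWithin] with x h1 h2 h3
    have hb2 := hball _ h2
    rw [hsum] at hb2
    have hxa : x ≠ a := h3
    simp only [hm]
    rw [← Finset.add_sum_erase _ _ (Finset.mem_univ i),
      Finset.sum_congr rfl fun l hl => h1 l (Finset.ne_of_mem_erase hl)]
    -- On both sides of the crossing this difference has the same value: 0 if the polygon is left by
    -- increasing x, and 1 if it is entered.
    have key : K.carrier.indicator (1 : Plane → ℝ) (coordPoint j x b) - K.rayTerm j k i x b =
        if 0 < K.edgeNormal i j then 0 else 1 := by
      rcases lt_or_gt_of_ne hxa with hlt | hgt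
      · rw [rayTerm, if_pos ⟨hi, hlt⟩]
        rcases lt_or_gt_of_ne hN with hneg | hpos
        · rw [if_neg (not_lt.2 hneg.le), sign_neg hneg,
            indicator_of_notMem (hb2.2 (mul_pos_of_neg_of_neg (sub_neg.2 hlt) hneg))]
          simp
        · rw [if_pos hpos, sign_pos hpos,
            indicator_of_mem (hb2.1 (mul_neg_of_neg_of_pos (sub_neg.2 hlt) hpos))]
          simp
      · rw [rayTerm, if_neg fun h => lt_asymm hgt h.2]
        rcases lt_or_gt_of_ne hN with hneg | hpos
        · rw [if_neg (not_lt.2 hneg.le),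
            indicator_of_mem (hb2.1 (mul_neg_of_pos_of_neg (sub_pos.2 hgt) hneg))]
          simp
        · rw [if_pos hpos, indicator_of_notMem (hb2.2 (mul_pos (sub_pos.2 hgt) hpos))]
          simp
    rw [← key]; ring
  have hinf : ∃ R, ∀ a > R, m a = 0 := by
    obtain ⟨R, hR⟩ := K.isBounded_carrier.subset_closedBall 0
    obtain ⟨R', hR'⟩ := (Finite.bddAbove_range fun i => K.crossing j k i b)
    refine ⟨max R R', fun a ha => ?_⟩
    simp only [hm]
    rw [indicator_of_notMem, Finset.sum_eq_zero, sub_zero]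
    · intro i _
      rw [rayTerm, if_neg]
      rintro ⟨-, h2⟩
      have : K.crossing j k i b ≤ R' := hR' ⟨i, rfl⟩
      linarith [le_max_right R R']
    · intro hK
      have h1 := hR hK
      rw [mem_closedBall_zero_iff] at h1
      have h2 := PiLp.norm_apply_le (coordPoint j a b) j
      rw [coordPoint_self] at h2
      have := le_abs_self a
      rw [Real.norm_eq_abs] at h2
      linarith [le_max_left R R']
  -- The vanishing is known only in a punctured neighbourhood of a; local constancy at the
  -- non-crossing a transfers it to a itself.
  obtain ⟨x, h1, h2⟩ := ((eventually_eq_zero_of_locally_const hlc hinf a).and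
    (nhdsWithin_le_nhds (hreg a ha))).exists
  have : m a = 0 := h2.symm.trans h1
  exact sub_eq_zero.1 this

/-- The fundamental theorem of calculus on the half-line left of the crossing leaves the value of f
at the crossing, as f has compact support. -/
theorem integral_rayTerm_mul {f : Plane → ℝ} (hf : ContDiff ℝ ∞ f) (hs : HasCompactSupport f)
    (h : k ≠ j) (i : K.Idx) (b : ℝ) :
    Integrable (fun a => K.rayTerm j k i a b * partialDeriv j f (coordPoint j a b)) ∧
    ∫ a, K.rayTerm j k i a b * partialDeriv j f (coordPoint j a b) =
      (K.range k i).indicator (fun b => SignType.sign (K.edgeNormal i j) *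
        f (K.edgePoint i ((b - K.vertex i k) / K.delta k i))) b := by
  by_cases hb : b ∈ K.range k i
  swap
  · have : ∀ a, K.rayTerm j k i a b = 0 := fun a => if_neg fun h => hb h.1
    simp [this, hb]
  set g : ℝ → ℝ := fun a => f (coordPoint j a b) with hg
  have hline : ∀ a, coordPoint j a b = coordPoint j 0 b + a • EuclideanSpace.single j (1 : ℝ) := by
    intro a
    ext l
    by_cases hl : l = j
    · subst hl
      rw [PiLp.add_apply, PiLp.smul_apply, coordPoint_self, coordPoint_self,
        PiLp.single_apply, if_pos rfl, smul_eq_mul, mul_one, zero_add]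
    · rw [PiLp.add_apply, PiLp.smul_apply, coordPoint_of_ne hl, coordPoint_of_ne hl,
        PiLp.single_apply, if_neg hl, smul_zero, add_zero]
  have hgd : ∀ a, HasDerivAt g (partialDeriv j f (coordPoint j a b)) a := by
    intro a
    have h1 : HasDerivAt (fun a => coordPoint j a b) (EuclideanSpace.single j (1 : ℝ)) a := by
      rw [funext hline]
      have h2 := ((hasDerivAt_id a).smul_const (EuclideanSpace.single j (1 : ℝ))).const_add
        (coordPoint j 0 b)
      rwa [one_smul] at h2
    exact ((hf.differentiable (by simp)).differentiableAt.hasFDerivAt).comp_hasDerivAt a h1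
  have hcp : ContDiff ℝ ∞ fun a => coordPoint j a b := by
    rw [funext hline]; fun_prop
  have hgc : ContDiff ℝ 1 g := (hf.comp hcp).of_le (by simp)
  have hgs : HasCompactSupport g := by
    refine hs.comp_isClosedEmbedding ?_
    refine Topology.IsClosedEmbedding.of_continuous_injective_isClosedMap hcp.continuous ?_ ?_
    · intro a a' haa
      have := congrArg (fun x : Plane => x j) haa
      simpa using this
    · have hproper : Continuous fun x : Plane => x j := by fun_prop
      intro s hs'
      have : (fun a => coordPoint j a b) '' s = {x : Plane | x j ∈ s} ∩ {x | x k = b} := by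
        ext x
        constructor
        · rintro ⟨a, ha, rfl⟩
          exact ⟨by simpa using ha, coordPoint_of_ne h a b⟩
        · rintro ⟨h1, h2⟩
          refine ⟨x j, h1, ?_⟩
          have h2 : x k = b := h2
          rw [← h2]; exact (eq_coordPoint h x).symm
      rw [this]
      exact (hs'.preimage hproper).inter (isClosed_eq (by fun_prop) continuous_const)
  have hderiv : deriv g = fun a => partialDeriv j f (coordPoint j a b) :=
    funext fun a => (hgd a).deriv
  have hint : Integrable (deriv g) :=
    (hgc.continuous_deriv le_rfl).integrable_of_hasCompactSupport hgs.deriv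
  have e : (fun a => K.rayTerm j k i a b * partialDeriv j f (coordPoint j a b)) =
      fun a => SignType.sign (K.edgeNormal i j) *
        (Iio (K.crossing j k i b)).indicator (deriv g) a := by
    ext a
    by_cases ha : a < K.crossing j k i b
    · rw [rayTerm, if_pos ⟨hb, ha⟩, indicator_of_mem (show a ∈ Iio _ from ha), hderiv]
    · rw [rayTerm, if_neg fun h => ha h.2, indicator_of_notMem (show a ∉ Iio _ from ha), zero_mul,
        mul_zero]
  rw [e]
  refine ⟨(hint.indicator measurableSet_Iio).const_mul _, ?_⟩
  rw [integral_const_mul, integral_indicator measurableSet_Iio, ← integral_Iic_eq_integral_Iio,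
    hgs.integral_Iic_deriv_eq hgc, indicator_of_mem hb, hg]
  simp only
  rw [K.coordPoint_crossing h hb]

/-- Substitute b = (coordinate k of the first vertex) + t · `delta`. Up to a common sign, `delta` is
the component j of the scaled normal; its sign combines with the orientation of the interval, and
for an edge parallel to the line both sides are zero. -/
theorem integral_range (h : k ≠ j) {f : Plane → ℝ} (hf : Continuous f) (i : K.Idx) :
    Integrable ((K.range k i).indicator (fun b => SignType.sign (K.edgeNormal i j) *
        f (K.edgePoint i ((b - K.vertex i k) / K.delta k i)))) ∧
    ∫ b, (K.range k i).indicator (fun b => SignType.sign (K.edgeNormal i j) *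
        f (K.edgePoint i ((b - K.vertex i k) / K.delta k i))) b =
      K.edgeNormal i j * ∫ t in (0 : ℝ)..1, f (K.edgePoint i t) := by
  set F : ℝ → ℝ := fun b => f (K.edgePoint i ((b - K.vertex i k) / K.delta k i)) with hF
  have hFc : Continuous F :=
    hf.comp ((K.continuous_edgePoint i).comp ((continuous_id.sub continuous_const).div_const _))
  have hm : MeasurableSet (K.range k i) := measurableSet_Ioo
  constructor
  · rw [integrable_indicator_iff hm]
    exact ((continuous_const.mul hFc).integrableOn_Icc).mono_set Ioo_subset_Icc_self
  rw [integral_indicator hm, integral_const_mul]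
  have hsub : K.delta k i * ∫ t in (0 : ℝ)..1, f (K.edgePoint i t) =
      ∫ b in (K.vertex i k)..(K.vertex (i + 1) k), F b := by
    by_cases hd : K.delta k i = 0
    · have : K.vertex (i + 1) k = K.vertex i k := sub_eq_zero.1 hd
      rw [hd, this]; simp
    · have := intervalIntegral.smul_integral_comp_mul_add (a := 0) (b := 1) F (K.delta k i)
        (K.vertex i k)
      have e : K.delta k i * 1 + K.vertex i k = K.vertex (i + 1) k := by rw [delta]; ring
      rw [e, mul_zero, zero_add, smul_eq_mul] at this
      rw [← this]
      congr 1
      refine intervalIntegral.integral_congr fun t _ => ?_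
      simp only [hF]
      rw [add_sub_cancel_right, mul_div_cancel_left₀ _ hd]
  obtain ⟨s, hs, he⟩ := K.edgeNormal_eq h
  rw [he, mul_assoc, hsub, range]
  have hsgn : ∀ x : ℝ, ((SignType.sign (s * x) : SignType) : ℝ) = s * (SignType.sign x : SignType) := by
    intro x
    rcases hs with rfl | rfl
    · simp
    · rw [neg_one_mul, neg_one_mul, Left.sign_neg]; simp
  rw [hsgn, mul_assoc]
  congr 1
  rcases lt_trichotomy (K.vertex i k) (K.vertex (i + 1) k) with h1 | h1 | h1
  · rw [min_eq_left h1.le, max_eq_right h1.le, sign_pos (by rw [delta]; linarith),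
      intervalIntegral.integral_of_le h1.le, integral_Ioc_eq_integral_Ioo]
    simp [hF]
  · have : K.delta k i = 0 := by rw [delta, h1, sub_self]
    rw [h1]; simp
  · rw [min_eq_right h1.le, max_eq_left h1.le, sign_neg (by rw [delta]; linarith),
      intervalIntegral.integral_of_ge h1.le, integral_Ioc_eq_integral_Ioo]
    simp [hF]

/-- The divergence theorem for smooth functions with compact support. -/
theorem integral_partialDeriv_of_hasCompactSupport {f : Plane → ℝ} (hf : ContDiff ℝ ∞ f)
    (hs : HasCompactSupport f) (j : Fin 2) :
    ∫ x in K.carrier, partialDeriv j f x =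
      ∑ i, K.edgeNormal i j * ∫ t in (0 : ℝ)..1, f (K.edgePoint i t) := by
  obtain ⟨k, h⟩ : ∃ k : Fin 2, k ≠ j := exists_ne j
  have hpc : Continuous (partialDeriv j f) := (contDiff_partialDeriv hf j).continuous
  have hps : HasCompactSupport (partialDeriv j f) := hs.fderiv_apply ℝ _
  have hint : Integrable (K.carrier.indicator (partialDeriv j f)) :=
    (hpc.integrable_of_hasCompactSupport hps).indicator K.isOpen_carrier.measurableSet
  rw [← integral_indicator K.isOpen_carrier.measurableSet,
    integral_eq_integral_coordPoint j hint]
  have hinner : ∀ᵐ b : ℝ, ∫ a, K.carrier.indicator (partialDeriv j f) (coordPoint j a b) =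
      ∑ i, (K.range k i).indicator (fun b => SignType.sign (K.edgeNormal i j) *
        f (K.edgePoint i ((b - K.vertex i k) / K.delta k i))) b := by
    -- Lines through a vertex, and on the other lines the crossing points, are finite in number and
    -- do not affect the integrals.
    have hb : ∀ᵐ b : ℝ, ∀ i, b ≠ K.vertex i k :=
      ae_all_iff.2 fun i => by simp [ae_iff]
    filter_upwards [hb] with b hb
    have ha : ∀ᵐ a : ℝ, ∀ i, K.crossing j k i b ≠ a :=
      ae_all_iff.2 fun i => by simp [ae_iff]
    have e : (fun a => K.carrier.indicator (partialDeriv j f) (coordPoint j a b)) =ᵐ[volume]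
        fun a => ∑ i, K.rayTerm j k i a b * partialDeriv j f (coordPoint j a b) := by
      filter_upwards [ha] with a ha
      rw [← Finset.sum_mul, ← K.indicator_eq_sum_rayTerm h hb fun i _ => ha i]
      by_cases hx : coordPoint j a b ∈ K.carrier <;> simp [hx]
    rw [integral_congr_ae e,
      integral_finsetSum _ fun i _ => (K.integral_rayTerm_mul hf hs h i b).1]
    exact Finset.sum_congr rfl fun i _ => (K.integral_rayTerm_mul hf hs h i b).2
  rw [integral_congr_ae hinner,
    integral_finsetSum _ fun i _ => (K.integral_range h hf.continuous i).1]
  exact Finset.sum_congr rfl fun i _ => (K.integral_range h hf.continuous i).2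

/-- The divergence theorem for smooth functions. -/
theorem integral_partialDeriv {f : Plane → ℝ} (hf : ContDiff ℝ ∞ f) (j : Fin 2) :
    ∫ x in K.carrier, partialDeriv j f x =
      ∑ i, K.edgeIntegral i (fun t => f (K.edgePoint i t)) * K.normal i j := by
  obtain ⟨R, hR0, hR⟩ := K.isBounded_carrier.subset_ball_lt 0 0
  -- A cutoff equal to 1 on the closed polygon reduces the claim to compact support without changing
  -- either side.
  set χ : ContDiffBump (0 : Plane) := ⟨R, R + 1, hR0, by linarith⟩ with hχ
  have hχ1 : ∀ x ∈ closure K.carrier, χ x = 1 := fun x hx => by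
    refine χ.one_of_mem_closedBall ?_
    exact closure_minimal (hR.trans Metric.ball_subset_closedBall) Metric.isClosed_closedBall hx
  have h1 := K.integral_partialDeriv_of_hasCompactSupport (f := fun x => f x * χ x)
    (hf.mul χ.contDiff) χ.hasCompactSupport.mul_left j
  have h2 : ∫ x in K.carrier, partialDeriv j (fun x => f x * χ x) x =
      ∫ x in K.carrier, partialDeriv j f x := by
    refine setIntegral_congr_fun K.isOpen_carrier.measurableSet fun x hx => ?_
    have : (fun x => f x * χ x) =ᶠ[𝓝 x] f := by
      filter_upwards [K.isOpen_carrier.mem_nhds hx] with y hy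
      rw [hχ1 y (subset_closure hy), mul_one]
    simp only [partialDeriv]
    rw [this.fderiv_eq]
  rw [← h2, h1]
  refine Finset.sum_congr rfl fun i _ => ?_
  have h3 : ∫ t in (0 : ℝ)..1, f (K.edgePoint i t) * χ (K.edgePoint i t) =
      ∫ t in (0 : ℝ)..1, f (K.edgePoint i t) := by
    refine intervalIntegral.integral_congr fun t ht => ?_
    rw [uIcc_of_le zero_le_one] at ht
    rw [hχ1 _ (frontier_subset_closure (K.edge_subset_frontier i (K.edgePoint_mem_edge i ht))),
      mul_one]
  rw [h3, ← K.edgeLength_mul_normal, edgeIntegral]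
  ring

end Polygon

namespace Polygon

variable (K : Polygon)

/-! ### Traces on the edges of a polygon -/

/-- The edge lies in an affine line, a proper subspace of the plane. -/
theorem volume_edge (i : K.Idx) : volume (K.edge i) = 0 := by
  have hsub : K.edge i ⊆ (AffineSubspace.map (AffineMap.lineMap (k := ℝ) (K.vertex i)
      (K.vertex (i + 1))) ⊤ : AffineSubspace ℝ Plane) := by
    rw [edge, segment_eq_image_lineMap]
    rintro x ⟨t, -, rfl⟩
    exact ⟨t, trivial, rfl⟩
  refine measure_mono_null hsub (Measure.addHaar_affineSubspace _ _ fun h => ?_)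
  have h1 := AffineSubspace.map_direction
    (AffineMap.lineMap (k := ℝ) (K.vertex i) (K.vertex (i + 1))) ⊤
  rw [h, AffineSubspace.direction_top, AffineSubspace.direction_top] at h1
  have h2 := Submodule.finrank_map_le
    ((AffineMap.lineMap (k := ℝ) (K.vertex i) (K.vertex (i + 1))).linear) ⊤
  rw [← h1, finrank_top, finrank_top] at h2
  simp at h2

theorem volume_frontier : volume (frontier K.carrier) = 0 := by
  rw [K.frontier_carrier]
  exact measure_iUnion_null K.volume_edge

theorem edgeIntegral_eq (i : K.Idx) (f : ℝ → ℝ) :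
    K.edgeIntegral i f = K.edgeLength i * ∫ t in Icc (0 : ℝ) 1, f t := by
  rw [edgeIntegral, intervalIntegral.integral_of_le zero_le_one, integral_Icc_eq_integral_Ioc]

theorem edgeIntegral_congr_ae (i : K.Idx) {f g : ℝ → ℝ}
    (h : f =ᵐ[volume.restrict (Icc (0 : ℝ) 1)] g) : K.edgeIntegral i f = K.edgeIntegral i g := by
  rw [edgeIntegral_eq, edgeIntegral_eq, integral_congr_ae h]

theorem edgeIntegral_smul_add (i : K.Idx) {f g : ℝ → ℝ} (c : ℝ)
    (hf : IntegrableOn f (Icc (0 : ℝ) 1)) (hg : IntegrableOn g (Icc (0 : ℝ) 1)) :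
    K.edgeIntegral i (fun t => c * f t + g t) =
      c * K.edgeIntegral i f + K.edgeIntegral i g := by
  rw [edgeIntegral_eq, edgeIntegral_eq, edgeIntegral_eq, integral_add (hf.const_mul c) hg,
    integral_const_mul]
  ring

theorem _root_.Continuous.memLp_Icc {h : ℝ → ℝ} (hh : Continuous h) (p : ℝ≥0∞) (a b : ℝ) :
    MemLp h p (volume.restrict (Icc a b)) := by
  obtain ⟨C, hC⟩ := isCompact_Icc.exists_bound_of_continuousOn (hh.continuousOn (s := Icc a b))
  refine MemLp.of_bound hh.aestronglyMeasurable C ?_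
  filter_upwards [ae_restrict_mem measurableSet_Icc] with x hx using hC x hx

theorem _root_.MeasureTheory.MemLp.integrableOn_mul_continuous {f h : ℝ → ℝ} {a b : ℝ}
    (hf : MemLp f 2 (volume.restrict (Icc a b))) (hh : Continuous h) :
    IntegrableOn (fun t => f t * h t) (Icc a b) :=
  MemLp.integrable_mul hf (hh.memLp_Icc 2 a b)

theorem ae_mem_Ioo : ∀ᵐ t ∂volume.restrict (Icc (0 : ℝ) 1), t ∈ Ioo (0 : ℝ) 1 := by
  rw [← restrict_Ioo_eq_restrict_Icc]
  exact ae_restrict_mem measurableSet_Ioo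

variable {K} {v v' g g' : Plane → ℝ}

theorem IsNormalTrace.memLp (h : K.IsNormalTrace v g) (i : K.Idx) :
    MemLp (fun t => g (K.edgePoint i t)) 2 (volume.restrict (Icc (0 : ℝ) 1)) := h.1 i

/-- The affine parameter of an edge extends to a smooth function on the plane. -/
theorem exists_contDiff_param (i : K.Idx) :
    ∃ τ : Plane → ℝ, ContDiff ℝ ∞ τ ∧ ∀ t, τ (K.edgePoint i t) = t := by
  set d := K.vertex (i + 1) - K.vertex i with hd
  have hd0 : d ≠ 0 := sub_ne_zero.2 (K.vertex_succ_ne i)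
  have hdd : inner ℝ d d ≠ (0 : ℝ) := inner_self_ne_zero.2 hd0
  refine ⟨fun x => inner ℝ (x - K.vertex i) d / inner ℝ d d,
    ((contDiff_id.sub contDiff_const).inner ℝ contDiff_const).div_const _, fun t => ?_⟩
  have : K.edgePoint i t - K.vertex i = t • d := by
    simp [edgePoint, AffineMap.lineMap_apply, hd]
  simp only [this, inner_smul_left]
  rw [mul_div_cancel_right₀ _ hdd]
  simp

theorem IsNormalTrace.ae_eq (h : K.IsNormalTrace v g) (h' : K.IsNormalTrace v g') (i : K.Idx) :
    (fun t => g (K.edgePoint i t)) =ᵐ[volume.restrict (Icc (0 : ℝ) 1)]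
      fun t => g' (K.edgePoint i t) := by
  set S : Set Plane := ⋃ l : {l : K.Idx // l ≠ i}, K.edge l with hS
  have hSc : IsClosed S := isClosed_iUnion_of_finite fun l => (K.isCompact_edge l).isClosed
  -- Multiplying test functions by χ isolates edge i: χ vanishes on all other edges and has no zero
  -- inside edge i, so it can be divided out at the end.
  obtain ⟨χ, hχS, hχ, -⟩ := hSc.isOpen_compl.exists_contDiff_support_eq (n := (⊤ : ℕ∞))
  have hχ0 : ∀ l, l ≠ i → ∀ t ∈ Icc (0 : ℝ) 1, χ (K.edgePoint l t) = 0 := by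
    intro l hl t ht
    by_contra hne
    have : K.edgePoint l t ∈ Function.support χ := hne
    rw [hχS] at this
    exact this (mem_iUnion.2 ⟨⟨l, hl⟩, K.edgePoint_mem_edge l ht⟩)
  have hχ1 : ∀ t ∈ Ioo (0 : ℝ) 1, χ (K.edgePoint i t) ≠ 0 := by
    intro t ht
    have : K.edgePoint i t ∈ Function.support χ := by
      rw [hχS, mem_compl_iff, hS, mem_iUnion]
      rintro ⟨⟨l, hl⟩, hl'⟩
      exact disjoint_left.1 (K.simple i l hl.symm) (K.edgePoint_mem_openEdge i ht) hl'
    exact this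
  obtain ⟨τ, hτ, hτe⟩ := exists_contDiff_param (K := K) i
  set d : ℝ → ℝ := fun t => g (K.edgePoint i t) - g' (K.edgePoint i t) with hd
  have hdL : MemLp d 2 (volume.restrict (Icc (0 : ℝ) 1)) := (h.memLp i).sub (h'.memLp i)
  have hχc : Continuous fun t => χ (K.edgePoint i t) :=
    hχ.continuous.comp (K.continuous_edgePoint i)
  have key : ∀ᵐ t ∂volume, t ∈ Ioo (0 : ℝ) 1 → d t * χ (K.edgePoint i t) = 0 := by
    refine isOpen_Ioo.ae_eq_zero_of_integral_contDiff_smul_eq_zero ?_ ?_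
    · exact ((hdL.integrableOn_mul_continuous hχc).mono_set
        Ioo_subset_Icc_self).locallyIntegrableOn
    · intro η hη hηc hηs
      -- A test function η of the edge parameter becomes a smooth function on the plane through the
      -- affine extension τ of this parameter.
      have e := (h.2 (fun x => χ x * η (τ x)) (hχ.mul (hη.comp hτ))).symm.trans
        (h'.2 (fun x => χ x * η (τ x)) (hχ.mul (hη.comp hτ)))
      have hz : ∀ G : Plane → ℝ, ∑ l, K.edgeIntegral l (fun t => G (K.edgePoint l t) *
          (χ (K.edgePoint l t) * η (τ (K.edgePoint l t)))) =
          K.edgeIntegral i (fun t => G (K.edgePoint i t) * (χ (K.edgePoint i t) * η t)) := by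
        intro G
        rw [Finset.sum_eq_single i]
        · simp_rw [hτe]
        · intro l _ hl
          rw [edgeIntegral_eq, setIntegral_congr_fun (g := fun _ => (0 : ℝ)) measurableSet_Icc]
          · simp
          · intro t ht
            simp only
            rw [hχ0 l hl t ht]; ring
        · simp
      rw [hz, hz, edgeIntegral_eq, edgeIntegral_eq] at e
      have e := mul_left_cancel₀ (K.edgeLength_pos i).ne' e
      have hχη : Continuous fun t => χ (K.edgePoint i t) * η t := hχc.mul hη.continuous
      have h0 : ∫ t in Icc (0 : ℝ) 1, η t • (d t * χ (K.edgePoint i t)) = 0 := by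
        have : ∀ t, η t • (d t * χ (K.edgePoint i t)) =
            g (K.edgePoint i t) * (χ (K.edgePoint i t) * η t) -
            g' (K.edgePoint i t) * (χ (K.edgePoint i t) * η t) := fun t => by
          simp only [hd, smul_eq_mul]; ring
        simp_rw [this]
        rw [integral_sub ((h.memLp i).integrableOn_mul_continuous hχη)
          ((h'.memLp i).integrableOn_mul_continuous hχη), e, sub_self]
      rw [← h0]
      refine (setIntegral_eq_integral_of_forall_compl_eq_zero fun t ht => ?_).symm
      rw [image_eq_zero_of_notMem_tsupport fun h => ht (Ioo_subset_Icc_self (hηs h)), zero_smul]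
  filter_upwards [ae_mem_Ioo, ae_restrict_of_ae key] with t ht h1
  exact sub_eq_zero.1 ((mul_eq_zero.1 (h1 ht)).resolve_right (hχ1 t ht))

theorem IsNormalTrace.isNormalTrace_normalTrace (h : K.IsNormalTrace v g) :
    K.IsNormalTrace v (K.normalTrace v) := by
  have H : ∃ g, K.IsNormalTrace v g := ⟨g, h⟩
  rw [normalTrace, dif_pos H]; exact H.choose_spec

theorem IsNormalTrace.normalTrace_ae_eq (h : K.IsNormalTrace v g) (i : K.Idx) :
    (fun t => K.normalTrace v (K.edgePoint i t)) =ᵐ[volume.restrict (Icc (0 : ℝ) 1)]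
      fun t => g (K.edgePoint i t) :=
  h.isNormalTrace_normalTrace.ae_eq h i

theorem integrableOn_normalTrace_integrand {φ : Plane → ℝ} (hφ : ContDiff ℝ ∞ φ)
    (hv : MemH2 K.carrier v) :
    IntegrableOn (fun x => weakLaplacian K.carrier v x * φ x +
      ∑ j, weakDeriv K.carrier j v x * partialDeriv j φ x) K.carrier := by
  have hb := K.isBounded_carrier
  refine Integrable.add (hv.memL2_weakLaplacian.integrable_mul
    (Continuous.memLp_restrict hφ.continuous hb 2)) (integrable_finsetSum _ fun j _ => ?_)
  exact (hv.1.2 j).memL2_weakDeriv.integrable_mul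
    (Continuous.memLp_restrict (contDiff_partialDeriv hφ j).continuous hb 2)

theorem IsNormalTrace.smul_add (c : ℝ) (hv : MemH2 K.carrier v) (hv' : MemH2 K.carrier v')
    (h : K.IsNormalTrace v g) (h' : K.IsNormalTrace v' g') :
    K.IsNormalTrace (c • v + v') (c • g + g') := by
  refine ⟨fun i => ((h.memLp i).const_mul c).add (h'.memLp i), fun φ hφ => ?_⟩
  have hU := K.isOpen_carrier
  have hφc : ∀ i, Continuous fun t => φ (K.edgePoint i t) := fun i =>
    hφ.continuous.comp (K.continuous_edgePoint i)
  have e : ∫ x in K.carrier, (weakLaplacian K.carrier (c • v + v') x * φ x +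
        ∑ j, weakDeriv K.carrier j (c • v + v') x * partialDeriv j φ x) =
      ∫ x in K.carrier, (c * (weakLaplacian K.carrier v x * φ x +
        ∑ j, weakDeriv K.carrier j v x * partialDeriv j φ x) +
        (weakLaplacian K.carrier v' x * φ x +
        ∑ j, weakDeriv K.carrier j v' x * partialDeriv j φ x)) := by
    refine integral_congr_ae ?_
    filter_upwards [weakLaplacian_smul_add hU c hv hv',
      weakDeriv_smul_add hU c hv.1.1 hv'.1.1 (hv.1.2 0) (hv'.1.2 0),
      weakDeriv_smul_add hU c hv.1.1 hv'.1.1 (hv.1.2 1) (hv'.1.2 1)] with x h1 h2 h3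
    simp only [Fin.sum_univ_two, h1, h2, h3, Pi.add_apply, Pi.smul_apply, smul_eq_mul]
    ring
  rw [e, integral_add ((integrableOn_normalTrace_integrand hφ hv).const_mul c)
    (integrableOn_normalTrace_integrand hφ hv'), integral_const_mul, h.2 φ hφ, h'.2 φ hφ,
    Finset.mul_sum, ← Finset.sum_add_distrib]
  refine Finset.sum_congr rfl fun i _ => ?_
  rw [← edgeIntegral_smul_add _ _ _ ((h.memLp i).integrableOn_mul_continuous (hφc i))
    ((h'.memLp i).integrableOn_mul_continuous (hφc i))]
  congr 1
  ext t
  simp only [Pi.add_apply, Pi.smul_apply, smul_eq_mul]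
  ring

/-- A smooth function has a normal derivative on the boundary. -/
theorem exists_isNormalTrace_of_contDiff {q : Plane → ℝ} (hq : ContDiff ℝ ∞ q) :
    ∃ g, K.IsNormalTrace q g := by
  -- A trace is a single function on the plane, although the normal changes from edge to edge. Open
  -- edges are disjoint, so at most one summand is nonzero; the vertices are negligible.
  set g : Plane → ℝ := fun x => ∑ l, (K.openEdge l).indicator
    (fun x => ∑ j, partialDeriv j q x * K.normal l j) x with hg
  have hge : ∀ i, ∀ t ∈ Ioo (0 : ℝ) 1, g (K.edgePoint i t) =
      ∑ j, partialDeriv j q (K.edgePoint i t) * K.normal i j := by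
    intro i t ht
    have hm := K.edgePoint_mem_openEdge i ht
    simp only [hg]
    rw [Finset.sum_eq_single i, indicator_of_mem hm]
    · intro l _ hl
      refine indicator_of_notMem (fun hl' => ?_) _
      exact disjoint_left.1 (K.simple i l hl.symm) hm (openSegment_subset_segment _ _ _ hl')
    · simp
  have hae : ∀ i, (fun t => g (K.edgePoint i t)) =ᵐ[volume.restrict (Icc (0 : ℝ) 1)]
      fun t => ∑ j, partialDeriv j q (K.edgePoint i t) * K.normal i j := fun i => by
    filter_upwards [ae_mem_Ioo] with t ht using hge i t ht
  have hpc : ∀ i j, Continuous fun t => partialDeriv j q (K.edgePoint i t) := fun i j =>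
    (contDiff_partialDeriv hq j).continuous.comp (K.continuous_edgePoint i)
  refine ⟨g, fun i => ?_, fun φ hφ => ?_⟩
  · refine MemLp.ae_eq (hae i).symm (Continuous.memLp_Icc ?_ 2 0 1)
    exact continuous_finsetSum _ fun j _ => (hpc i j).mul continuous_const
  have hφc : ∀ i, Continuous fun t => φ (K.edgePoint i t) := fun i =>
    hφ.continuous.comp (K.continuous_edgePoint i)
  have hb := K.isBounded_carrier
  have hF : ∀ j, ContDiff ℝ ∞ fun x => partialDeriv j q x * φ x := fun j =>
    (contDiff_partialDeriv hq j).mul hφ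
  have e : ∫ x in K.carrier, (weakLaplacian K.carrier q x * φ x +
        ∑ j, weakDeriv K.carrier j q x * partialDeriv j φ x) =
      ∫ x in K.carrier, ∑ j, partialDeriv j (fun x => partialDeriv j q x * φ x) x := by
    refine integral_congr_ae ?_
    filter_upwards [weakLaplacian_of_contDiff K.isOpen_carrier hb hq,
      weakDeriv_of_contDiff K.isOpen_carrier hb hq 0,
      weakDeriv_of_contDiff K.isOpen_carrier hb hq 1] with x h1 h2 h3
    have hd : ∀ j, partialDeriv j (fun x => partialDeriv j q x * φ x) x =
        partialDeriv j (partialDeriv j q) x * φ x + partialDeriv j q x * partialDeriv j φ x := by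
      intro j
      have := fderiv_fun_mul
        ((contDiff_partialDeriv hq j).differentiable (by simp)).differentiableAt
        (hφ.differentiable (by simp)).differentiableAt (x := x)
      rw [partialDeriv, this]
      simp only [add_apply, smul_apply, smul_eq_mul, partialDeriv]
      ring
    simp only [Fin.sum_univ_two, h1, h2, h3, hd]
    ring
  rw [e, integral_finsetSum _ fun j _ => memLp_one_iff_integrable.1
    (Continuous.memLp_restrict (contDiff_partialDeriv (hF j) j).continuous hb 1)]
  simp_rw [K.integral_partialDeriv (hF _)]
  rw [Finset.sum_comm]
  refine Finset.sum_congr rfl fun i _ => ?_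
  have e2 : K.edgeIntegral i (fun t => g (K.edgePoint i t) * φ (K.edgePoint i t)) =
      K.edgeIntegral i (fun t => K.normal i 0 * (partialDeriv 0 q (K.edgePoint i t) *
        φ (K.edgePoint i t)) + K.normal i 1 * (partialDeriv 1 q (K.edgePoint i t) *
        φ (K.edgePoint i t))) := by
    refine K.edgeIntegral_congr_ae i ?_
    filter_upwards [hae i] with t ht
    rw [ht, Fin.sum_univ_two]; ring
  have hI : ∀ j, IntegrableOn (fun t => partialDeriv j q (K.edgePoint i t) *
      φ (K.edgePoint i t)) (Icc 0 1) := fun j =>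
    ((hpc i j).mul (hφc i)).integrableOn_Icc
  rw [e2, edgeIntegral_smul_add _ _ _ (hI 0) ((hI 1).const_mul _), Fin.sum_univ_two]
  simp only [edgeIntegral, intervalIntegral.integral_const_mul]
  ring

variable (K) in
/-- The functions of `H²(K)` to which the degrees of freedom apply. -/
def HasTraces (v : Plane → ℝ) : Prop :=
  MemH2 K.carrier v ∧ ContinuousOn v (closure K.carrier) ∧ ∃ g, K.IsNormalTrace v g

theorem hasTraces_of_contDiff {q : Plane → ℝ} (hq : ContDiff ℝ ∞ q) : K.HasTraces q :=
  ⟨memH2_of_contDiff K.isOpen_carrier K.isBounded_carrier hq, hq.continuous.continuousOn,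
    exists_isNormalTrace_of_contDiff hq⟩

theorem MemEnlarged.hasTraces {ℓ : ℕ} (h : K.MemEnlarged ℓ v) : K.HasTraces v :=
  ⟨h.1, h.2.1, h.2.2.1⟩

theorem HasTraces.isNormalTrace (h : K.HasTraces v) : K.IsNormalTrace v (K.normalTrace v) :=
  h.2.2.elim fun _ hg => hg.isNormalTrace_normalTrace

theorem HasTraces.smul_add (c : ℝ) (h : K.HasTraces v) (h' : K.HasTraces v') :
    K.HasTraces (c • v + v') :=
  ⟨h.1.smul_add K.isOpen_carrier c h'.1, (h.2.1.const_smul c).add h'.2.1,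
    ⟨_, h.isNormalTrace.smul_add c h.1 h'.1 h'.isNormalTrace⟩⟩

theorem HasTraces.normalTrace_smul_add (c : ℝ) (h : K.HasTraces v) (h' : K.HasTraces v')
    (i : K.Idx) : (fun t => K.normalTrace (c • v + v') (K.edgePoint i t))
      =ᵐ[volume.restrict (Icc (0 : ℝ) 1)]
      fun t => c * K.normalTrace v (K.edgePoint i t) + K.normalTrace v' (K.edgePoint i t) :=
  (h.isNormalTrace.smul_add c h.1 h'.1 h'.isNormalTrace).normalTrace_ae_eq i

theorem HasTraces.memLp_edge (h : K.HasTraces v) (i : K.Idx) :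
    MemLp (fun t => v (K.edgePoint i t)) 2 (volume.restrict (Icc (0 : ℝ) 1)) := by
  have hc : ContinuousOn (fun t => v (K.edgePoint i t)) (Icc 0 1) :=
    h.2.1.comp (K.continuous_edgePoint i).continuousOn fun t ht =>
      frontier_subset_closure (K.edge_subset_frontier i (K.edgePoint_mem_edge i ht))
  obtain ⟨C, hC⟩ := isCompact_Icc.exists_bound_of_continuousOn hc
  refine MemLp.of_bound (hc.aestronglyMeasurable measurableSet_Icc) C ?_
  filter_upwards [ae_restrict_mem measurableSet_Icc] with x hx using hC x hx

/-- Two parametrisations of a common edge differ by a measure preserving map. -/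
theorem exists_measurePreserving_edgePoint {K K' : Polygon} {i : K.Idx} {j : K'.Idx}
    (h : K.edge i = K'.edge j) :
    ∃ θ : ℝ → ℝ, MeasurePreserving θ (volume.restrict (Icc (0 : ℝ) 1))
      (volume.restrict (Icc (0 : ℝ) 1)) ∧ ∀ t, K.edgePoint i t = K'.edgePoint j (θ t) := by
  have z01 : (0 : ℝ) ∈ Icc (0 : ℝ) 1 := ⟨le_rfl, zero_le_one⟩
  have o01 : (1 : ℝ) ∈ Icc (0 : ℝ) 1 := ⟨zero_le_one, le_rfl⟩
  have hp : ∀ {t}, t ∈ Icc (0 : ℝ) 1 → ∃ s ∈ Icc (0 : ℝ) 1, K'.edgePoint j s = K.edgePoint i t :=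
    fun ht => K'.exists_edgePoint_of_mem_edge (h ▸ K.edgePoint_mem_edge i ht)
  obtain ⟨t0, ht0, e0⟩ := hp z01
  obtain ⟨t1, ht1, e1⟩ := hp o01
  have hθ : ∀ t, K.edgePoint i t = K'.edgePoint j (t0 + t * (t1 - t0)) := by
    intro t
    ext l
    have a0 := congrArg (fun x : Plane => x l) e0
    have a1 := congrArg (fun x : Plane => x l) e1
    simp only [edgePoint_apply] at a0 a1 ⊢
    linear_combination (t - 1) * a0 - t * a1
  obtain ⟨τ, -, hτ⟩ := exists_contDiff_param (K := K') j
  have hq : ∀ {s}, s ∈ Icc (0 : ℝ) 1 → ∃ t ∈ Icc (0 : ℝ) 1, t0 + t * (t1 - t0) = s := by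
    intro s hs
    obtain ⟨t, ht, e⟩ := K.exists_edgePoint_of_mem_edge
      (i := i) (h ▸ K'.edgePoint_mem_edge j hs : K'.edgePoint j s ∈ K.edge i)
    refine ⟨t, ht, ?_⟩
    rw [hθ] at e
    have := congrArg τ e
    rwa [hτ, hτ] at this
  obtain ⟨s0, hs0, f0⟩ := hq z01
  obtain ⟨s1, hs1, f1⟩ := hq o01
  -- The affine change of parameter maps [0, 1] onto itself. Writing 0 and 1 as convex combinations
  -- of t0 and t1 leaves only the identity and the reversal.
  have hcase : (t0 = 0 ∧ t1 = 1) ∨ (t0 = 1 ∧ t1 = 0) := by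
    have g0 : (1 - s0) * t0 = 0 ∧ s0 * t1 = 0 := by
      have := mul_nonneg (sub_nonneg.2 hs0.2) ht0.1
      have := mul_nonneg hs0.1 ht1.1
      constructor <;> linarith
    have g1 : (1 - s1) * (1 - t0) = 0 ∧ s1 * (1 - t1) = 0 := by
      have := mul_nonneg (sub_nonneg.2 hs1.2) (sub_nonneg.2 ht0.2)
      have := mul_nonneg hs1.1 (sub_nonneg.2 ht1.2)
      constructor <;> linarith
    rcases mul_eq_zero.1 g0.1 with a | a
    · have hs : s0 = 1 := by linarith
      have ht1' : t1 = 0 := by simpa [hs] using g0.2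
      refine .inr ⟨?_, ht1'⟩
      have hs1' : s1 = 0 := by simpa [ht1'] using g1.2
      have := g1.1
      rw [hs1'] at this
      linarith
    · refine .inl ⟨a, ?_⟩
      have hs1' : s1 = 1 := by
        have := g1.1
        rw [a] at this
        linarith
      have := g1.2
      rw [hs1'] at this
      linarith
  rcases hcase with ⟨rfl, rfl⟩ | ⟨rfl, rfl⟩
  · exact ⟨id, MeasurePreserving.id _, fun t => by rw [hθ]; simp⟩
  · refine ⟨fun t => 1 - t, ?_, fun t => by rw [hθ]; ring_nf⟩
    have := (Measure.measurePreserving_sub_left (volume : Measure ℝ) 1).restrict_preimage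
      (measurableSet_Icc (a := (0 : ℝ)) (b := 1))
    simpa using this

end Polygon

/-! ### Polynomials as functions on the plane -/

section PolyFun

variable (p q : MvPolynomial (Fin 2) ℝ)

@[simp] theorem polyFun_add (x : Plane) : polyFun (p + q) x = polyFun p x + polyFun q x := by
  simp [polyFun]

@[simp] theorem polyFun_mul (x : Plane) : polyFun (p * q) x = polyFun p x * polyFun q x := by
  simp [polyFun]

@[simp] theorem polyFun_smul (c : ℝ) (x : Plane) : polyFun (c • p) x = c * polyFun p x := by
  simp [polyFun, MvPolynomial.smul_eval]

@[simp] theorem polyFun_zero (x : Plane) : polyFun 0 x = 0 := by simp [polyFun]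

@[simp] theorem polyFun_C (c : ℝ) (x : Plane) : polyFun (MvPolynomial.C c) x = c := by
  simp [polyFun]

theorem polyFun_sum {ι : Type*} (s : Finset ι) (r : ι → MvPolynomial (Fin 2) ℝ) (x : Plane) :
    polyFun (∑ i ∈ s, r i) x = ∑ i ∈ s, polyFun (r i) x := by
  simp [polyFun]

theorem polyFun_smul_add (c : ℝ) : polyFun (c • p + q) = c • polyFun p + polyFun q := by
  ext x; simp

theorem contDiff_polyFun : ContDiff ℝ ∞ (polyFun p) := by
  induction p using MvPolynomial.induction_on with
  | C a =>
    have : polyFun (MvPolynomial.C a) = fun _ => a := by ext; simp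
    rw [this]; exact contDiff_const
  | add p q hp hq =>
    have : polyFun (p + q) = fun x => polyFun p x + polyFun q x := by ext; simp
    rw [this]; exact hp.add hq
  | mul_X p i hp =>
    have : polyFun (p * MvPolynomial.X i) = fun x : Plane => polyFun p x * x i := by
      ext; simp [polyFun]
    rw [this]; exact hp.mul (by fun_prop)

theorem continuous_polyFun : Continuous (polyFun p) := (contDiff_polyFun p).continuous

theorem partialDeriv_polyFun (j : Fin 2) :
    partialDeriv j (polyFun p) = polyFun (MvPolynomial.pderiv j p) := by
  induction p using MvPolynomial.induction_on with
  | C a =>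
    have : polyFun (MvPolynomial.C a) = fun _ => a := by ext; simp
    ext x
    simp [partialDeriv, this]
  | add p q hp hq =>
    ext x
    have e : polyFun (p + q) = fun x => polyFun p x + polyFun q x := by ext; simp
    rw [map_add, polyFun_add, ← hp, ← hq, partialDeriv, e,
      fderiv_fun_add ((contDiff_polyFun p).differentiable (by simp)).differentiableAt
        ((contDiff_polyFun q).differentiable (by simp)).differentiableAt]
    rfl
  | mul_X p i hp =>
    ext x
    have e : polyFun (p * MvPolynomial.X i) = fun x : Plane => polyFun p x * x i := by
      ext; simp [polyFun]
    have hd : HasFDerivAt (fun x : Plane => x i)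
        (EuclideanSpace.proj i : Plane →L[ℝ] ℝ) x :=
      (EuclideanSpace.proj i : Plane →L[ℝ] ℝ).hasFDerivAt
    have h1 : polyFun (MvPolynomial.X i) x = x i := by simp [polyFun]
    rw [Derivation.leibniz, MvPolynomial.pderiv_X, partialDeriv, e,
      fderiv_fun_mul ((contDiff_polyFun p).differentiable (by simp)).differentiableAt
        hd.differentiableAt, hd.fderiv, smul_eq_mul, smul_eq_mul, polyFun_add, polyFun_mul,
      polyFun_mul, h1, ← hp]
    simp only [add_apply, smul_apply, smul_eq_mul, partialDeriv]
    by_cases hij : i = j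
    · subst hij; simp [polyFun]
    · simp [polyFun, hij]

theorem integrableOn_polyFun {U : Set Plane} (hU : Bornology.IsBounded U) :
    IntegrableOn (polyFun p) U :=
  memLp_one_iff_integrable.1 (Continuous.memLp_restrict (continuous_polyFun p) hU 1)

variable {p}

/-- A polynomial that vanishes on a nonempty open set is zero. -/
theorem eq_zero_of_polyFun_eq_zero {U : Set Plane} (hU : IsOpen U) (hne : U.Nonempty)
    (h : ∀ x ∈ U, polyFun p x = 0) : p = 0 := by
  obtain ⟨x₀, hx₀⟩ := hne
  have ho : IsOpen ((WithLp.toLp 2 : (Fin 2 → ℝ) → Plane) ⁻¹' U) :=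
    hU.preimage (PiLp.continuous_toLp 2 _)
  obtain ⟨r, hr, hball⟩ := Metric.isOpen_iff.1 ho (fun i => x₀ i) hx₀
  refine MvPolynomial.funext_set (fun i => Metric.ball (x₀ i) r) (fun i => ?_) fun x hx => ?_
  · rw [Real.ball_eq_Ioo]; exact Ioo_infinite (by linarith)
  · have hx' : x ∈ Metric.ball (fun i => x₀ i) r := by
      rw [ball_pi _ hr]; exact hx
    have := h _ (hball hx')
    simpa [polyFun] using this

theorem eq_zero_of_polyFun_ae_eq_zero {U : Set Plane} (hU : IsOpen U) (hne : U.Nonempty)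
    (h : polyFun p =ᵐ[volume.restrict U] 0) : p = 0 :=
  eq_zero_of_polyFun_eq_zero hU hne (Measure.eqOn_open_of_ae_eq h hU
    (continuous_polyFun p).continuousOn continuousOn_const)

instance finiteDimensional_poly (k : ℤ) : FiniteDimensional ℝ (Poly k) := by
  have hfin : {s : Fin 2 →₀ ℕ | (s.degree : ℤ) ≤ k}.Finite :=
    (Finsupp.finite_of_degree_le k.toNat).subset fun s hs => by
      simp only [mem_ofPred_eq] at hs ⊢; omega
  have := hfin.to_subtype
  exact Module.Basis.finiteDimensional_of_finite
    (MvPolynomial.basisRestrictSupport ℝ {s : Fin 2 →₀ ℕ | (s.degree : ℤ) ≤ k})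

theorem pderiv_mem_poly {k : ℤ} (hp : p ∈ Poly k) (j : Fin 2) :
    MvPolynomial.pderiv j p ∈ Poly (k - 1) := by
  rw [Poly, MvPolynomial.restrictSupport_eq_span] at hp
  induction hp using Submodule.span_induction with
  | mem x hx =>
    obtain ⟨s, hs, rfl⟩ := hx
    simp only [MvPolynomial.pderiv_monomial, Poly, MvPolynomial.monomial_mem_restrictSupport]
    by_cases h0 : s j = 0
    · right; simp [h0]
    · left
      have hle : Finsupp.single j 1 ≤ s := by
        rw [Finsupp.single_le_iff]; omega
      have := congrArg Finsupp.degree (tsub_add_cancel_of_le hle)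
      rw [map_add, Finsupp.degree_single] at this
      simp only [mem_ofPred_eq] at hs ⊢
      omega
  | zero => simp
  | add x y _ _ hx hy => rw [map_add]; exact Submodule.add_mem _ hx hy
  | smul a x _ hx => rw [Derivation.map_smul]; exact Submodule.smul_mem _ a hx

/-- A polynomial with zero gradient is constant. -/
theorem polyFun_eq_const_of_pderiv_eq_zero (h : ∀ j, MvPolynomial.pderiv j p = 0) (x : Plane) :
    polyFun p x = polyFun p 0 := by
  refine is_const_of_fderiv_eq_zero (𝕜 := ℝ) ((contDiff_polyFun p).differentiable (by simp))
    (fun y => ?_) x 0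
  refine ContinuousLinearMap.coe_injective
    ((EuclideanSpace.basisFun (Fin 2) ℝ).toBasis.ext fun j => ?_)
  have := congrFun (partialDeriv_polyFun p j) y
  rw [h, polyFun_zero] at this
  simpa [partialDeriv] using this

end PolyFun

/-! ### Variational problems in finite dimensions -/

/-- Definiteness makes v ↦ b(v, ·) injective into the dual space, which has the same dimension.
Symmetry is not required. -/
theorem existsUnique_of_definite {V : Type*} [AddCommGroup V] [Module ℝ V] [FiniteDimensional ℝ V]
    (b : V →ₗ[ℝ] V →ₗ[ℝ] ℝ) (hb : ∀ v, b v v = 0 → v = 0) (F : V →ₗ[ℝ] ℝ) :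
    ∃! v, ∀ w, b v w = F w := by
  have hinj : Function.Injective b := by
    refine (injective_iff_map_eq_zero b).2 fun v hv => hb v ?_
    rw [hv]; rfl
  have hsurj : Function.Surjective b :=
    (LinearMap.injective_iff_surjective_of_finrank_eq_finrank
      Subspace.dual_finrank_eq.symm (f := b)).1 hinj
  obtain ⟨v, hv⟩ := hsurj F
  exact ⟨v, fun w => by rw [hv], fun v' hv' => hinj (by rw [hv]; exact LinearMap.ext hv')⟩

/-! ### Moments of polynomials on a polygon and L² projections. -/

namespace Polygon

variable (K : Polygon)

/-- Integration of polynomials over the polygon. -/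
def polyIntegral : MvPolynomial (Fin 2) ℝ →ₗ[ℝ] ℝ where
  toFun p := ∫ x in K.carrier, polyFun p x
  map_add' p q := by
    simp_rw [polyFun_add]
    exact integral_add (integrableOn_polyFun p K.isBounded_carrier)
      (integrableOn_polyFun q K.isBounded_carrier)
  map_smul' c p := by
    simp_rw [polyFun_smul]
    rw [integral_const_mul]; rfl

theorem polyIntegral_apply (p : MvPolynomial (Fin 2) ℝ) :
    K.polyIntegral p = ∫ x in K.carrier, polyFun p x := rfl

/-- The integral over edge `i` of the product of a polynomial on this edge and a bivariate
polynomial. -/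
def edgeMoment (i : K.Idx) : Polynomial ℝ →ₗ[ℝ] MvPolynomial (Fin 2) ℝ →ₗ[ℝ] ℝ := by
  have hI : ∀ (s : Polynomial ℝ) (p : MvPolynomial (Fin 2) ℝ),
      IntegrableOn (fun t => s.eval t * polyFun p (K.edgePoint i t)) (Icc (0 : ℝ) 1) := fun s p =>
    (s.continuous.mul ((continuous_polyFun p).comp
      (K.continuous_edgePoint i))).integrableOn_Icc
  refine LinearMap.mk₂ ℝ
    (fun s p => K.edgeIntegral i (fun t => s.eval t * polyFun p (K.edgePoint i t))) ?_ ?_ ?_ ?_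
  · intro s s' p
    have := K.edgeIntegral_smul_add i 1 (hI s p) (hI s' p)
    rw [one_mul] at this
    rw [← this]
    congr 1; ext t; simp only [Polynomial.eval_add]; ring
  · intro c s p
    simp only [edgeIntegral, Polynomial.eval_smul, smul_eq_mul, mul_assoc,
      intervalIntegral.integral_const_mul]
    ring
  · intro s p p'
    have := K.edgeIntegral_smul_add i 1 (hI s p) (hI s p')
    rw [one_mul] at this
    rw [← this]
    congr 1; ext t; simp only [polyFun_add]; ring
  · intro c s p
    simp only [edgeIntegral, polyFun_smul, smul_eq_mul, mul_left_comm _ c,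
      intervalIntegral.integral_const_mul]

theorem edgeMoment_apply (i : K.Idx) (s : Polynomial ℝ) (p : MvPolynomial (Fin 2) ℝ) :
    K.edgeMoment i s p =
      K.edgeIntegral i (fun t => s.eval t * polyFun p (K.edgePoint i t)) := rfl

/-- The divergence theorem for polynomials. -/
theorem polyIntegral_pderiv (p : MvPolynomial (Fin 2) ℝ) (j : Fin 2) :
    K.polyIntegral (MvPolynomial.pderiv j p) =
      ∑ i, K.edgeIntegral i (fun t => polyFun p (K.edgePoint i t)) * K.normal i j := by
  rw [polyIntegral_apply, ← partialDeriv_polyFun, K.integral_partialDeriv (contDiff_polyFun p)]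

variable {ι : Type*} [Fintype ι]

theorem eq_zero_of_polyIntegral_eq_zero {D : ι → MvPolynomial (Fin 2) ℝ}
    (h : K.polyIntegral (∑ i, D i * D i) = 0) (i : ι) : D i = 0 := by
  rw [polyIntegral_apply] at h
  have h1 := (integral_eq_zero_iff_of_nonneg (fun x => by
    simp only [Pi.zero_apply, polyFun_sum, polyFun_mul]
    exact Finset.sum_nonneg fun i _ => mul_self_nonneg _)
    (integrableOn_polyFun _ K.isBounded_carrier)).1 h
  refine eq_zero_of_polyFun_ae_eq_zero K.isOpen_carrier K.isConnected_carrier.nonempty ?_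
  filter_upwards [h1] with x hx
  simp only [Pi.zero_apply, polyFun_sum, polyFun_mul] at hx
  have := (Finset.sum_eq_zero_iff_of_nonneg fun i _ => mul_self_nonneg _).1 hx i
    (Finset.mem_univ i)
  simpa using this

/-- The `L²`-projection onto polynomials. -/
theorem exists_polyIntegral_eq (k : ℤ) (F : (ι → MvPolynomial (Fin 2) ℝ) →ₗ[ℝ] ℝ) :
    ∃ G : ι → MvPolynomial (Fin 2) ℝ, (∀ i, G i ∈ Poly k) ∧
      ∀ p, (∀ i, p i ∈ Poly k) → K.polyIntegral (∑ i, G i * p i) = F p := by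
  let inc : (ι → Poly k) →ₗ[ℝ] (ι → MvPolynomial (Fin 2) ℝ) :=
    LinearMap.pi fun i => (Poly k).subtype ∘ₗ LinearMap.proj i
  have hinc : ∀ g i, inc g i = g i := fun _ _ => rfl
  let b : (ι → Poly k) →ₗ[ℝ] (ι → Poly k) →ₗ[ℝ] ℝ := LinearMap.mk₂ ℝ
    (fun g p => K.polyIntegral (∑ i, inc g i * inc p i))
    (fun g g' p => by
      rw [← map_add, ← Finset.sum_add_distrib]; simp only [map_add, Pi.add_apply, add_mul])
    (fun c g p => by
      rw [← map_smul, Finset.smul_sum]; simp only [map_smul, Pi.smul_apply, smul_mul_assoc])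
    (fun g p p' => by
      rw [← map_add, ← Finset.sum_add_distrib]; simp only [map_add, Pi.add_apply, mul_add])
    (fun c g p => by
      rw [← map_smul, Finset.smul_sum]; simp only [map_smul, Pi.smul_apply, mul_smul_comm])
  have hb : ∀ g, b g g = 0 → g = 0 := fun g hg => by
    ext1 i
    exact Subtype.ext (K.eq_zero_of_polyIntegral_eq_zero (D := inc g) hg i)
  obtain ⟨g, hg, -⟩ := existsUnique_of_definite b hb (F ∘ₗ inc)
  refine ⟨inc g, fun i => (g i).2, fun p hp => ?_⟩
  exact hg fun i => ⟨p i, hp i⟩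

theorem eq_of_polyIntegral_eq {k : ℤ} {G G' : ι → MvPolynomial (Fin 2) ℝ}
    {F : (ι → MvPolynomial (Fin 2) ℝ) → ℝ}
    (hG : ∀ i, G i ∈ Poly k) (hG' : ∀ i, G' i ∈ Poly k)
    (h : ∀ p, (∀ i, p i ∈ Poly k) → K.polyIntegral (∑ i, G i * p i) = F p)
    (h' : ∀ p, (∀ i, p i ∈ Poly k) → K.polyIntegral (∑ i, G' i * p i) = F p) : G = G' := by
  ext1 i
  refine sub_eq_zero.1 (K.eq_zero_of_polyIntegral_eq_zero (D := fun i => G i - G' i) ?_ i)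
  have hm : ∀ i, G i - G' i ∈ Poly k := fun i => Submodule.sub_mem _ (hG i) (hG' i)
  have e : ∑ i, (G i - G' i) * (G i - G' i) =
      ∑ i, G i * (G i - G' i) - ∑ i, G' i * (G i - G' i) := by
    rw [← Finset.sum_sub_distrib]
    exact Finset.sum_congr rfl fun i _ => by ring
  rw [e, map_sub, h _ hm, h' _ hm, sub_self]

end Polygon

namespace Polygon

variable {K : Polygon} {ℓ : ℕ} {u v : Plane → ℝ}

/-! ### Linearity of the degrees of freedom and of the projections -/

theorem dof_smul_add (B : K.DofBasis ℓ) (c : ℝ) (hu : K.HasTraces u) (hv : K.HasTraces v) :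
    dof B (c • u + v) = c • dof B u + dof B v := by
  ext s
  rcases s with i | ⟨i, r⟩ | ⟨i, r⟩ | r
  · rfl
  · simp only [dof, Pi.add_apply, Pi.smul_apply, smul_eq_mul]
    have := K.edgeIntegral_smul_add i c
      ((hu.memLp_edge i).integrableOn_mul_continuous (B.edge i r : Polynomial ℝ).continuous)
      ((hv.memLp_edge i).integrableOn_mul_continuous (B.edge i r : Polynomial ℝ).continuous)
    rw [mul_left_comm, ← mul_add, ← this]
    congr 2; ext t; ring
  · simp only [dof, Pi.add_apply, Pi.smul_apply, smul_eq_mul]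
    rw [← K.edgeIntegral_smul_add i c
      ((hu.isNormalTrace.memLp i).integrableOn_mul_continuous
        (B.normal i r : Polynomial ℝ).continuous)
      ((hv.isNormalTrace.memLp i).integrableOn_mul_continuous
        (B.normal i r : Polynomial ℝ).continuous)]
    refine K.edgeIntegral_congr_ae i ?_
    filter_upwards [hu.normalTrace_smul_add c hv i] with t ht
    rw [ht]; ring
  · simp only [dof, Pi.add_apply, Pi.smul_apply, smul_eq_mul]
    have hp : MemL2 K.carrier (polyFun (B.interior r)) :=
      Continuous.memLp_restrict (continuous_polyFun _) K.isBounded_carrier 2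
    have e : ∫ x in K.carrier, (c * u x + v x) * polyFun (B.interior r) x =
        c * (∫ x in K.carrier, u x * polyFun (B.interior r) x) +
          ∫ x in K.carrier, v x * polyFun (B.interior r) x := by
      rw [← integral_const_mul, ← integral_add ((hu.1.1.1.integrable_mul hp).const_mul c)
        (hv.1.1.1.integrable_mul hp)]
      congr 1; ext x; ring
    rw [e]; ring

theorem hasTraces_polyFun (q : MvPolynomial (Fin 2) ℝ) : K.HasTraces (polyFun q) :=
  hasTraces_of_contDiff (contDiff_polyFun q)

variable (K) in
/-- The right-hand side of the variational identity of the gradient projection. -/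
def gradFunctional (r : MvPolynomial (Fin 2) ℝ) (s : K.Idx → Polynomial ℝ) :
    (Fin 2 → MvPolynomial (Fin 2) ℝ) →ₗ[ℝ] ℝ :=
  -(K.polyIntegral ∘ₗ LinearMap.mulLeft ℝ r ∘ₗ
      ∑ j, (MvPolynomial.pderiv j).toLinearMap ∘ₗ LinearMap.proj j) +
    ∑ i, K.edgeMoment i (s i) ∘ₗ ∑ j, K.normal i j • LinearMap.proj j

theorem gradFunctional_apply (r : MvPolynomial (Fin 2) ℝ) (s : K.Idx → Polynomial ℝ)
    (p : Fin 2 → MvPolynomial (Fin 2) ℝ) :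
    K.gradFunctional r s p = -K.polyIntegral (r * ∑ j, MvPolynomial.pderiv j (p j)) +
      ∑ i, K.edgeMoment i (s i) (∑ j, K.normal i j • p j) := by
  simp [gradFunctional]

theorem gradFunctional_smul_add (c : ℝ) (r r' : MvPolynomial (Fin 2) ℝ)
    (s s' : K.Idx → Polynomial ℝ) (p : Fin 2 → MvPolynomial (Fin 2) ℝ) :
    K.gradFunctional (c • r + r') (c • s + s') p =
      c * K.gradFunctional r s p + K.gradFunctional r' s' p := by
  rw [gradFunctional_apply, gradFunctional_apply, gradFunctional_apply]
  generalize ∑ j, MvPolynomial.pderiv j (p j) = d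
  rw [add_mul, smul_mul_assoc, map_add, map_smul, smul_eq_mul, mul_add, Finset.mul_sum, neg_add,
    add_add_add_comm, ← Finset.sum_add_distrib, mul_neg]
  congr 1
  refine Finset.sum_congr rfl fun i _ => ?_
  rw [Pi.add_apply, Pi.smul_apply, LinearMap.map_add₂, LinearMap.map_smul₂, smul_eq_mul]

variable (K) in
/-- The right-hand side of the variational identity of the Hessian projection. -/
def hessFunctional (G : Fin 2 → MvPolynomial (Fin 2) ℝ) (m s : K.Idx → Polynomial ℝ) :
    (Fin 2 × Fin 2 → MvPolynomial (Fin 2) ℝ) →ₗ[ℝ] ℝ :=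
  -(K.polyIntegral ∘ₗ ∑ a, LinearMap.mulLeft ℝ (G a) ∘ₗ
      ∑ b, (MvPolynomial.pderiv b).toLinearMap ∘ₗ LinearMap.proj (a, b)) +
    ∑ i, (K.edgeMoment i (m i) ∘ₗ
        (∑ a, ∑ b, (K.normal i a * K.normal i b) • LinearMap.proj (a, b)) +
      (K.edgeLength i)⁻¹ • K.edgeMoment i (s i).derivative ∘ₗ
        ∑ a, ∑ b, (K.tangent i a * K.normal i b) • LinearMap.proj (a, b))

theorem hessFunctional_apply (G : Fin 2 → MvPolynomial (Fin 2) ℝ) (m s : K.Idx → Polynomial ℝ)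
    (p : Fin 2 × Fin 2 → MvPolynomial (Fin 2) ℝ) :
    K.hessFunctional G m s p =
      -K.polyIntegral (∑ a, G a * ∑ b, MvPolynomial.pderiv b (p (a, b))) +
      ∑ i, (K.edgeMoment i (m i) (∑ a, ∑ b, (K.normal i a * K.normal i b) • p (a, b)) +
        (K.edgeLength i)⁻¹ * K.edgeMoment i (s i).derivative
          (∑ a, ∑ b, (K.tangent i a * K.normal i b) • p (a, b))) := by
  simp [hessFunctional]

theorem hessFunctional_smul_add (c : ℝ) (G G' : Fin 2 → MvPolynomial (Fin 2) ℝ)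
    (m m' s s' : K.Idx → Polynomial ℝ) (p : Fin 2 × Fin 2 → MvPolynomial (Fin 2) ℝ) :
    K.hessFunctional (c • G + G') (c • m + m') (c • s + s') p =
      c * K.hessFunctional G m s p + K.hessFunctional G' m' s' p := by
  have e : ∑ a, (c • G + G') a * ∑ b, MvPolynomial.pderiv b (p (a, b)) =
      c • (∑ a, G a * ∑ b, MvPolynomial.pderiv b (p (a, b))) +
        ∑ a, G' a * ∑ b, MvPolynomial.pderiv b (p (a, b)) := by
    rw [Finset.smul_sum, ← Finset.sum_add_distrib]
    exact Finset.sum_congr rfl fun a _ => by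
      rw [Pi.add_apply, Pi.smul_apply, add_mul, smul_mul_assoc]
  rw [hessFunctional_apply, hessFunctional_apply, hessFunctional_apply, e, map_add, map_smul,
    smul_eq_mul, mul_add, Finset.mul_sum, neg_add, add_add_add_comm, ← Finset.sum_add_distrib,
    mul_neg]
  congr 1
  refine Finset.sum_congr rfl fun i _ => ?_
  simp only [Pi.add_apply, Pi.smul_apply, Polynomial.derivative_add, Polynomial.derivative_smul,
    LinearMap.map_add₂, LinearMap.map_smul₂, smul_eq_mul]
  ring

namespace Projections

variable {B : K.DofBasis ℓ} (P : Projections B)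

theorem valueProj_smul_add (c : ℝ) (hu : K.HasTraces u) (hv : K.HasTraces v) :
    P.valueProj (c • u + v) = c • P.valueProj u + P.valueProj v := by
  simp [valueProj, dof_smul_add B c hu hv]

theorem edgeProj_smul_add (c : ℝ) (hu : K.HasTraces u) (hv : K.HasTraces v) (i : K.Idx) :
    P.edgeProj i (c • u + v) = c • P.edgeProj i u + P.edgeProj i v := by
  simp [edgeProj, dof_smul_add B c hu hv]

theorem normalProj_smul_add (c : ℝ) (hu : K.HasTraces u) (hv : K.HasTraces v) (i : K.Idx) :
    P.normalProj i (c • u + v) = c • P.normalProj i u + P.normalProj i v := by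
  simp [normalProj, dof_smul_add B c hu hv]

theorem valueProj_mem (v : Plane → ℝ) : P.valueProj v ∈ Poly ℓ := (P.value (dof B v)).2

theorem isGradProj_iff {G : Fin 2 → MvPolynomial (Fin 2) ℝ} :
    P.IsGradProj v G ↔ (∀ j, G j ∈ Poly ((ℓ : ℤ) - 1)) ∧
      ∀ p : Fin 2 → MvPolynomial (Fin 2) ℝ, (∀ j, p j ∈ Poly ((ℓ : ℤ) - 1)) →
        K.polyIntegral (∑ j, G j * p j) =
          K.gradFunctional (P.valueProj v) (fun i => P.edgeProj i v) p := by
  simp only [IsGradProj, gradFunctional_apply, polyIntegral_apply, edgeMoment_apply, polyFun_mul,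
    polyFun_sum, polyFun_smul, mul_comm (polyFun _ (K.edgePoint _ _)) (K.normal _ _)]

/-- Indexing matrix fields by pairs puts the Hessian projection into the same form as the gradient
projection, so one L² projection lemma serves both. -/
theorem isHessProj_iff {H : Fin 2 → Fin 2 → MvPolynomial (Fin 2) ℝ} :
    P.IsHessProj v H ↔ (∀ ab : Fin 2 × Fin 2, H ab.1 ab.2 ∈ Poly ((ℓ : ℤ) - 2)) ∧
      ∀ p : Fin 2 × Fin 2 → MvPolynomial (Fin 2) ℝ, (∀ ab, p ab ∈ Poly ((ℓ : ℤ) - 2)) →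
        K.polyIntegral (∑ ab : Fin 2 × Fin 2, H ab.1 ab.2 * p ab) =
          K.hessFunctional (P.gradProj v) (fun i => P.normalProj i v)
            (fun i => P.edgeProj i v) p := by
  have hI : ∀ (i : K.Idx) (s : Polynomial ℝ) (c : Fin 2 → Fin 2 → ℝ)
      (p : Fin 2 → Fin 2 → MvPolynomial (Fin 2) ℝ),
      Continuous fun t => s.eval t * ∑ a, ∑ b, c a b * polyFun (p a b) (K.edgePoint i t) := by
    intro i s c p
    refine s.continuous.mul (continuous_finsetSum _ fun a _ => continuous_finsetSum _ fun b _ => ?_)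
    exact continuous_const.mul ((continuous_polyFun _).comp (K.continuous_edgePoint i))
  have hedge : ∀ (i : K.Idx) (p : Fin 2 → Fin 2 → MvPolynomial (Fin 2) ℝ),
      K.edgeIntegral i (fun t =>
        (P.normalProj i v : Polynomial ℝ).eval t *
          (∑ a, ∑ b, K.normal i a * K.normal i b * polyFun (p a b) (K.edgePoint i t)) +
        ((K.edgeLength i)⁻¹ * (P.edgeProj i v).derivative.eval t) *
          (∑ a, ∑ b, K.tangent i a * K.normal i b * polyFun (p a b) (K.edgePoint i t))) =
      K.edgeMoment i (P.normalProj i v) (∑ a, ∑ b, (K.normal i a * K.normal i b) • p a b) +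
        (K.edgeLength i)⁻¹ * K.edgeMoment i (P.edgeProj i v).derivative
          (∑ a, ∑ b, (K.tangent i a * K.normal i b) • p a b) := by
    intro i p
    simp only [edgeMoment_apply, polyFun_sum, polyFun_smul]
    rw [add_comm (K.edgeIntegral i _), ← K.edgeIntegral_smul_add i _
      (hI i _ (fun a b => K.tangent i a * K.normal i b) p).integrableOn_Icc
      (hI i _ (fun a b => K.normal i a * K.normal i b) p).integrableOn_Icc]
    congr 1; ext t; ring
  simp only [IsHessProj, hessFunctional_apply, hedge, Fintype.sum_prod_type, polyIntegral_apply,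
    polyFun_mul, polyFun_sum]
  constructor
  · rintro ⟨h1, h2⟩
    exact ⟨fun ab => h1 ab.1 ab.2, fun p hp => h2 (fun a b => p (a, b)) fun a b => hp (a, b)⟩
  · rintro ⟨h1, h2⟩
    exact ⟨fun a b => h1 (a, b), fun p hp => h2 (fun ab => p ab.1 ab.2) fun ab => hp ab.1 ab.2⟩

theorem isGradProj_gradProj (v : Plane → ℝ) : P.IsGradProj v (P.gradProj v) := by
  obtain ⟨G, hG⟩ := K.exists_polyIntegral_eq ((ℓ : ℤ) - 1)
    (K.gradFunctional (P.valueProj v) (fun i => P.edgeProj i v))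
  exact Classical.epsilon_spec ⟨G, P.isGradProj_iff.2 hG⟩

theorem isHessProj_hessProj (v : Plane → ℝ) : P.IsHessProj v (P.hessProj v) := by
  obtain ⟨H, hH⟩ := K.exists_polyIntegral_eq ((ℓ : ℤ) - 2)
    (K.hessFunctional (P.gradProj v) (fun i => P.normalProj i v) (fun i => P.edgeProj i v))
  exact Classical.epsilon_spec (p := P.IsHessProj v)
    ⟨fun a b => H (a, b), P.isHessProj_iff.2 hH⟩

theorem IsGradProj.gradProj_eq {G : Fin 2 → MvPolynomial (Fin 2) ℝ} {P : Projections B}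
    (h : P.IsGradProj v G) : P.gradProj v = G := by
  have h1 := P.isGradProj_iff.1 (P.isGradProj_gradProj v)
  have h2 := P.isGradProj_iff.1 h
  exact K.eq_of_polyIntegral_eq h1.1 h2.1 h1.2 h2.2

theorem IsHessProj.hessProj_eq {H : Fin 2 → Fin 2 → MvPolynomial (Fin 2) ℝ} {P : Projections B}
    (h : P.IsHessProj v H) : P.hessProj v = H := by
  have h1 := P.isHessProj_iff.1 (P.isHessProj_hessProj v)
  have h2 := P.isHessProj_iff.1 h
  have := K.eq_of_polyIntegral_eq h1.1 h2.1 h1.2 h2.2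
  ext1 a; ext1 b
  exact congrFun this (a, b)

/-- The projection is a chosen solution. The linear combination solves the combined identity, whose
right-hand side is linear in the data, and the solution is unique. -/
theorem gradProj_smul_add (c : ℝ) (hu : K.HasTraces u) (hv : K.HasTraces v) :
    P.gradProj (c • u + v) = c • P.gradProj u + P.gradProj v := by
  refine IsGradProj.gradProj_eq (P.isGradProj_iff.2 ?_)
  have h1 := P.isGradProj_iff.1 (P.isGradProj_gradProj u)
  have h2 := P.isGradProj_iff.1 (P.isGradProj_gradProj v)
  refine ⟨fun j => Submodule.add_mem _ (Submodule.smul_mem _ _ (h1.1 j)) (h2.1 j), fun p hp => ?_⟩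
  have e : (fun i => P.edgeProj i (c • u + v)) =
      c • (fun i => P.edgeProj i u) + fun i => P.edgeProj i v :=
    funext fun i => P.edgeProj_smul_add c hu hv i
  rw [e, P.valueProj_smul_add c hu hv, gradFunctional_smul_add, ← h1.2 p hp, ← h2.2 p hp,
    ← smul_eq_mul, ← map_smul, ← map_add, Finset.smul_sum, ← Finset.sum_add_distrib]
  congr 1
  refine Finset.sum_congr rfl fun j _ => ?_
  rw [Pi.add_apply, Pi.smul_apply, add_mul, smul_mul_assoc]

theorem hessProj_smul_add (c : ℝ) (hu : K.HasTraces u) (hv : K.HasTraces v) :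
    P.hessProj (c • u + v) = c • P.hessProj u + P.hessProj v := by
  refine IsHessProj.hessProj_eq (P.isHessProj_iff.2 ?_)
  have h1 := P.isHessProj_iff.1 (P.isHessProj_hessProj u)
  have h2 := P.isHessProj_iff.1 (P.isHessProj_hessProj v)
  refine ⟨fun j => Submodule.add_mem _ (Submodule.smul_mem _ _ (h1.1 j)) (h2.1 j), fun p hp => ?_⟩
  have e : (fun i => P.edgeProj i (c • u + v)) =
      c • (fun i => P.edgeProj i u) + fun i => P.edgeProj i v :=
    funext fun i => P.edgeProj_smul_add c hu hv i
  have e' : (fun i => (P.normalProj i (c • u + v) : Polynomial ℝ)) =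
      c • (fun i => (P.normalProj i u : Polynomial ℝ)) + fun i => (P.normalProj i v : Polynomial ℝ) :=
    funext fun i => by rw [P.normalProj_smul_add c hu hv i]; rfl
  rw [e, e', P.gradProj_smul_add c hu hv, hessFunctional_smul_add, ← h1.2 p hp, ← h2.2 p hp,
    ← smul_eq_mul, ← map_smul, ← map_add, Finset.smul_sum, ← Finset.sum_add_distrib]
  congr 1
  refine Finset.sum_congr rfl fun j _ => ?_
  rw [Pi.add_apply, Pi.smul_apply, Pi.add_apply, Pi.smul_apply, add_mul, smul_mul_assoc]

/-- The gradient projection is exact on functions with the degrees of freedom of a polynomial. -/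
theorem gradProj_of_dof_eq {q : MvPolynomial (Fin 2) ℝ} (hq : q ∈ Poly ℓ)
    (h : dof B v = dof B (polyFun q)) :
    P.gradProj v = fun j => MvPolynomial.pderiv j q := by
  refine IsGradProj.gradProj_eq (P.isGradProj_iff.2 ⟨fun j => pderiv_mem_poly hq j, fun p _ => ?_⟩)
  -- Both boundary and volume data reduce to q itself, so the right-hand side is the divergence
  -- theorem for q p, that is ∫ ∇q · p.
  have hval : P.valueProj v = q := by rw [valueProj, h, P.value_poly q hq]
  have hedge : ∀ i, K.edgeMoment i (P.edgeProj i v) (∑ j, K.normal i j • p j) =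
      ∑ j, K.edgeIntegral i (fun t => polyFun (q * p j) (K.edgePoint i t)) * K.normal i j := by
    intro i
    rw [map_sum]
    refine Finset.sum_congr rfl fun j _ => ?_
    rw [map_smul, smul_eq_mul, mul_comm, edgeMoment_apply]
    congr 1
    simp only [edgeIntegral]
    congr 1
    refine intervalIntegral.integral_congr fun t ht => ?_
    rw [uIcc_of_le zero_le_one] at ht
    simp only [edgeProj, polyFun_mul]
    rw [h, P.edge_poly q hq i t ht]
  rw [gradFunctional_apply, hval]
  simp_rw [hedge]
  rw [Finset.sum_comm]
  simp_rw [← K.polyIntegral_pderiv]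
  rw [← map_sum, ← map_neg, ← map_add]
  congr 1
  rw [Finset.mul_sum, neg_add_eq_sub, ← Finset.sum_sub_distrib]
  refine Finset.sum_congr rfl fun j _ => ?_
  rw [Derivation.leibniz, smul_eq_mul, smul_eq_mul]
  ring

end Projections

end Polygon

/-! ### Unisolvence on one element -/

/-- A polynomial on an edge is determined by its end values and its moments. -/
theorem edgePoly_eq_zero {ℓ : ℕ} {r : Polynomial ℝ} (hr : r ∈ EdgePoly ℓ)
    (h0 : r.eval 0 = 0) (h1 : r.eval 1 = 0)
    (hm : ∀ p ∈ EdgePoly ((ℓ : ℤ) - 2), ∫ t in (0 : ℝ)..1, r.eval t * p.eval t = 0) : r = 0 := by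
  open Polynomial in
  by_contra hr0
  have hd0 : (X : ℝ[X]) ∣ r := by
    have := dvd_iff_isRoot.2 h0
    rwa [C_0, sub_zero] at this
  have hd1 : (X - C 1 : ℝ[X]) ∣ r := dvd_iff_isRoot.2 h1
  have hcop : IsCoprime (X : ℝ[X]) (X - C 1) := ⟨1, -1, by rw [C_1]; ring⟩
  -- With r = t(t - 1)s the quotient s has degree at most ℓ - 2, so it is an admissible test
  -- polynomial, and -∫ r s = ∫ t(1 - t)s² is positive unless s = 0.
  obtain ⟨s, hs⟩ := hcop.mul_dvd hd0 hd1
  have hs0 : s ≠ 0 := by rintro rfl; exact hr0 (by rw [hs, mul_zero])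
  have hdeg : r.natDegree = s.natDegree + 2 := by
    rw [hs, natDegree_mul (mul_ne_zero X_ne_zero (X_sub_C_ne_zero 1)) hs0,
      natDegree_mul X_ne_zero (X_sub_C_ne_zero 1), natDegree_X, natDegree_X_sub_C]
    ring
  have hsm : s ∈ EdgePoly ((ℓ : ℤ) - 2) := by
    rw [EdgePoly, mem_degreeLT] at hr ⊢
    rw [degree_eq_natDegree hr0, Nat.cast_lt] at hr
    rw [degree_eq_natDegree hs0, Nat.cast_lt]
    omega
  obtain ⟨c, hc, hsc⟩ : ∃ c ∈ Ioo (0 : ℝ) 1, s.eval c ≠ 0 := by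
    by_contra! h
    exact hs0 (eq_zero_of_infinite_isRoot s ((Ioo_infinite zero_lt_one).mono fun x hx => h x hx))
  have hpos : 0 < ∫ t in (0 : ℝ)..1, -(r.eval t * s.eval t) := by
    have e : ∀ t, -(r.eval t * s.eval t) = t * (1 - t) * (s.eval t) ^ 2 := fun t => by
      rw [hs]; simp only [eval_mul, eval_X, eval_sub, eval_C]; ring
    refine intervalIntegral.integral_pos zero_lt_one
      (r.continuous.mul s.continuous).neg.continuousOn (fun t ht => ?_)
      ⟨c, Ioo_subset_Icc_self hc, ?_⟩
    · rw [e]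
      exact mul_nonneg (mul_nonneg ht.1.le (by linarith [ht.2])) (sq_nonneg _)
    · rw [e]
      exact mul_pos (mul_pos hc.1 (by linarith [hc.2])) (by positivity)
  rw [intervalIntegral.integral_neg, hm s hsm, neg_zero] at hpos
  exact lt_irrefl _ hpos

namespace Polygon

variable {K : Polygon} {ℓ : ℕ} {u v w : Plane → ℝ}

theorem integral_mul_smul_add {U : Set Plane} (c : ℝ) {f f' h : Plane → ℝ} (hf : MemL2 U f)
    (hf' : MemL2 U f') (hh : MemL2 U h) :
    ∫ x in U, (c * f x + f' x) * h x = c * (∫ x in U, f x * h x) + ∫ x in U, f' x * h x := by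
  rw [← integral_const_mul, ← integral_add ((hf.integrable_mul hh).const_mul c)
    (hf'.integrable_mul hh)]
  congr 1; ext x; ring

theorem MemEnlarged.smul_add (c : ℝ) (hu : K.MemEnlarged ℓ u) (hv : K.MemEnlarged ℓ v) :
    K.MemEnlarged ℓ (c • u + v) := by
  obtain ⟨h1, h2, h3⟩ := hu.hasTraces.smul_add c hv.hasTraces
  obtain ⟨hu1, hu2, hu3, hu4, p, hp, q, hpq⟩ := hu
  obtain ⟨hv1, hv2, hv3, hv4, p', hp', q', hpq'⟩ := hv
  refine ⟨h1, h2, h3, fun i => ?_, c • p + p', Submodule.add_mem _ (Submodule.smul_mem _ _ hp) hp',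
    c • q + q', fun w g hw hw0 hg => ?_⟩
  · obtain ⟨r, hr, e⟩ := hu4 i
    obtain ⟨r', hr', e'⟩ := hv4 i
    refine ⟨c • r + r', Submodule.add_mem _ (Submodule.smul_mem _ _ hr) hr', fun t ht => ?_⟩
    rw [Pi.add_apply, Pi.smul_apply, e t ht, e' t ht, Polynomial.eval_add, Polynomial.eval_smul]
  have hpL : ∀ p, MemL2 K.carrier (polyFun p) := fun p =>
    Continuous.memLp_restrict (continuous_polyFun p) K.isBounded_carrier 2
  have e1 : ∫ x in K.carrier, weakLaplacian K.carrier (c • u + v) x * weakLaplacian K.carrier w x =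
      ∫ x in K.carrier, (c * weakLaplacian K.carrier u x + weakLaplacian K.carrier v x) *
        weakLaplacian K.carrier w x := by
    refine integral_congr_ae ?_
    filter_upwards [weakLaplacian_smul_add K.isOpen_carrier c hu1 hv1] with x hx
    rw [hx]; rfl
  simp only [polyFun_add, polyFun_smul]
  rw [e1, integral_mul_smul_add c hu1.memL2_weakLaplacian hv1.memL2_weakLaplacian
    hw.memL2_weakLaplacian, integral_mul_smul_add c (hpL p) (hpL p') hw0.1.1, hpq w g hw hw0 hg,
    hpq' w g hw hw0 hg, mul_add, Finset.mul_sum, add_add_add_comm, ← Finset.sum_add_distrib]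
  congr 1
  refine Finset.sum_congr rfl fun i _ => ?_
  have hI : ∀ s : Polynomial ℝ, IntegrableOn (fun t => s.eval t * g (K.edgePoint i t))
      (Icc (0 : ℝ) 1) := fun s => by
    have := (hg.memLp i).integrableOn_mul_continuous s.continuous
    simpa only [mul_comm] using this
  rw [← K.edgeIntegral_smul_add i c (hI _) (hI _)]
  congr 1; ext t
  simp only [Pi.add_apply, Pi.smul_apply, Submodule.coe_add, Submodule.coe_smul,
    Polynomial.eval_add, Polynomial.eval_smul, smul_eq_mul]
  ring

/-- Among the polynomials only the constants are needed in the enlarged space: Π₀v is shown to be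
constant before it is subtracted from v. -/
theorem memEnlarged_const (c : ℝ) : K.MemEnlarged ℓ fun _ => c := by
  have hc : ContDiff ℝ ∞ fun _ : Plane => c := contDiff_const
  refine ⟨memH2_of_contDiff K.isOpen_carrier K.isBounded_carrier hc, hc.continuous.continuousOn,
    exists_isNormalTrace_of_contDiff hc, fun i => ⟨Polynomial.C c, ?_, fun t _ => by simp⟩,
    0, Submodule.zero_mem _, 0, fun w g _ _ _ => ?_⟩
  · rw [EdgePoly, Polynomial.mem_degreeLT]
    refine Polynomial.degree_C_le.trans_lt ?_
    have : 0 < ((ℓ : ℤ) + 1).toNat := by omega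
    exact_mod_cast this
  · have h0 : weakLaplacian K.carrier (fun _ => c) =ᵐ[volume.restrict K.carrier] 0 := by
      refine (weakLaplacian_of_contDiff K.isOpen_carrier K.isBounded_carrier hc).trans ?_
      refine Eventually.of_forall fun x => ?_
      have : ∀ i, partialDeriv i (fun _ : Plane => c) = fun _ => 0 := fun i => by
        ext x; simp [partialDeriv]
      have h0 : ∀ i, partialDeriv i (fun _ : Plane => (0 : ℝ)) x = 0 := fun i => by
        simp [partialDeriv]
      simp only [this, h0]; simp
    rw [integral_eq_zero_of_ae (h0.mono fun x hx => by simp [hx])]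
    simp [edgeIntegral]

variable (K) in
/-- The moment of an edge function against polynomials. -/
def edgeFunctional (i : K.Idx) (k : ℤ) {f : ℝ → ℝ}
    (hf : MemLp f 2 (volume.restrict (Icc (0 : ℝ) 1))) : EdgePoly k →ₗ[ℝ] ℝ where
  toFun p := K.edgeIntegral i (fun t => f t * (p : Polynomial ℝ).eval t)
  map_add' p q := by
    have := K.edgeIntegral_smul_add i 1
      (hf.integrableOn_mul_continuous (p : Polynomial ℝ).continuous)
      (hf.integrableOn_mul_continuous (q : Polynomial ℝ).continuous)
    rw [one_mul] at this
    rw [← this]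
    congr 1; ext t; simp only [Submodule.coe_add, Polynomial.eval_add]; ring
  map_smul' c p := by
    simp only [edgeIntegral, Submodule.coe_smul, Polynomial.eval_smul, smul_eq_mul,
      mul_left_comm _ c, intervalIntegral.integral_const_mul, RingHom.id_apply]

theorem area_pos : 0 < K.area := by
  refine ENNReal.toReal_pos ?_ K.isBounded_carrier.measure_lt_top.ne
  exact (K.isOpen_carrier.measure_pos volume K.isConnected_carrier.nonempty).ne'

theorem edge_moment_eq_zero {B : K.DofBasis ℓ} (hw : K.HasTraces w) (hdof : dof B w = 0)
    (i : K.Idx) {p : Polynomial ℝ} (hp : p ∈ EdgePoly ((ℓ : ℤ) - 2)) :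
    K.edgeIntegral i (fun t => w (K.edgePoint i t) * p.eval t) = 0 := by
  have h : K.edgeFunctional i ((ℓ : ℤ) - 2) (hw.memLp_edge i) = 0 := by
    refine (B.edge i).ext fun r => ?_
    have := congrFun hdof (.inr (.inl (i, r)))
    exact (mul_eq_zero.1 this).resolve_left (inv_ne_zero (K.edgeLength_pos i).ne')
  exact congrArg (fun L : EdgePoly ((ℓ : ℤ) - 2) →ₗ[ℝ] ℝ => L ⟨p, hp⟩) h

theorem normal_moment_eq_zero {B : K.DofBasis ℓ} (hw : K.HasTraces w) (hdof : dof B w = 0)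
    (i : K.Idx) {p : Polynomial ℝ} (hp : p ∈ EdgePoly ((ℓ : ℤ) - 2)) :
    K.edgeIntegral i (fun t => K.normalTrace w (K.edgePoint i t) * p.eval t) = 0 := by
  have h : K.edgeFunctional i ((ℓ : ℤ) - 2) (hw.isNormalTrace.memLp i) = 0 := by
    refine (B.normal i).ext fun r => ?_
    exact congrFun hdof (.inr (.inr (.inl (i, r))))
  exact congrArg (fun L : EdgePoly ((ℓ : ℤ) - 2) →ₗ[ℝ] ℝ => L ⟨p, hp⟩) h

theorem interior_moment_eq_zero {B : K.DofBasis ℓ} (hw : K.HasTraces w) (hdof : dof B w = 0)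
    {p : MvPolynomial (Fin 2) ℝ} (hp : p ∈ Poly ((ℓ : ℤ) - 4)) :
    ∫ x in K.carrier, w x * polyFun p x = 0 := by
  have hpL : ∀ p, Integrable (fun x => w x * polyFun p x) (volume.restrict K.carrier) := fun p =>
    hw.1.1.1.integrable_mul
      (Continuous.memLp_restrict (continuous_polyFun p) K.isBounded_carrier 2)
  let L : Poly ((ℓ : ℤ) - 4) →ₗ[ℝ] ℝ :=
    { toFun := fun p => ∫ x in K.carrier, w x * polyFun p x
      map_add' := fun p q => by
        rw [← integral_add (hpL p) (hpL q)]
        congr 1; ext x; rw [Submodule.coe_add, polyFun_add, mul_add]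
      map_smul' := fun c p => by
        rw [RingHom.id_apply, smul_eq_mul, ← integral_const_mul]
        congr 1; ext x; rw [Submodule.coe_smul, polyFun_smul]; ring }
  have h : L = 0 := by
    refine B.interior.ext fun r => ?_
    have := congrFun hdof (.inr (.inr (.inr r)))
    exact (mul_eq_zero.1 this).resolve_left (inv_ne_zero area_pos.ne')
  exact congrArg (fun L : Poly ((ℓ : ℤ) - 4) →ₗ[ℝ] ℝ => L ⟨p, hp⟩) h

theorem edgePoint_zero (i : K.Idx) : K.edgePoint i 0 = K.vertex i := by simp [edgePoint]

theorem edgePoint_one (i : K.Idx) : K.edgePoint i 1 = K.vertex (i + 1) := by simp [edgePoint]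

/-- A function of the enlarged space vanishes if its degrees of freedom and its moments against
`P_ℓ(K)` do. -/
theorem MemEnlarged.eq_zero {B : K.DofBasis ℓ} (hw : K.MemEnlarged ℓ w) (hdof : dof B w = 0)
    (hint : ∀ p ∈ Poly ℓ, ∫ x in K.carrier, w x * polyFun p x = 0) :
    ∀ x ∈ K.carrier, w x = 0 := by
  have hT := hw.hasTraces
  have hU := K.isOpen_carrier
  obtain ⟨hH2, hc, -, hedge, p, hp, q, hpq⟩ := hw
  -- Edgewise, w is a polynomial with vanishing end values and moments up to degree ℓ - 2, hence
  -- zero.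
  have hfr : ∀ x ∈ frontier K.carrier, w x = 0 := by
    intro x hx
    rw [K.frontier_carrier, mem_iUnion] at hx
    obtain ⟨i, hi⟩ := hx
    obtain ⟨t, ht, rfl⟩ := K.exists_edgePoint_of_mem_edge hi
    obtain ⟨r, hr, hrw⟩ := hedge i
    have hr0 : r = 0 := by
      refine edgePoly_eq_zero hr ?_ ?_ fun s hs => ?_
      · rw [← hrw 0 ⟨le_rfl, zero_le_one⟩, edgePoint_zero]
        exact congrFun hdof (.inl i)
      · rw [← hrw 1 ⟨zero_le_one, le_rfl⟩, edgePoint_one]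
        exact congrFun hdof (.inl (i + 1))
      · have := (mul_eq_zero.1 (edge_moment_eq_zero hT hdof i hs)).resolve_left
          (K.edgeLength_pos i).ne'
        refine Eq.trans (intervalIntegral.integral_congr fun t ht => ?_) this
        rw [uIcc_of_le zero_le_one] at ht
        simp only [hrw t ht]
    rw [hrw t ht, hr0, Polynomial.eval_zero]
  have h10 : MemH10 K.carrier w :=
    memH10_of_continuousOn hU K.isBounded_carrier hH2.1 hc hfr
  -- The function w is its own test function. The source p has degree at most ℓ and is paired with
  -- w, and each edge datum has degree at most ℓ - 2 and is paired with the normal derivative; all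
  -- these moments vanish.
  have hΔ : weakLaplacian K.carrier w =ᵐ[volume.restrict K.carrier] 0 := by
    refine ae_eq_zero_of_integral_mul_self hH2.memL2_weakLaplacian ?_
    rw [hpq w _ hH2 h10 hT.isNormalTrace]
    have h1 := hint p hp
    simp_rw [mul_comm (w _)] at h1
    rw [h1, zero_add]
    refine Finset.sum_eq_zero fun i _ => ?_
    have := normal_moment_eq_zero hT hdof i (q i).2
    simp_rw [mul_comm (K.normalTrace w _)] at this
    exact this
  -- Green's formula without boundary term, from w ∈ H¹₀, gives ∫ |∇w|² = -∫ w Δw.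
  have hgrad : ∑ i, ∫ x in K.carrier, weakDeriv K.carrier i w x * weakDeriv K.carrier i w x = 0 := by
    have e : ∀ i, ∫ x in K.carrier, weakDeriv K.carrier i w x * weakDeriv K.carrier i w x =
        -∫ x in K.carrier, weakDeriv K.carrier i (weakDeriv K.carrier i w) x * w x := fun i =>
      h10.integral_mul_weakDeriv (hH2.2 i) i
    simp_rw [e]
    rw [Finset.sum_neg_distrib, neg_eq_zero, ← integral_finsetSum Finset.univ fun i _ =>
      ((hH2.2 i).2 i).memL2_weakDeriv.integrable_mul hH2.1.1]
    refine integral_eq_zero_of_ae ?_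
    filter_upwards [hΔ] with x hx
    rw [← Finset.sum_mul]
    change weakLaplacian K.carrier w x * w x = 0
    rw [hx]; simp
  have h0 := (Finset.sum_eq_zero_iff_of_nonneg fun i _ =>
    integral_nonneg fun x => mul_self_nonneg _).1 hgrad 0 (Finset.mem_univ 0)
  have hae := h10.ae_eq_zero K.isBounded_carrier
    (ae_eq_zero_of_integral_mul_self (hH2.1.2 0).memL2_weakDeriv h0)
  exact Measure.eqOn_open_of_ae_eq hae hU (hc.mono subset_closure) continuousOn_const

/-! ### The kernel of the projected gradient and the residual on the local space. -/

namespace Projections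

variable {B : K.DofBasis ℓ} (P : Projections B)

/-- The degrees of freedom of `v - Π₀ v`. -/
def residual (v : Plane → ℝ) : K.DofIdx ℓ → ℝ := dof B fun x => v x - polyFun (P.valueProj v) x

theorem residual_eq (hv : K.HasTraces v) :
    P.residual v = dof B v - dof B (polyFun (P.valueProj v)) := by
  have e : (fun x => v x - polyFun (P.valueProj v) x) =
      (-1 : ℝ) • polyFun (P.valueProj v) + v := by
    ext x; simp only [Pi.add_apply, Pi.smul_apply, smul_eq_mul]; ring
  rw [residual, e, dof_smul_add B _ (hasTraces_polyFun _) hv]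
  module

theorem residual_smul_add (c : ℝ) (hu : K.HasTraces u) (hv : K.HasTraces v) :
    P.residual (c • u + v) = c • P.residual u + P.residual v := by
  rw [P.residual_eq (hu.smul_add c hv), P.residual_eq hu, P.residual_eq hv,
    P.valueProj_smul_add c hu hv, polyFun_smul_add, dof_smul_add B c hu hv,
    dof_smul_add B c (hasTraces_polyFun _) (hasTraces_polyFun _)]
  module

variable {P}

theorem MemLocal.hasTraces (hv : P.MemLocal v) : K.HasTraces v := hv.1.hasTraces

theorem MemLocal.smul_add (c : ℝ) (hu : P.MemLocal u) (hv : P.MemLocal v) :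
    P.MemLocal (c • u + v) := by
  refine ⟨hu.1.smul_add c hv.1, fun p hp hp' => ?_⟩
  have hL : ∀ p, MemL2 K.carrier (polyFun p) := fun p =>
    Continuous.memLp_restrict (continuous_polyFun p) K.isBounded_carrier 2
  have e : ∀ x, (c • u + v) x - polyFun (P.valueProj (c • u + v)) x =
      c * (u x - polyFun (P.valueProj u) x) + (v x - polyFun (P.valueProj v) x) := fun x => by
    rw [P.valueProj_smul_add c hu.hasTraces hv.hasTraces, polyFun_add, polyFun_smul,
      Pi.add_apply, Pi.smul_apply, smul_eq_mul]
    ring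
  simp_rw [e]
  refine (integral_mul_smul_add c (hu.hasTraces.1.1.1.sub (hL _)) (hv.hasTraces.1.1.1.sub (hL _))
    (hL p)).trans ?_
  simp only [Pi.sub_apply]
  rw [hu.2 p hp hp', hv.2 p hp hp', mul_zero, add_zero]

/-- The normal trace of 0 is a chosen representative, not literally 0, so the claim is drawn from
additivity. -/
theorem dof_zero : dof B (0 : Plane → ℝ) = 0 := by
  have h0 : K.HasTraces (0 : Plane → ℝ) := hasTraces_of_contDiff contDiff_const
  have := dof_smul_add B 1 h0 h0
  rw [smul_zero, add_zero, one_smul] at this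
  exact left_eq_add.1 this

theorem memLocal_zero : P.MemLocal (0 : Plane → ℝ) := by
  refine ⟨memEnlarged_const 0, fun p _ _ => ?_⟩
  have : P.valueProj (0 : Plane → ℝ) = 0 := by simp [valueProj, dof_zero]
  simp [this]

/-- If the projected gradient and the degrees of freedom of `v - Π₀ v` vanish, then `v` is
constant. -/
theorem MemLocal.eq_const (hv : P.MemLocal v) (hG : P.gradProj v = 0) (hR : P.residual v = 0) :
    ∀ x ∈ K.carrier, v x = polyFun (P.valueProj v) 0 := by
  set q := P.valueProj v with hq
  have hd : dof B v = dof B (polyFun q) := by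
    rw [P.residual_eq hv.hasTraces] at hR; exact sub_eq_zero.1 hR
  have hg := P.gradProj_of_dof_eq (P.valueProj_mem v) hd
  have hconst : ∀ x, polyFun q x = polyFun q 0 := by
    refine polyFun_eq_const_of_pderiv_eq_zero fun j => ?_
    rw [hG] at hg
    exact (congrFun hg j).symm
  set w : Plane → ℝ := (-1 : ℝ) • (fun _ => polyFun q 0) + v with hw
  have hwx : ∀ x, w x = v x - polyFun q x := fun x => by
    rw [hw, hconst x]; simp only [Pi.add_apply, Pi.smul_apply, smul_eq_mul]; ring
  have hwE : K.MemEnlarged ℓ w := (memEnlarged_const _).smul_add _ hv.1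
  have hwd : dof B w = 0 := by
    rw [← hR]; exact congrArg (dof B) (funext hwx)
  have h0 := hwE.eq_zero hwd fun p hp => by
    -- Moments against P_{ℓ-4} are degrees of freedom; for the remaining polynomials the constraint
    -- in the local space says that v and Π₀v have equal moments.
    by_cases hp' : p ∈ Poly ((ℓ : ℤ) - 4)
    · exact interior_moment_eq_zero hwE.hasTraces hwd hp'
    · simp_rw [hwx]; exact hv.2 p hp hp'
  intro x hx
  have := h0 x hx
  rw [hwx, hconst] at this
  exact sub_eq_zero.1 this

/-- With zero degrees of freedom Π₀v, Π₁v and the residual all vanish, so v equals the constant Π₀v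
= 0. This is the injectivity behind the finite dimension of the global space. -/
theorem MemLocal.eq_zero_of_dof (hv : P.MemLocal v) (hd : dof B v = 0) :
    ∀ x ∈ K.carrier, v x = 0 := by
  have hq : P.valueProj v = 0 := by simp [valueProj, hd]
  have h0 : dof B v = dof B (polyFun (0 : MvPolynomial (Fin 2) ℝ)) := by
    have : polyFun (0 : MvPolynomial (Fin 2) ℝ) = 0 := by ext; simp
    rw [hd, this, dof_zero]
  have hG : P.gradProj v = 0 := by
    rw [P.gradProj_of_dof_eq (Submodule.zero_mem _) h0]; ext j; simp
  have hR : P.residual v = 0 := by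
    rw [P.residual_eq hv.hasTraces, hq, h0, sub_self]
  intro x hx
  rw [hv.eq_const hG hR x hx, hq, polyFun_zero]

end Projections

end Polygon

/-! ### The local discrete form -/

namespace Polygon

variable {K : Polygon} {ℓ : ℕ} {B : K.DofBasis ℓ} (P : Projections B) (ε : ℝ)
  {Φ : Plane → Matrix (Fin 2) (Fin 2) ℝ} {u u' v v' : Plane → ℝ}

theorem integrableOn_coefficient_mul
    (hΦ : ∀ a b, MemLp (fun x => Φ x a b) ⊤ (volume.restrict K.carrier))
    (G G' : Fin 2 → MvPolynomial (Fin 2) ℝ) :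
    IntegrableOn (fun x => ∑ a, ∑ b, Φ x a b * polyFun (G b) x * polyFun (G' a) x) K.carrier := by
  refine integrable_finsetSum _ fun a _ => integrable_finsetSum _ fun b _ => ?_
  have h1 := integrableOn_polyFun (G b * G' a) K.isBounded_carrier
  have h2 := (memLp_one_iff_integrable.2 h1).mul (hΦ a b) (r := 1)
  refine (memLp_one_iff_integrable.1 h2).congr (Eventually.of_forall fun x => ?_)
  simp only [Pi.mul_apply, polyFun_mul]; ring

theorem localForm_smul_add_left
    (hΦ : ∀ a b, MemLp (fun x => Φ x a b) ⊤ (volume.restrict K.carrier)) (c : ℝ)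
    (hu : K.HasTraces u) (hu' : K.HasTraces u') (v : Plane → ℝ) :
    localForm P ε Φ (c • u + u') v = c * localForm P ε Φ u v + localForm P ε Φ u' v := by
  have hH : ∫ x in K.carrier, ∑ a, ∑ b, polyFun (P.hessProj (c • u + u') a b) x *
      polyFun (P.hessProj v a b) x =
      c * (∫ x in K.carrier, ∑ a, ∑ b, polyFun (P.hessProj u a b) x *
        polyFun (P.hessProj v a b) x) + ∫ x in K.carrier, ∑ a, ∑ b,
          polyFun (P.hessProj u' a b) x * polyFun (P.hessProj v a b) x := by
    have key : ∀ H : Fin 2 → Fin 2 → MvPolynomial (Fin 2) ℝ,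
        ∫ x in K.carrier, ∑ a, ∑ b, polyFun (H a b) x * polyFun (P.hessProj v a b) x =
        K.polyIntegral (∑ a, ∑ b, H a b * P.hessProj v a b) := fun H => by
      simp only [polyIntegral_apply, polyFun_sum, polyFun_mul]
    rw [key, key, key, P.hessProj_smul_add c hu hu', ← smul_eq_mul, ← map_smul, ← map_add]
    congr 1
    simp only [Fin.sum_univ_two, Pi.add_apply, Pi.smul_apply, smul_add, add_mul, smul_mul_assoc]
    abel
  have hG : ∫ x in K.carrier, ∑ a, ∑ b, Φ x a b * polyFun (P.gradProj (c • u + u') b) x *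
      polyFun (P.gradProj v a) x =
      c * (∫ x in K.carrier, ∑ a, ∑ b, Φ x a b * polyFun (P.gradProj u b) x *
        polyFun (P.gradProj v a) x) + ∫ x in K.carrier, ∑ a, ∑ b, Φ x a b *
          polyFun (P.gradProj u' b) x * polyFun (P.gradProj v a) x := by
    rw [← integral_const_mul, ← integral_add ((integrableOn_coefficient_mul hΦ _ _).const_mul c)
      (integrableOn_coefficient_mul hΦ _ _), P.gradProj_smul_add c hu hu']
    congr 1; ext x
    simp only [Fin.sum_univ_two, Pi.add_apply, Pi.smul_apply, polyFun_add, polyFun_smul]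
    ring
  have hR : ∑ s, P.residual (c • u + u') s * P.residual v s =
      c * (∑ s, P.residual u s * P.residual v s) + ∑ s, P.residual u' s * P.residual v s := by
    rw [P.residual_smul_add c hu hu', Finset.mul_sum, ← Finset.sum_add_distrib]
    refine Finset.sum_congr rfl fun s _ => ?_
    simp only [Pi.add_apply, Pi.smul_apply, smul_eq_mul]; ring
  simp only [Projections.residual] at hR
  simp only [localForm, stab, hH, hG, hR]
  ring

theorem localForm_smul_add_right
    (hΦ : ∀ a b, MemLp (fun x => Φ x a b) ⊤ (volume.restrict K.carrier)) (c : ℝ)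
    (u : Plane → ℝ) (hv : K.HasTraces v) (hv' : K.HasTraces v') :
    localForm P ε Φ u (c • v + v') = c * localForm P ε Φ u v + localForm P ε Φ u v' := by
  have hH : ∫ x in K.carrier, ∑ a, ∑ b, polyFun (P.hessProj u a b) x *
      polyFun (P.hessProj (c • v + v') a b) x =
      c * (∫ x in K.carrier, ∑ a, ∑ b, polyFun (P.hessProj u a b) x *
        polyFun (P.hessProj v a b) x) + ∫ x in K.carrier, ∑ a, ∑ b,
          polyFun (P.hessProj u a b) x * polyFun (P.hessProj v' a b) x := by
    have key : ∀ H : Fin 2 → Fin 2 → MvPolynomial (Fin 2) ℝ,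
        ∫ x in K.carrier, ∑ a, ∑ b, polyFun (P.hessProj u a b) x * polyFun (H a b) x =
        K.polyIntegral (∑ a, ∑ b, P.hessProj u a b * H a b) := fun H => by
      simp only [polyIntegral_apply, polyFun_sum, polyFun_mul]
    rw [key, key, key, P.hessProj_smul_add c hv hv', ← smul_eq_mul, ← map_smul, ← map_add]
    congr 1
    simp only [Fin.sum_univ_two, Pi.add_apply, Pi.smul_apply, smul_add, mul_add, mul_smul_comm]
    abel
  have hG : ∫ x in K.carrier, ∑ a, ∑ b, Φ x a b * polyFun (P.gradProj u b) x *
      polyFun (P.gradProj (c • v + v') a) x =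
      c * (∫ x in K.carrier, ∑ a, ∑ b, Φ x a b * polyFun (P.gradProj u b) x *
        polyFun (P.gradProj v a) x) + ∫ x in K.carrier, ∑ a, ∑ b, Φ x a b *
          polyFun (P.gradProj u b) x * polyFun (P.gradProj v' a) x := by
    rw [← integral_const_mul, ← integral_add ((integrableOn_coefficient_mul hΦ _ _).const_mul c)
      (integrableOn_coefficient_mul hΦ _ _), P.gradProj_smul_add c hv hv']
    congr 1; ext x
    simp only [Fin.sum_univ_two, Pi.add_apply, Pi.smul_apply, polyFun_add, polyFun_smul]
    ring
  have hR : ∑ s, P.residual u s * P.residual (c • v + v') s =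
      c * (∑ s, P.residual u s * P.residual v s) + ∑ s, P.residual u s * P.residual v' s := by
    rw [P.residual_smul_add c hv hv', Finset.mul_sum, ← Finset.sum_add_distrib]
    refine Finset.sum_congr rfl fun s _ => ?_
    simp only [Pi.add_apply, Pi.smul_apply, smul_eq_mul]; ring
  simp only [Projections.residual] at hR
  simp only [localForm, stab, hH, hG, hR]
  ring

theorem diam_pos : 0 < Metric.diam K.carrier := by
  obtain ⟨x, hx⟩ := K.isConnected_carrier.nonempty
  refine Metric.diam_pos ?_ K.isBounded_carrier
  exact (infinite_of_mem_nhds x (K.isOpen_carrier.mem_nhds hx)).nontrivial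

/-- The local form is nonnegative, and it controls the projected gradient and `v - Π₀ v`. -/
theorem localForm_nonneg (hε : 0 < ε)
    (hΦ : ∀ a b, MemLp (fun x => Φ x a b) ⊤ (volume.restrict K.carrier)) {β : ℝ} (hβ : 0 < β)
    (hpos : ∀ᵐ x ∂volume.restrict K.carrier, ∀ ξ : Fin 2 → ℝ,
      β * ∑ a, ξ a ^ 2 ≤ ∑ a, ∑ b, Φ x a b * ξ a * ξ b) (v : Plane → ℝ) :
    0 ≤ localForm P ε Φ v v ∧
      (localForm P ε Φ v v = 0 → P.gradProj v = 0 ∧ P.residual v = 0) := by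
  have hH : 0 ≤ ε * ∫ x in K.carrier, ∑ a, ∑ b,
      polyFun (P.hessProj v a b) x * polyFun (P.hessProj v a b) x :=
    mul_nonneg hε.le (integral_nonneg fun x => Finset.sum_nonneg fun a _ =>
      Finset.sum_nonneg fun b _ => mul_self_nonneg _)
  -- Ellipticity is applied pointwise with ξ = Π₁v(x). Of the Hessian term only the sign is used.
  have hG : β * K.polyIntegral (∑ a, P.gradProj v a * P.gradProj v a) ≤
      ∫ x in K.carrier, ∑ a, ∑ b,
        Φ x a b * polyFun (P.gradProj v b) x * polyFun (P.gradProj v a) x := by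
    rw [polyIntegral_apply, ← integral_const_mul]
    refine integral_mono_ae ((integrableOn_polyFun _ K.isBounded_carrier).const_mul β)
      (integrableOn_coefficient_mul hΦ _ _) ?_
    filter_upwards [hpos] with x hx
    have := hx fun a => polyFun (P.gradProj v a) x
    simp only [polyFun_sum, polyFun_mul]
    calc _ = β * ∑ a, polyFun (P.gradProj v a) x ^ 2 := by simp_rw [sq]
      _ ≤ _ := this
      _ = _ := Finset.sum_congr rfl fun a _ => Finset.sum_congr rfl fun b _ => by ring
  have hG0 : 0 ≤ K.polyIntegral (∑ a, P.gradProj v a * P.gradProj v a) := by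
    rw [polyIntegral_apply]
    refine integral_nonneg fun x => ?_
    simp only [Pi.zero_apply, polyFun_sum, polyFun_mul]
    exact Finset.sum_nonneg fun a _ => mul_self_nonneg _
  -- The part ε h_K⁻² alone makes the weight positive; of `supNorm` only nonnegativity matters.
  have hc : 0 < ε * (Metric.diam K.carrier ^ 2)⁻¹ + supNorm K.carrier Φ :=
    add_pos_of_pos_of_nonneg (mul_pos hε (inv_pos.2 (pow_pos diam_pos 2))) ENNReal.toReal_nonneg
  have hS0 : 0 ≤ ∑ s, P.residual v s * P.residual v s :=
    Finset.sum_nonneg fun s _ => mul_self_nonneg _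
  have hS : 0 ≤ (ε * (Metric.diam K.carrier ^ 2)⁻¹ + supNorm K.carrier Φ) *
      ∑ s, P.residual v s * P.residual v s := mul_nonneg hc.le hS0
  have hβG := mul_nonneg hβ.le hG0
  have e : localForm P ε Φ v v = ε * (∫ x in K.carrier, ∑ a, ∑ b,
      polyFun (P.hessProj v a b) x * polyFun (P.hessProj v a b) x) +
      (∫ x in K.carrier, ∑ a, ∑ b,
        Φ x a b * polyFun (P.gradProj v b) x * polyFun (P.gradProj v a) x) +
      (ε * (Metric.diam K.carrier ^ 2)⁻¹ + supNorm K.carrier Φ) *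
        ∑ s, P.residual v s * P.residual v s := rfl
  rw [e]
  refine ⟨by linarith, fun h => ⟨?_, ?_⟩⟩
  · have h1 : β * K.polyIntegral (∑ a, P.gradProj v a * P.gradProj v a) = 0 := by linarith
    ext1 a
    exact K.eq_zero_of_polyIntegral_eq_zero ((mul_eq_zero.1 h1).resolve_left hβ.ne') a
  · have h1 : (ε * (Metric.diam K.carrier ^ 2)⁻¹ + supNorm K.carrier Φ) *
        ∑ s, P.residual v s * P.residual v s = 0 := by linarith
    have h2 := (Finset.sum_eq_zero_iff_of_nonneg fun s _ => mul_self_nonneg _).1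
      ((mul_eq_zero.1 h1).resolve_left hc.ne')
    ext s
    exact mul_self_eq_zero.1 (h2 s (Finset.mem_univ s))

end Polygon

/-! ### The global space -/

namespace Mesh

variable {Ω : Set Plane} {T : Mesh Ω} {ℓ : ℕ} {B : T.DofBases ℓ} {P : Projections B}
  {u v : Plane → ℝ}

theorem isBounded (T : Mesh Ω) : Bornology.IsBounded Ω := by
  refine Bornology.IsBounded.subset ?_ (T.cover ▸ subset_closure : Ω ⊆ ⋃ k, closure _)
  exact (Bornology.isBounded_iUnion).2 fun k => (T.element k).isBounded_carrier.closure

variable (T) in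
-- An element is open and lies in the closure of Ω, hence in its interior, which is Ω again because
-- Ω is open and convex. Without convexity, Ω could have a slit that runs through an element.
theorem carrier_subset (hΩ : IsOpen Ω) (hc : Convex ℝ Ω) (k : Fin T.N) :
    (T.element k).carrier ⊆ Ω := by
  have h1 : (T.element k).carrier ⊆ closure Ω := by
    rw [← T.cover]
    exact subset_closure.trans (subset_iUnion (fun k => closure (T.element k).carrier) k)
  have h2 : (interior Ω).Nonempty := by
    rw [hΩ.interior_eq, ← closure_nonempty_iff]
    exact (T.element k).isConnected_carrier.nonempty.mono h1
  have h3 := interior_maximal h1 (T.element k).isOpen_carrier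
  rwa [hc.interior_closure_eq_interior_of_nonempty_interior h2, hΩ.interior_eq] at h3

variable (T) in
-- The closed elements cover Ω, and their boundaries are finite unions of null segments.
theorem ae_mem_carrier (hΩ : IsOpen Ω) :
    ∀ᵐ x ∂volume.restrict Ω, ∃ k, x ∈ (T.element k).carrier := by
  have h : ∀ᵐ x : Plane, ∀ k, x ∉ frontier (T.element k).carrier :=
    ae_all_iff.2 fun k => measure_eq_zero_iff_ae_notMem.1 (T.element k).volume_frontier
  filter_upwards [ae_restrict_of_ae h, ae_restrict_mem hΩ.measurableSet] with x hx hxΩ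
  have : x ∈ ⋃ k, closure (T.element k).carrier := by
    rw [T.cover]; exact subset_closure hxΩ
  obtain ⟨k, hk⟩ := mem_iUnion.1 this
  refine ⟨k, by_contra fun h => hx k ?_⟩
  rw [(T.element k).isOpen_carrier.frontier_eq]
  exact ⟨hk, h⟩

/-- A function of the global space that is constant on every element vanishes. -/
theorem eq_zero_of_eq_const (hΩ : IsOpen Ω) (hc : Convex ℝ Ω) (hv : v ∈ space P)
    (h : ∀ k, ∃ c, ∀ x ∈ (T.element k).carrier, v x = c) : v = 0 := by
  obtain ⟨h10, hcont, hout, -, -⟩ := hv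
  have hk : ∀ k, weakDeriv Ω 0 v =ᵐ[volume.restrict (T.element k).carrier] 0 := by
    intro k
    obtain ⟨c, hvc⟩ := h k
    have hU := (T.element k).isOpen_carrier
    have hsub := T.carrier_subset hΩ hc k
    have h1 := (h10.1.2 0).isWeakDeriv.mono hsub
    have h2 : IsWeakDeriv (T.element k).carrier 0 v (fun _ => 0) := by
      have := (isWeakDeriv_of_contDiff (f := fun _ => c) contDiff_const
        (T.element k).carrier 0)
      have e : partialDeriv 0 (fun _ : Plane => c) = fun _ => 0 := by
        ext x; simp [partialDeriv]
      rw [e] at this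
      refine this.congr_ae ?_ .rfl
      filter_upwards [ae_restrict_mem hU.measurableSet] with x hx using (hvc x hx).symm
    exact h1.ae_eq hU h2
      (MemLp.mono_measure (Measure.restrict_mono hsub le_rfl) (h10.1.2 0).memL2_weakDeriv)
      MemLp.zero
  -- The weak derivative lives on all of Ω, so jumps between elements cannot hide in it: vanishing
  -- on each element means vanishing almost everywhere, although the constants might differ a
  -- priori.
  have hae : ∀ᵐ x ∂volume.restrict Ω, weakDeriv Ω 0 v x = 0 := by
    have hall : ∀ᵐ x : Plane, ∀ k, x ∈ (T.element k).carrier → weakDeriv Ω 0 v x = 0 :=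
      ae_all_iff.2 fun k =>
        (ae_restrict_iff' (T.element k).isOpen_carrier.measurableSet).1 (hk k)
    filter_upwards [ae_restrict_of_ae hall, T.ae_mem_carrier hΩ] with x hx ⟨k, hxk⟩
    exact hx k hxk
  have h0 : EqOn v 0 Ω := Measure.eqOn_open_of_ae_eq (h10.ae_eq_zero T.isBounded hae) hΩ
    (hcont.mono subset_closure) continuousOn_const
  have h1 : EqOn v 0 (closure Ω) :=
    h0.of_subset_closure hcont continuousOn_const subset_closure le_rfl
  ext x
  by_cases hx : x ∈ closure Ω
  · exact h1 hx
  · exact hout x hx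

variable (T) in
/-- The moment of the jump of the normal derivative over the common edge of two elements. -/
def jumpMoment (k k' : Fin T.N) (i : (T.element k).Idx) (p : Polynomial ℝ) (v : Plane → ℝ) : ℝ :=
  (T.element k).edgeIntegral i (fun t =>
    ((T.element k).normalTrace v ((T.element k).edgePoint i t) +
      (T.element k').normalTrace v ((T.element k).edgePoint i t)) * p.eval t)

/-- Linearity of the trace from the second element is known in that element's parametrisation only.
The measure preserving change of parameter carries it, with square integrability, to the
parametrisation used in the moment. -/
theorem jumpMoment_smul_add {k k' : Fin T.N} {i : (T.element k).Idx} {j : (T.element k').Idx}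
    (h : (T.element k).edge i = (T.element k').edge j) (p : Polynomial ℝ) (c : ℝ)
    (hu : ∀ k, (T.element k).HasTraces u) (hv : ∀ k, (T.element k).HasTraces v) :
    T.jumpMoment k k' i p (c • u + v) = c * T.jumpMoment k k' i p u + T.jumpMoment k k' i p v := by
  obtain ⟨θ, hθ, hθe⟩ := Polygon.exists_measurePreserving_edgePoint h
  have hL : ∀ {v : Plane → ℝ}, (∀ k, (T.element k).HasTraces v) →
      MemLp (fun t => (T.element k).normalTrace v ((T.element k).edgePoint i t) +
        (T.element k').normalTrace v ((T.element k).edgePoint i t)) 2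
        (volume.restrict (Icc (0 : ℝ) 1)) := by
    intro v hv
    refine ((hv k).isNormalTrace.memLp i).add ?_
    have := ((hv k').isNormalTrace.memLp j).comp_measurePreserving hθ
    simpa only [Function.comp_def, ← hθe] using this
  rw [jumpMoment, jumpMoment, jumpMoment, ← (T.element k).edgeIntegral_smul_add i c
    ((hL hu).integrableOn_mul_continuous p.continuous)
    ((hL hv).integrableOn_mul_continuous p.continuous)]
  refine (T.element k).edgeIntegral_congr_ae i ?_
  have h2 := hθ.quasiMeasurePreserving.ae ((hu k').normalTrace_smul_add c (hv k') j)
  filter_upwards [(hu k).normalTrace_smul_add c (hv k) i, h2] with t h1 h2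
  rw [← hθe] at h2
  rw [h1, h2]
  ring

theorem hasTraces_of_mem_space (hv : v ∈ space P) (k : Fin T.N) : (T.element k).HasTraces v :=
  (hv.2.2.2.1 k).hasTraces

theorem space_smul_add (hΩ : IsOpen Ω) (c : ℝ) (hu : u ∈ space P) (hv : v ∈ space P) :
    c • u + v ∈ space P := by
  refine ⟨hu.1.smul_add hΩ c hv.1, (hu.2.1.const_smul c).add hv.2.1, fun x hx => ?_,
    fun k => (hu.2.2.2.1 k).smul_add c (hv.2.2.2.1 k), fun k k' hkk' i j hij p hp => ?_⟩
  · rw [Pi.add_apply, Pi.smul_apply, hu.2.2.1 x hx, hv.2.2.1 x hx, smul_zero, add_zero]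
  · have h1 : T.jumpMoment k k' i p u = 0 := hu.2.2.2.2 k k' hkk' i j hij p hp
    have h2 : T.jumpMoment k k' i p v = 0 := hv.2.2.2.2 k k' hkk' i j hij p hp
    have := jumpMoment_smul_add hij p c (hasTraces_of_mem_space hu) (hasTraces_of_mem_space hv)
    rwa [h1, h2, mul_zero, add_zero] at this

/-- As the normal traces of 0 are chosen representatives, the vanishing of the jump moments comes
from their additivity. -/
theorem zero_mem_space (hΩ : IsOpen Ω) : (0 : Plane → ℝ) ∈ space P := by
  have h0 : ContDiff ℝ ∞ (0 : Plane → ℝ) := contDiff_const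
  have h1 : MemH1 Ω (0 : Plane → ℝ) := memH1_of_contDiff T.isBounded h0
  have hT : ∀ k, (T.element k).HasTraces (0 : Plane → ℝ) := fun k =>
    Polygon.hasTraces_of_contDiff h0
  refine ⟨memH10_of_continuousOn hΩ T.isBounded h1 continuousOn_const fun _ _ => rfl,
    continuousOn_const, fun _ _ => rfl, fun k => Polygon.Projections.memLocal_zero,
    fun k k' _ i j hij p _ => ?_⟩
  have := jumpMoment_smul_add hij p 1 hT hT
  rw [smul_zero, add_zero, one_mul] at this
  exact left_eq_add.1 this

variable (P) in
/-- The global space as a linear space. -/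
def spaceSubmodule (hΩ : IsOpen Ω) : Submodule ℝ (Plane → ℝ) where
  carrier := space P
  add_mem' {u v} hu hv := by
    have := space_smul_add hΩ 1 hu hv
    rwa [one_smul] at this
  zero_mem' := zero_mem_space hΩ
  smul_mem' c u hu := by
    have := space_smul_add hΩ c hu (zero_mem_space hΩ)
    rwa [add_zero] at this

/-- The degrees of freedom of all elements determine the function, by elementwise unisolvence and
`eq_zero_of_eq_const` with all constants zero; there are finitely many of them. -/
theorem finiteDimensional_space (hΩ : IsOpen Ω) (hc : Convex ℝ Ω) :
    FiniteDimensional ℝ (spaceSubmodule P hΩ) := by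
  have hT : ∀ (v : spaceSubmodule P hΩ) k, (T.element k).HasTraces (v : Plane → ℝ) :=
    fun v k => hasTraces_of_mem_space v.2 k
  let D : spaceSubmodule P hΩ →ₗ[ℝ] ∀ k, (T.element k).DofIdx ℓ → ℝ :=
    { toFun := fun v k => Polygon.dof (B k) v
      map_add' := fun u v => by
        ext1 k
        have := Polygon.dof_smul_add (B k) 1 (hT u k) (hT v k)
        rwa [one_smul, one_smul] at this
      map_smul' := fun c u => by
        ext1 k
        have := Polygon.dof_smul_add (B k) c (hT u k) (hT 0 k)
        rwa [Submodule.coe_zero, add_zero, Polygon.Projections.dof_zero, add_zero] at this }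
  have hinj : Function.Injective D := by
    refine (injective_iff_map_eq_zero D).2 fun v hv => Subtype.ext ?_
    refine eq_zero_of_eq_const hΩ hc v.2 fun k => ⟨0, ?_⟩
    exact (v.2.2.2.2.1 k).eq_zero_of_dof (congrFun hv k)
  exact Module.Finite.of_injective D hinj

end Mesh

/-! ### The discrete problem -/

section DiscreteProblem

variable {Ω : Set Plane} {T : Mesh Ω} {ℓ : ℕ} {B : T.DofBases ℓ} {P : Mesh.Projections B}
  {Φ : Plane → Matrix (Fin 2) (Fin 2) ℝ}

/-- A bilinear form and a linear form given on the global space by functions that respect linear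
combinations. -/
theorem existsUnique_mem_space (hΩ : IsOpen Ω) (hc : Convex ℝ Ω)
    {A : (Plane → ℝ) → (Plane → ℝ) → ℝ} {F : (Plane → ℝ) → ℝ}
    (hl : ∀ c, ∀ u ∈ Mesh.space P, ∀ u' ∈ Mesh.space P, ∀ v,
      A (c • u + u') v = c * A u v + A u' v)
    (hr : ∀ c u, ∀ v ∈ Mesh.space P, ∀ v' ∈ Mesh.space P,
      A u (c • v + v') = c * A u v + A u v')
    (hF : ∀ c, ∀ v ∈ Mesh.space P, ∀ v' ∈ Mesh.space P, F (c • v + v') = c * F v + F v')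
    (hA : ∀ v ∈ Mesh.space P, A v v = 0 → v = 0) :
    ∃! v, v ∈ Mesh.space P ∧ ∀ w ∈ Mesh.space P, A v w = F w := by
  have h0 := Mesh.zero_mem_space (P := P) hΩ
  have hl0 : ∀ v, A 0 v = 0 := fun v => by
    have := hl 1 0 h0 0 h0 v
    rw [smul_zero, add_zero, one_mul] at this
    exact left_eq_add.1 this
  have hr0 : ∀ u, A u 0 = 0 := fun u => by
    have := hr 1 u 0 h0 0 h0
    rw [smul_zero, add_zero, one_mul] at this
    exact left_eq_add.1 this
  have hF0 : F 0 = 0 := by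
    have := hF 1 0 h0 0 h0
    rw [smul_zero, add_zero, one_mul] at this
    exact left_eq_add.1 this
  have := Mesh.finiteDimensional_space (P := P) hΩ hc
  let V := Mesh.spaceSubmodule P hΩ
  let b : V →ₗ[ℝ] V →ₗ[ℝ] ℝ := LinearMap.mk₂ ℝ (fun u v => A u v)
    (fun u u' v => by
      have := hl 1 u u.2 u' u'.2 v
      rwa [one_smul, one_mul] at this)
    (fun c u v => by
      have := hl c u u.2 0 h0 v
      rwa [add_zero, hl0, add_zero] at this)
    (fun u v v' => by
      have := hr 1 u v v.2 v' v'.2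
      rwa [one_smul, one_mul] at this)
    (fun c u v => by
      have := hr c u v v.2 0 h0
      rwa [add_zero, hr0, add_zero] at this)
  let f : V →ₗ[ℝ] ℝ :=
    { toFun := fun v => F v
      map_add' := fun v v' => by
        have := hF 1 v v.2 v' v'.2
        rwa [one_smul, one_mul] at this
      map_smul' := fun c v => by
        have := hF c v v.2 0 h0
        rwa [add_zero, hF0, add_zero] at this }
  obtain ⟨v, hv, huniq⟩ := existsUnique_of_definite b
    (fun v hv => Subtype.ext (hA v v.2 hv)) f
  refine ⟨v, ⟨v.2, fun w hw => hv ⟨w, hw⟩⟩, fun v' hv' => ?_⟩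
  exact congrArg Subtype.val (huniq ⟨v', hv'.1⟩ fun w => hv'.2 w w.2)

/-- A sum of nonnegative local forms is zero only if each is. Then v is constant on every element,
and the boundary condition together with H¹ conformity makes all the constants zero. -/
theorem discreteForm_definite (hΩ : IsOpen Ω) (hc : Convex ℝ Ω) {ε : ℝ} (hε : 0 < ε)
    (hΦ : ∀ a b, MemLp (fun x => Φ x a b) ⊤ (volume.restrict Ω)) {β : ℝ} (hβ : 0 < β)
    (hpos : ∀ᵐ x ∂volume.restrict Ω, ∀ ξ : Fin 2 → ℝ,
      β * ∑ a, ξ a ^ 2 ≤ ∑ a, ∑ b, Φ x a b * ξ a * ξ b) {v : Plane → ℝ}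
    (hv : v ∈ Mesh.space P) (h : discreteForm P ε Φ v v = 0) : v = 0 := by
  have key := fun k => Polygon.localForm_nonneg (P k) ε hε
    (fun a b => MemLp.mono_measure (Measure.restrict_mono (T.carrier_subset hΩ hc k) le_rfl)
      (hΦ a b)) hβ (ae_restrict_of_ae_restrict_of_subset (T.carrier_subset hΩ hc k) hpos) v
  have h1 := (Finset.sum_eq_zero_iff_of_nonneg fun k _ => (key k).1).1 h
  refine Mesh.eq_zero_of_eq_const hΩ hc hv fun k => ⟨polyFun ((P k).valueProj v) 0, ?_⟩
  have h2 := (key k).2 (h1 k (Finset.mem_univ k))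
  exact (hv.2.2.2.1 k).eq_const h2.1 h2.2

theorem memLp_cof {A : Plane → Matrix (Fin 2) (Fin 2) ℝ} {p : ℝ≥0∞} {μ : Measure Plane}
    (h : ∀ a b, MemLp (fun x => A x a b) p μ) (a b : Fin 2) :
    MemLp (fun x => cof (A x) a b) p μ := by
  fin_cases a <;> fin_cases b <;>
    simp only [cof, Matrix.adjugate_fin_two, Matrix.transpose_apply, Fin.zero_eta, Fin.mk_one,
      Matrix.of_apply, Matrix.cons_val_zero, Matrix.cons_val_one, Matrix.cons_val_fin_one]
  exacts [h 1 1, (h 1 0).neg, (h 0 1).neg, h 0 0]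

end DiscreteProblem

end VEM

end

/-! ### Existence and uniqueness of the discrete solution. -/

theorem theorem3 (Ω : Set VEM.Plane) (hΩ_open : IsOpen Ω) (hΩ_convex : Convex ℝ Ω)
    (T : VEM.Mesh Ω) (ℓ : ℕ) (hℓ : 2 ≤ ℓ)
    (B : T.DofBases ℓ) (P : VEM.Mesh.Projections B)
    (ε : ℝ) (hε : 0 < ε)
    (u : VEM.Plane → ℝ) (hu : VEM.MemH2 Ω u)
    (hu_bdd : ∀ a b, MemLp (fun x => VEM.weakHessian Ω u x a b) ⊤ (volume.restrict Ω))
    (β : ℝ) (hβ : 0 < β)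
    (hu_pos : ∀ᵐ x ∂(volume.restrict Ω), ∀ ξ : Fin 2 → ℝ,
      β * ∑ a, ξ a ^ 2 ≤ ∑ a, ∑ b, VEM.cof (VEM.weakHessian Ω u x) a b * ξ a * ξ b)
    (φ : VEM.Plane → ℝ) (hφ : VEM.MemL2 Ω φ)
    (ψ : VEM.HMinusHalf Ω) (J : VEM.EdgePairing ψ T ℓ) :
    ∃! v : VEM.Plane → ℝ, v ∈ VEM.Mesh.space P ∧
      ∀ w ∈ VEM.Mesh.space P,
        VEM.discreteForm P ε (fun x => VEM.cof (VEM.weakHessian Ω u x)) v w =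
          (∫ x in Ω, φ x * w x) +
            ε * ∑ e ∈ T.boundaryEdges, J.toFun e ((P e.1).normalProj e.2 w) := by
  have hΦ := VEM.memLp_cof hu_bdd
  -- Bounds on the coefficient pass from Ω to the elements because the elements lie in Ω, not merely
  -- in its closure.
  have hΦK := fun k a b => MemLp.mono_measure
    (Measure.restrict_mono (T.carrier_subset hΩ_open hΩ_convex k) le_rfl) (hΦ a b)
  refine VEM.existsUnique_mem_space
    (A := VEM.discreteForm P ε fun x => VEM.cof (VEM.weakHessian Ω u x))
    (F := fun w => (∫ x in Ω, φ x * w x) +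
      ε * ∑ e ∈ T.boundaryEdges, J.toFun e ((P e.1).normalProj e.2 w))
    hΩ_open hΩ_convex ?_ ?_ ?_ fun v hv h =>
      VEM.discreteForm_definite hΩ_open hΩ_convex hε hΦ hβ hu_pos hv h
  · intro c v hv v' hv' w
    simp only [VEM.discreteForm]
    rw [Finset.mul_sum, ← Finset.sum_add_distrib]
    exact Finset.sum_congr rfl fun k _ => VEM.Polygon.localForm_smul_add_left (P k) ε (hΦK k) c
      (VEM.Mesh.hasTraces_of_mem_space hv k) (VEM.Mesh.hasTraces_of_mem_space hv' k) w
  · intro c w v hv v' hv'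
    simp only [VEM.discreteForm]
    rw [Finset.mul_sum, ← Finset.sum_add_distrib]
    exact Finset.sum_congr rfl fun k _ => VEM.Polygon.localForm_smul_add_right (P k) ε (hΦK k) c w
      (VEM.Mesh.hasTraces_of_mem_space hv k) (VEM.Mesh.hasTraces_of_mem_space hv' k)
  · intro c v hv v' hv'
    have h1 := VEM.Polygon.integral_mul_smul_add c hv.1.1.1 hv'.1.1.1 hφ
    have h2 : ∑ e ∈ T.boundaryEdges, J.toFun e ((P e.1).normalProj e.2 (c • v + v')) =
        c * (∑ e ∈ T.boundaryEdges, J.toFun e ((P e.1).normalProj e.2 v)) +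
          ∑ e ∈ T.boundaryEdges, J.toFun e ((P e.1).normalProj e.2 v') := by
      rw [Finset.mul_sum, ← Finset.sum_add_distrib]
      refine Finset.sum_congr rfl fun e _ => ?_
      rw [(P e.1).normalProj_smul_add c (VEM.Mesh.hasTraces_of_mem_space hv e.1)
        (VEM.Mesh.hasTraces_of_mem_space hv' e.1) e.2, map_add, map_smul, smul_eq_mul]
    simp only [mul_comm (φ _), h2]
    rw [show (∫ x in Ω, (c • v + v') x * φ x) = _ from h1]
    ring
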